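/- **Theorem 3.4.** Let $d\in\{1,2,3\}$ and let $\Omega\subset\mathbb R^d$ be a bounded polyhedral domain with a conforming triangulation $\mathcal T_H$ of mesh size $H=\max_{T\in\mathcal T_H}\operatorname{diam}T$, either by simplices ($P_1$) or by axis-parallel boxes ($Q_1$), so that $\Omega$ is the interior of the union of the elements. Let $\mathcal T_h$ be a conforming refinement of $\mathcal T_H$ of the same type. Let $V_H\subset V_h\subset H^1_0(\Omega)$ be the $P_1$ (resp. $Q_1$) finite element spaces on $\mathcal T_H$ and $\mathcal T_h$: the continuous functions that are affine (resp. of degree at most $1$ in each variable) on every element and vanish on $\partial\Omega$. Let $\mathcal A\in L_\infty(\Omega)^{d\times d}$ be symmetric with eigenvalues in $[\alpha,\beta]$ almost everywhere, $\alpha>0$, and let $y_d\in L_2(\Omega)$. Put $$a(y,z)=\int_\Omega(\mathcal A\nabla y)\cdot\nabla z\,dx,\qquad \|v\|_a=\sqrt{a(v,v)},\qquad \|(q,z)\|_{a\times a}^2=\|q\|_a^2+\|z\|_a^2,$$ $$\mathcal B\big((p,y),(q,z)\big)=a(p,q)+\int_\Omega yq\,dx+\int_\Omega pz\,dx-a(y,z).$$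 Let $\Pi_H\zeta\in V_H$ be the function whose value at each interior vertex $p$ of $\mathcal T_H$ is the average, over the elements $T\in\mathcal T_H$ having $p$ as a vertex, of $(Q_T\zeta)(p)$, where $Q_T$ is the $L_2(T)$-orthogonal projection onto $P_1(T)$ (resp. $Q_1(T)$). Let $K=\{v\in V_h:\Pi_Hv=0\}$. Define the ideal multiscale space by $$V_H^{ms,h}=\{\mathbf v\in V_h\times V_h:\ \mathcal B(\mathbf v,\mathbf w)=0\ \ \forall\,\mathbf w\in K\times K\}.$$ Then, for each $\mathbf v\in V_h\times V_h$, there is a unique $\mathcal C_h\mathbf v\in K\times K$ with $\mathcal B(\mathcal C_h\mathbf v,\mathbf w)=\mathcal B(\mathbf v,\mathbf w)$ for all $\mathbf w\in K\times K$, and $V_H^{ms,h}=(I-\mathcal C_h)(V_H\times V_H)$. There are a unique $(p_h,y_h)\in V_h\times V_h$ and a unique $(p_H^{ms,h},y_H^{ms,h})\in V_H^{ms,h}$ such that $$\mathcal B\big((p_h,y_h),(q,z)\big)=\int_\Omega y_dq\,dx\quad\forall\,(q,z)\in V_h\times V_h,$$ $$\mathcal B\big((p_H^{ms,h},y_H^{ms,h}),(q,z)\big)=\int_\Omega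 y_dq\,dx\quad\forall\,(q,z)\in V_H^{ms,h},$$ and $$\big\|(p_h,y_h)-(p_H^{ms,h},y_H^{ms,h})\big\|_{a\times a}\le\frac{C_\dagger}{\sqrt\alpha}\,H\,\|y_d\|_{L_2(\Omega)},$$ where the constant $C_\dagger\ge1$ depends only on the shape regularity of $\mathcal T_H$, that is, on a number $\sigma$ such that each $T\in\mathcal T_H$ contains a ball of some diameter $\rho_T$ with $\operatorname{diam}T\le\sigma\rho_T$. In particular, $C_\dagger$ does not depend on $\Omega$, $H$, $\mathcal T_h$, $\mathcal A$, $\alpha$, $\beta$ or $y_d$. -/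

import Mathlib

open MeasureTheory
open scoped Matrix Gradient

namespace LOD

/-- Euclidean space of dimension `d`. -/
abbrev E (d : ℕ) : Type := EuclideanSpace ℝ (Fin d)

/-- The two families of finite elements: affine polynomials on simplices (`P1`), and polynomials
of degree at most one in each variable on rectangular boxes (`Q1`). -/
inductive ElementKind
  | P1
  | Q1

/-- Vertex sets of nondegenerate simplices in dimension `d`. -/
def IsSimplex {d : ℕ} (V : Finset (E d)) : Prop :=
  V.card = d + 1 ∧ AffineIndependent ℝ (fun x : V => (x : E d))

/-- Vertex sets of nondegenerate boxes `[a 0, b 0] × ⋯ × [a (d-1), b (d-1)]`. -/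
def IsBox {d : ℕ} (V : Finset (E d)) : Prop :=
  ∃ a b : Fin d → ℝ, (∀ i, a i < b i) ∧ ∀ x : E d, x ∈ V ↔ ∀ i, x i = a i ∨ x i = b i

/-- The admissible cells of each family, given by their vertex sets. -/
def IsCell {d : ℕ} (k : ElementKind) (V : Finset (E d)) : Prop :=
  match k with
  | .P1 => IsSimplex V
  | .Q1 => IsBox V

/-- The closed cell with vertex set `V`. -/
def cell {d : ℕ} (V : Finset (E d)) : Set (E d) := convexHull ℝ (V : Set (E d))

/-- The polynomials `c + ∑ gᵢ xᵢ`, respectively `∑_S c_S ∏_{i ∈ S} xᵢ` (`S ⊆ {0, …, d-1}`). -/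
def polySpace (k : ElementKind) (d : ℕ) : Set (E d → ℝ) :=
  match k with
  | .P1 => {f | ∃ (c : ℝ) (g : Fin d → ℝ), ∀ x, f x = c + ∑ i, g i * x i}
  | .Q1 => {f | ∃ c : Finset (Fin d) → ℝ, ∀ x, f x = ∑ S, c S * ∏ i ∈ S, x i}

/-- A conforming mesh: finitely many cells of one family, any two of which meet exactly in the
convex hull of their common vertices (a common face, possibly empty). -/
structure Mesh (k : ElementKind) (d : ℕ) where
  /-- the vertex sets of the cells -/
  cells : Finset (Finset (E d))
  isCell : ∀ V ∈ cells, IsCell k V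
  conforming : ∀ V ∈ cells, ∀ W ∈ cells,
    cell V ∩ cell W = convexHull ℝ ((V : Set (E d)) ∩ (W : Set (E d)))

namespace Mesh

variable {k : ElementKind} {d : ℕ}

/-- The open polyhedral set which is triangulated by the mesh. -/
def domain (M : Mesh k d) : Set (E d) := interior (⋃ V ∈ M.cells, cell V)

/-- The mesh size: the largest diameter of a cell. -/
noncomputable def size (M : Mesh k d) : ℝ :=
  sSup ((fun V => Metric.diam (cell V)) '' (M.cells : Set (Finset (E d))))

/-- Every cell contains a ball of some diameter `ρ` such that the diameter of the cell is at
most `σ ρ`. -/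
def ShapeRegular (M : Mesh k d) (σ : ℝ) : Prop :=
  ∀ V ∈ M.cells, ∃ (c : E d) (ρ : ℝ), 0 < ρ ∧ Metric.ball c (ρ / 2) ⊆ cell V ∧
    Metric.diam (cell V) ≤ σ * ρ

/-- `M` is a refinement of `N`: both triangulate the same set and each cell of `M` lies in a cell
of `N`. -/
def Refines (M N : Mesh k d) : Prop :=
  M.domain = N.domain ∧ ∀ V ∈ M.cells, ∃ W ∈ N.cells, cell V ⊆ cell W

/-- The conforming finite element space with homogeneous Dirichlet boundary conditions: continuous
functions that are polynomials of the family on each cell and vanish outside the domain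
(functions on the domain are extended by zero). -/
def feSpace (M : Mesh k d) : Set (E d → ℝ) :=
  {v | Continuous v ∧ (∀ V ∈ M.cells, ∃ q ∈ polySpace k d, ∀ x ∈ cell V, v x = q x) ∧
    ∀ x, x ∉ M.domain → v x = 0}

/-- The interior vertices of the mesh. -/
def nodes (M : Mesh k d) : Set (E d) := {p | p ∈ M.domain ∧ ∃ V ∈ M.cells, p ∈ V}

open Classical in
/-- The cells that have `p` as a vertex. -/
noncomputable def star (M : Mesh k d) (p : E d) : Finset (Finset (E d)) :=
  M.cells.filter (fun V => p ∈ V)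

end Mesh

/-- `q` is the orthogonal projection of `v`, with respect to the `L²` inner product on the cell
with vertices `V`, onto the polynomials of the family. -/
def IsLocalProj {d : ℕ} (k : ElementKind) (V : Finset (E d)) (v q : E d → ℝ) : Prop :=
  q ∈ polySpace k d ∧ ∀ r ∈ polySpace k d, ∫ x in cell V, (v x - q x) * r x = 0

/-- `w` is the quasi-interpolant of `v` on the mesh `M`: it is the finite element function whose
value at each interior vertex `p` is the average, over the cells that share `p`, of the values
at `p` of the local `L²` projections of `v`. -/
def IsQuasiInterp {k : ElementKind} {d : ℕ} (M : Mesh k d) (v w : E d → ℝ) : Prop :=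
  w ∈ M.feSpace ∧ ∃ Q : Finset (E d) → E d → ℝ, (∀ V ∈ M.cells, IsLocalProj k V v (Q V)) ∧
    ∀ p ∈ M.nodes, w p = (1 / ((M.star p).card : ℝ)) * ∑ V ∈ M.star p, Q V p

/-- The functions of the fine space whose quasi-interpolant on the coarse mesh is zero. -/
def kernelSpace {k : ElementKind} {d : ℕ} (TH Th : Mesh k d) : Set (E d → ℝ) :=
  {v | v ∈ Th.feSpace ∧ IsQuasiInterp TH v 0}

/-- A diffusion matrix: components in `L^∞(Ω)`, and almost everywhere in `Ω` symmetric with all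
eigenvalues in `[α, β]`. -/
structure IsDiffusion {d : ℕ} (Ω : Set (E d)) (A : E d → Matrix (Fin d) (Fin d) ℝ)
    (α β : ℝ) : Prop where
  memLp : ∀ i j, MemLp (fun x => A x i j) ⊤ (volume.restrict Ω)
  symm : ∀ᵐ x ∂(volume.restrict Ω), (A x).IsSymm
  spec : ∀ᵐ x ∂(volume.restrict Ω), ∀ μ ∈ spectrum ℝ (A x), α ≤ μ ∧ μ ≤ β

/-- The energy form `∫_Ω (A ∇y) · ∇z`. On the finite element functions the pointwise gradient
exists almost everywhere and is the weak gradient. -/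
noncomputable def energy {d : ℕ} (Ω : Set (E d)) (A : E d → Matrix (Fin d) (Fin d) ℝ)
    (y z : E d → ℝ) : ℝ :=
  ∫ x in Ω, (A x *ᵥ (∇ y x).ofLp) ⬝ᵥ (∇ z x).ofLp

/-- The form of the optimality system:
`B((p,y),(q,z)) = a(p,q) + ∫_Ω y q + ∫_Ω p z - a(y,z)`. -/
noncomputable def kktForm {d : ℕ} (Ω : Set (E d)) (A : E d → Matrix (Fin d) (Fin d) ℝ)
    (v w : (E d → ℝ) × (E d → ℝ)) : ℝ :=
  energy Ω A v.1 w.1 + (∫ x in Ω, v.2 x * w.1 x) + (∫ x in Ω, v.1 x * w.2 x)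
    - energy Ω A v.2 w.2

/-- The norm `(‖q‖_a² + ‖z‖_a²)^{1/2}` on pairs. -/
noncomputable def energyNorm {d : ℕ} (Ω : Set (E d)) (A : E d → Matrix (Fin d) (Fin d) ℝ)
    (v : (E d → ℝ) × (E d → ℝ)) : ℝ :=
  Real.sqrt (energy Ω A v.1 v.1 + energy Ω A v.2 v.2)

/-- `u` is the Galerkin solution in `X` of the optimality system with desired state `yd`. -/
def IsGalerkin {d : ℕ} (Ω : Set (E d)) (A : E d → Matrix (Fin d) (Fin d) ℝ) (yd : E d → ℝ)
    (X : Set ((E d → ℝ) × (E d → ℝ))) (u : (E d → ℝ) × (E d → ℝ)) : Prop :=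
  u ∈ X ∧ ∀ w ∈ X, kktForm Ω A u w = ∫ x in Ω, yd x * w.1 x

/-- `c = C_h v`: the pair in `K × K`, `K` the kernel space, with `B(c, w) = B(v, w)` for all `w`
in `K × K`. -/
def IsCorrector {k : ElementKind} {d : ℕ} (TH Th : Mesh k d)
    (A : E d → Matrix (Fin d) (Fin d) ℝ) (v c : (E d → ℝ) × (E d → ℝ)) : Prop :=
  c ∈ kernelSpace TH Th ×ˢ kernelSpace TH Th ∧
    ∀ w ∈ kernelSpace TH Th ×ˢ kernelSpace TH Th,
      kktForm Th.domain A c w = kktForm Th.domain A v w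

/-- The ideal multiscale space: all pairs in the fine space that are `B`-orthogonal to
`K × K`. -/
def msSpace {k : ElementKind} {d : ℕ} (TH Th : Mesh k d)
    (A : E d → Matrix (Fin d) (Fin d) ℝ) : Set ((E d → ℝ) × (E d → ℝ)) :=
  {v | v ∈ Th.feSpace ×ˢ Th.feSpace ∧
    ∀ w ∈ kernelSpace TH Th ×ˢ kernelSpace TH Th, kktForm Th.domain A v w = 0}

/-- The corrected coarse space `(I - C_h)(V_H × V_H)`. -/
def correctedSpace {k : ElementKind} {d : ℕ} (TH Th : Mesh k d)
    (A : E d → Matrix (Fin d) (Fin d) ℝ) : Set ((E d → ℝ) × (E d → ℝ)) :=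
  {u | ∃ v ∈ TH.feSpace ×ˢ TH.feSpace, ∃ c, IsCorrector TH Th A v c ∧ u = v - c}

end LOD

/-! Write X = V_h × V_h and N = K × K. Testing B at (p, y) with (p, -y) cancels the two mass terms
and leaves ‖(p, y)‖²_{a×a} (`kktForm_reflect`). For a subspace S of V_h the product S × S is
invariant under this reflection, so the indefinite form B is nondegenerate on X and on N. In finite
dimension this yields the existence and uniqueness claims. Since B is symmetric, X is the direct sum
of N and its B-orthogonal complement, the multiscale space. Hence the Galerkin error e is the
B-projection of the fine solution onto N, and it solves the same problem posed in N
(`sub_isGalerkin`). Testing with the reflected error bounds ‖e‖²_{a×a} by ‖y_d‖ ‖e₁‖ in L². The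
corrected coarse space is the whole complement because V_h = V_H + K, which holds since Π_H
reproduces V_H.

What remains is the Poincaré inequality ‖v‖ ≤ C H ‖∇v‖ on K with C depending only on d and σ
(`integral_sq_le_of_quasiInterp_zero`). On a coarse cell T the function v - Q_T v is controlled by
the Poincaré inequality on convex bodies, so it suffices to bound the nodal values (Q_T v)(p). By an
inverse estimate such a value is close to the mean of v over T, and the means over two cells with a
common facet are close, because an affine map fixing the facet carries one cell to the other. Now
cross facets at p, starting from T (`reachable_hasFreeFacet_or`). Either a cell with a boundary
facet at p is reached; v vanishes on that facet, so the mean over that cell is small. Or the cells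
reached cover a neighborhood of p; then p is an interior vertex, every cell at p is reached, the
values (Q_W v)(p) are mutually close, and their sum is zero because Π_H v = 0. No regularity of the
boundary enters.

Shape regularity bounds the number of cells at p (`card_star_le`), hence the length of the chains,
and makes neighboring diameters comparable when d ≥ 2. Simplices and boxes are treated together
through the affine functions that cut out their facets (`CellFrame`). -/

namespace LOD

/-! ### Estimates along lines for Lipschitz functions -/

open Set Filter Topology
open scoped ENNReal NNReal

/-- The squared norm of the gradient, set to `∞` where the function is not differentiable. -/
noncomputable def gradSq {d : ℕ} (f : E d → ℝ) (z : E d) : ℝ≥0∞ :=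
  open Classical in if DifferentiableAt ℝ f z then ‖∇ f z‖ₑ ^ 2 else ⊤

lemma measurable_gradient {d : ℕ} (f : E d → ℝ) : Measurable (∇ f) := by
  have : (∇ f) = fun x => (InnerProductSpace.toDual ℝ (E d)).symm (fderiv ℝ f x) := rfl
  rw [this]
  exact (InnerProductSpace.toDual ℝ (E d)).symm.continuous.measurable.comp (measurable_fderiv ℝ f)

lemma measurable_gradSq {d : ℕ} (f : E d → ℝ) : Measurable (gradSq f) := by
  classical
  unfold gradSq
  exact Measurable.ite (measurableSet_of_differentiableAt ℝ f)
    ((measurable_gradient f).enorm.pow_const 2) measurable_const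

lemma gradSq_ae_eq {d : ℕ} {f : E d → ℝ} {K : ℝ≥0} (hf : LipschitzWith K f) :
    ∀ᵐ z : E d, gradSq f z = ‖∇ f z‖ₑ ^ 2 := by
  filter_upwards [hf.ae_differentiableAt (μ := volume)] with z hz
  simp [gradSq, hz]

lemma sq_lintegral_le {X : Type*} [MeasurableSpace X] (μ : Measure X) {h : X → ℝ≥0∞}
    (hh : AEMeasurable h μ) : (∫⁻ x, h x ∂μ) ^ 2 ≤ μ univ * ∫⁻ x, h x ^ 2 ∂μ := by
  have := ENNReal.lintegral_mul_le_Lp_mul_Lq μ Real.HolderConjugate.two_two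
    (f := fun _ => 1) (g := h) aemeasurable_const hh
  simp only [Pi.mul_apply, one_mul, ENNReal.one_rpow, lintegral_const] at this
  calc (∫⁻ x, h x ∂μ) ^ 2 ≤ ((μ univ) ^ (1 / 2 : ℝ) * (∫⁻ x, h x ^ (2 : ℝ) ∂μ) ^ (1 / 2 : ℝ)) ^ 2 := by
        gcongr
    _ = _ := by
        rw [mul_pow, ← ENNReal.rpow_natCast, ← ENNReal.rpow_natCast, ← ENNReal.rpow_mul,
          ← ENNReal.rpow_mul]
        norm_num

/-- A given line may lie inside the null set where `f` is not differentiable, so Rademacher's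
theorem is of no use on it. The value `∞` of `gradSq` makes the bound true at every point; the null
set is discarded only after integration over space. -/
lemma enorm_deriv_line_sq_le {d : ℕ} (f : E d → ℝ) (x e : E d) (t : ℝ) :
    ‖deriv (fun t : ℝ => f (x + t • e)) t‖ₑ ^ 2 ≤ ‖e‖ₑ ^ 2 * gradSq f (x + t • e) := by
  rcases eq_or_ne e 0 with rfl | he
  · simp
  by_cases hd : DifferentiableAt ℝ f (x + t • e)
  · have h1 : HasDerivAt (fun t : ℝ => x + t • e) e t := by
      simpa using ((hasDerivAt_id t).smul_const e).const_add x
    have h2 : deriv (fun t : ℝ => f (x + t • e)) t = inner ℝ (∇ f (x + t • e)) e := by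
      rw [inner_gradient_left]
      exact (hd.hasFDerivAt.comp_hasDerivAt t h1).deriv
    rw [h2, gradSq, if_pos hd, ← mul_pow]
    gcongr
    rw [← ofReal_norm, ← ofReal_norm, ← ofReal_norm,
      ← ENNReal.ofReal_mul (norm_nonneg _)]
    refine ENNReal.ofReal_le_ofReal ?_
    rw [mul_comm]
    exact norm_inner_le_norm _ _
  · rw [gradSq, if_neg hd, ENNReal.mul_top]
    · exact le_top
    · simpa using he

/-- Fundamental theorem of calculus for the absolutely continuous restriction to the segment, then
Cauchy–Schwarz. The length `τ ≤ 1` of the interval is dropped. -/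
lemma enorm_sub_line_sq_le {d : ℕ} {f : E d → ℝ} {K : ℝ≥0} (hf : LipschitzWith K f) (x e : E d)
    {τ : ℝ} (h0 : 0 ≤ τ) (h1 : τ ≤ 1) :
    ‖f (x + τ • e) - f x‖ₑ ^ 2 ≤ ‖e‖ₑ ^ 2 * ∫⁻ t in Ioc 0 τ, gradSq f (x + t • e) := by
  have hlin : LipschitzWith ‖e‖₊ (fun t : ℝ => x + t • e) := by
    refine LipschitzWith.of_dist_le_mul fun s t => ?_
    rw [dist_add_left, dist_eq_norm, ← sub_smul, norm_smul, mul_comm, Real.dist_eq,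
      Real.norm_eq_abs]
    rfl
  have hac := ((hf.comp hlin).lipschitzOnWith (s := uIcc 0 τ)).absolutelyContinuousOnInterval
  have hftc := hac.integral_deriv_eq_sub
  have hm : Measurable (deriv (f ∘ fun t : ℝ => x + t • e)) := measurable_deriv _
  have e1 : f (x + τ • e) - f x = ∫ t in Ioc 0 τ, deriv (f ∘ fun t : ℝ => x + t • e) t := by
    rw [← intervalIntegral.integral_of_le h0, hftc]; simp
  rw [e1]
  calc _ ≤ (∫⁻ t in Ioc 0 τ, ‖deriv (f ∘ fun t : ℝ => x + t • e) t‖ₑ) ^ 2 := by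
        gcongr; exact enorm_integral_le_lintegral_enorm _
    _ ≤ (volume.restrict (Ioc 0 τ)) univ *
          ∫⁻ t in Ioc 0 τ, ‖deriv (f ∘ fun t : ℝ => x + t • e) t‖ₑ ^ 2 :=
        sq_lintegral_le _ hm.enorm.aemeasurable
    _ ≤ 1 * ∫⁻ t in Ioc 0 τ, ‖e‖ₑ ^ 2 * gradSq f (x + t • e) := by
        gcongr
        · simpa using h1
        · exact enorm_deriv_line_sq_le f x e _
    _ = _ := by
        rw [one_mul, lintegral_const_mul]
        exact (measurable_gradSq f).comp (by fun_prop)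

/-- The shift `x ↦ x + τ x • e` need not preserve measure. The line integral is therefore enlarged
to all `t ∈ (0, 1]` with the integrand cut off outside `D`; after Fubini each fixed `t` is a genuine
translation. -/
lemma lintegral_sub_shift_le {d : ℕ} {f : E d → ℝ} {K : ℝ≥0} (hf : LipschitzWith K f)
    {D : Set (E d)} (hD : MeasurableSet D) (e : E d) {τ : E d → ℝ}
    (h0 : ∀ x ∈ D, 0 ≤ τ x) (h1 : ∀ x ∈ D, τ x ≤ 1)
    (hin : ∀ x ∈ D, ∀ t, 0 ≤ t → t ≤ τ x → x + t • e ∈ D) :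
    ∫⁻ x in D, ‖f (x + τ x • e) - f x‖ₑ ^ 2 ≤ ‖e‖ₑ ^ 2 * ∫⁻ x in D, gradSq f x := by
  have hmG : Measurable (D.indicator (gradSq f)) := (measurable_gradSq f).indicator hD
  calc ∫⁻ x in D, ‖f (x + τ x • e) - f x‖ₑ ^ 2
      ≤ ∫⁻ x in D, ‖e‖ₑ ^ 2 * ∫⁻ t in Ioc (0 : ℝ) 1, D.indicator (gradSq f) (x + t • e) := by
        refine setLIntegral_mono' hD fun x hx => ?_
        refine (enorm_sub_line_sq_le hf x e (h0 x hx) (h1 x hx)).trans (mul_le_mul' le_rfl ?_)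
        calc ∫⁻ t in Ioc 0 (τ x), gradSq f (x + t • e)
            = ∫⁻ t in Ioc 0 (τ x), D.indicator (gradSq f) (x + t • e) := by
              refine setLIntegral_congr_fun measurableSet_Ioc fun t ht => ?_
              rw [indicator_of_mem (hin x hx t ht.1.le ht.2)]
          _ ≤ _ := lintegral_mono_set (Ioc_subset_Ioc_right (h1 x hx))
    _ ≤ ∫⁻ x, ‖e‖ₑ ^ 2 * ∫⁻ t in Ioc (0 : ℝ) 1, D.indicator (gradSq f) (x + t • e) :=
        setLIntegral_le_lintegral _ _
    _ = ‖e‖ₑ ^ 2 * ∫⁻ x, ∫⁻ t in Ioc (0 : ℝ) 1, D.indicator (gradSq f) (x + t • e) := by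
        rw [lintegral_const_mul]
        exact Measurable.lintegral_prod_right' (f := fun p : E d × ℝ =>
          D.indicator (gradSq f) (p.1 + p.2 • e)) (hmG.comp (by fun_prop))
    _ = ‖e‖ₑ ^ 2 * ∫⁻ t in Ioc (0 : ℝ) 1, ∫⁻ x, D.indicator (gradSq f) (x + t • e) := by
        rw [lintegral_lintegral_swap]
        exact (hmG.comp (by fun_prop : Measurable
          fun p : E d × ℝ => p.1 + p.2 • e)).aemeasurable
    _ = _ := by
        simp_rw [lintegral_add_right_eq_self (fun x => D.indicator (gradSq f) x)]
        simp [lintegral_indicator hD]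

lemma lintegral_comp_affine {d : ℕ} {h : E d → ℝ≥0∞} (hh : Measurable h) (c : E d) {s : ℝ}
    (hs : s ≠ 0) :
    ∫⁻ x, h (c + s • x) = ENNReal.ofReal |(s ^ d)⁻¹| * ∫⁻ x, h x := by
  have h1 : ∫⁻ x, h (c + s • x) = ∫⁻ y, h (c + y) ∂(Measure.map (fun x => s • x) volume) := by
    rw [lintegral_map (by fun_prop) (by fun_prop)]
  have h2 := Measure.map_addHaar_smul (volume : Measure (E d)) hs
  simp only [finrank_euclideanSpace, Fintype.card_fin] at h2
  rw [h1]
  change ∫⁻ y, h (c + y) ∂(Measure.map (s • ·) volume) = _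
  rw [h2, lintegral_smul_measure, lintegral_add_left_eq_self h c, smul_eq_mul]

lemma lintegral_comp_affine_le {d : ℕ} {h : E d → ℝ≥0∞} (hh : Measurable h) (c : E d) {s r : ℝ}
    (hr : 0 < r) (hs : r ≤ s) :
    ∫⁻ x, h (c + s • x) ≤ ENNReal.ofReal ((r ^ d)⁻¹) * ∫⁻ x, h x := by
  have h0 : 0 < s := hr.trans_le hs
  rw [lintegral_comp_affine hh c h0.ne']
  gcongr
  rw [abs_of_pos (by positivity)]
  gcongr

/-- After bounding the difference by the integral over the segment, fix `t` and substitute in the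
variable whose coefficient in `t x + (1 - t) y` is at least `1/2`. The Jacobian factor is then at
most `2 ^ d`. -/
lemma lintegral_pair_le {d : ℕ} {f : E d → ℝ} {K : ℝ≥0} (hf : LipschitzWith K f)
    {D : Set (E d)} (hD : MeasurableSet D) (hc : Convex ℝ D) {δ : ℝ≥0∞}
    (hδ : ∀ x ∈ D, ∀ y ∈ D, ‖x - y‖ₑ ≤ δ) :
    ∫⁻ x in D, ∫⁻ y in D, ‖f x - f y‖ₑ ^ 2 ≤
      δ ^ 2 * (2 ^ d * volume D * ∫⁻ x in D, gradSq f x) := by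
  set G := D.indicator (gradSq f) with hG
  have hmG : Measurable G := (measurable_gradSq f).indicator hD
  have hmem : ∀ x ∈ D, ∀ y ∈ D, ∀ t ∈ Ioc (0 : ℝ) 1, y + t • (x - y) ∈ D := fun x hx y hy t ht =>
    hc.add_smul_sub_mem hy hx ⟨ht.1.le, ht.2⟩
  have hIG : ∫⁻ x, G x = ∫⁻ x in D, gradSq f x := lintegral_indicator hD _
  have hm3 : Measurable fun p : (E d × E d) × ℝ => G (p.1.2 + p.2 • (p.1.1 - p.1.2)) :=
    hmG.comp (by fun_prop)
  -- the estimate at fixed `t`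
  have hscale : ∀ (c : E d) (s : ℝ), 1 / 2 ≤ s → ∫⁻ x in D, G (c + s • x) ≤ 2 ^ d * ∫⁻ x, G x := by
    intro c s hs
    refine (setLIntegral_le_lintegral _ _).trans
      ((lintegral_comp_affine_le hmG c (by norm_num) hs).trans_eq ?_)
    congr 1
    rw [one_div, inv_pow, inv_inv, ENNReal.ofReal_pow (by norm_num)]
    norm_num
  have hfix : ∀ t : ℝ, ∫⁻ x in D, ∫⁻ y in D, G (y + t • (x - y)) ≤
      2 ^ d * volume D * ∫⁻ x, G x := by
    intro t
    rcases le_total (1 / 2) t with ht | ht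
    · rw [lintegral_lintegral_swap (f := fun x y => G (y + t • (x - y)))
        (hmG.comp (by fun_prop : Measurable fun p : E d × E d => p.2 + t • (p.1 - p.2))).aemeasurable]
      calc _ ≤ ∫⁻ y in D, 2 ^ d * ∫⁻ x, G x := by
            refine lintegral_mono fun y => ?_
            refine le_trans (le_of_eq ?_) (hscale ((1 - t) • y) t ht)
            refine lintegral_congr fun x => ?_
            congr 1
            module
        _ = _ := by simp; ring
    · calc _ ≤ ∫⁻ y in D, 2 ^ d * ∫⁻ x, G x := by
            refine lintegral_mono fun x => ?_
            refine le_trans (le_of_eq ?_) (hscale (t • x) (1 - t) (by linarith))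
            refine lintegral_congr fun y => ?_
            congr 1
            module
        _ = _ := by simp; ring
  calc ∫⁻ x in D, ∫⁻ y in D, ‖f x - f y‖ₑ ^ 2
      ≤ ∫⁻ x in D, ∫⁻ y in D, δ ^ 2 * ∫⁻ t in Ioc (0 : ℝ) 1, G (y + t • (x - y)) := by
        refine setLIntegral_mono' hD fun x hx => setLIntegral_mono' hD fun y hy => ?_
        have := enorm_sub_line_sq_le hf y (x - y) zero_le_one le_rfl
        rw [one_smul, add_sub_cancel] at this
        refine this.trans ?_
        gcongr ?_ ^ 2 * ?_
        · exact hδ x hx y hy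
        · refine le_of_eq (setLIntegral_congr_fun measurableSet_Ioc fun t ht => ?_)
          simp only [hG]
          rw [indicator_of_mem (hmem x hx y hy t ht)]
    _ = δ ^ 2 * ∫⁻ x in D, ∫⁻ y in D, ∫⁻ t in Ioc (0 : ℝ) 1, G (y + t • (x - y)) := by
        have hm2 : Measurable fun p : E d × E d =>
            ∫⁻ t in Ioc (0 : ℝ) 1, G (p.2 + t • (p.1 - p.2)) :=
          Measurable.lintegral_prod_right' hm3
        rw [← lintegral_const_mul _ (Measurable.lintegral_prod_right' hm2)]
        refine lintegral_congr fun x => ?_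
        rw [lintegral_const_mul]
        exact hm2.comp (by fun_prop : Measurable fun y => (x, y))
    _ = δ ^ 2 * ∫⁻ t in Ioc (0 : ℝ) 1, ∫⁻ x in D, ∫⁻ y in D, G (y + t • (x - y)) := by
        congr 1
        rw [lintegral_lintegral_swap (f := fun t x => ∫⁻ y in D, G (y + t • (x - y)))]
        · refine lintegral_congr fun x => ?_
          rw [lintegral_lintegral_swap]
          exact (hmG.comp (by fun_prop : Measurable
            fun p : E d × ℝ => p.1 + p.2 • (x - p.1))).aemeasurable
        · exact (Measurable.lintegral_prod_right' (f := fun p : (ℝ × E d) × E d =>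
            G (p.2 + p.1.1 • (p.1.2 - p.2))) (hmG.comp (by fun_prop))).aemeasurable
    _ ≤ δ ^ 2 * ∫⁻ t in Ioc (0 : ℝ) 1, 2 ^ d * volume D * ∫⁻ x, G x := by
        gcongr with t; exact hfix t
    _ = _ := by rw [hIG]; simp

end LOD

/-! ### Poincaré inequality on convex bodies -/

namespace LOD

open Set Filter Topology
open scoped ENNReal NNReal

lemma norm_gradient_le {d : ℕ} {f : E d → ℝ} {K : ℝ≥0} (hf : LipschitzWith K f) (x : E d) :
    ‖∇ f x‖ ≤ K := by
  have := norm_fderiv_le_of_lipschitz ℝ hf (x₀ := x)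
  rwa [← toDual_gradient, LinearIsometryEquiv.norm_map] at this

lemma integrableOn_norm_gradient_sq {d : ℕ} {f : E d → ℝ} {K : ℝ≥0} (hf : LipschitzWith K f)
    {D : Set (E d)} (hD : volume D ≠ ⊤) : IntegrableOn (fun x => ‖∇ f x‖ ^ 2) D := by
  refine Measure.integrableOn_of_bounded (M := (K : ℝ) ^ 2) hD
    ((measurable_gradient f).norm.pow_const 2).aestronglyMeasurable ?_
  refine Eventually.of_forall fun x => ?_
  rw [Real.norm_of_nonneg (by positivity)]
  gcongr
  exact norm_gradient_le hf x

lemma enorm_sq_eq_ofReal (a : ℝ) : ‖a‖ₑ ^ 2 = ENNReal.ofReal (a ^ 2) := by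
  rw [← ofReal_norm, ← ENNReal.ofReal_pow (norm_nonneg _), Real.norm_eq_abs, sq_abs]

lemma lintegral_gradSq {d : ℕ} {f : E d → ℝ} {K : ℝ≥0} (hf : LipschitzWith K f)
    {D : Set (E d)} (hD : volume D ≠ ⊤) :
    ∫⁻ x in D, gradSq f x = ENNReal.ofReal (∫ x in D, ‖∇ f x‖ ^ 2) := by
  rw [ofReal_integral_eq_lintegral_ofReal (integrableOn_norm_gradient_sq hf hD)
    (Eventually.of_forall fun x => by positivity)]
  refine lintegral_congr_ae ?_
  filter_upwards [ae_restrict_of_ae (gradSq_ae_eq hf)] with x hx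
  rw [hx, ← ofReal_norm, ENNReal.ofReal_pow (norm_nonneg _)]

lemma integral_sq_le_of_lintegral {d : ℕ} {D : Set (E d)} {u : E d → ℝ}
    (hu : AEStronglyMeasurable u (volume.restrict D)) {c : ℝ} (hc : 0 ≤ c)
    (h : ∫⁻ x in D, ‖u x‖ₑ ^ 2 ≤ ENNReal.ofReal c) : ∫ x in D, u x ^ 2 ≤ c := by
  rw [integral_eq_lintegral_of_nonneg_ae (Eventually.of_forall fun x => sq_nonneg _)
    (hu.pow 2)]
  refine ENNReal.toReal_le_of_le_ofReal hc ?_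
  simpa only [enorm_sq_eq_ofReal] using h

/-- A line estimate: the difference between a function and its translate along a segment that
stays in the set is controlled by the gradient. -/
lemma integral_sub_shift_sq_le {d : ℕ} {f : E d → ℝ} {K : ℝ≥0} (hf : LipschitzWith K f)
    {D : Set (E d)} (hD : MeasurableSet D) (hDv : volume D ≠ ⊤) (e : E d) {τ : E d → ℝ}
    (hτ : Continuous τ) (h0 : ∀ x ∈ D, 0 ≤ τ x) (h1 : ∀ x ∈ D, τ x ≤ 1)
    (hin : ∀ x ∈ D, ∀ t, 0 ≤ t → t ≤ τ x → x + t • e ∈ D) :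
    ∫ x in D, (f (x + τ x • e) - f x) ^ 2 ≤ ‖e‖ ^ 2 * ∫ x in D, ‖∇ f x‖ ^ 2 := by
  have hfc := hf.continuous
  refine integral_sq_le_of_lintegral (by fun_prop) (by positivity) ?_
  refine (lintegral_sub_shift_le hf hD e h0 h1 hin).trans_eq ?_
  rw [lintegral_gradSq hf hDv, ENNReal.ofReal_mul (by positivity),
    ENNReal.ofReal_pow (norm_nonneg _), ofReal_norm]

/-- `f x` minus the mean is the mean of `f x - f y`; Cauchy–Schwarz in `y`, then one factor `volume
D` is cancelled. -/
lemma enorm_sub_average_sq_le {d : ℕ} {f : E d → ℝ} (hf : Continuous f)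
    {D : Set (E d)} (hD : IsCompact D) (hD0 : volume D ≠ 0) (x : E d) :
    ‖f x - ⨍ y in D, f y‖ₑ ^ 2 * volume D ≤ ∫⁻ y in D, ‖f x - f y‖ₑ ^ 2 := by
  have hDv : volume D ≠ ⊤ := hD.measure_lt_top.ne
  have hint : IntegrableOn f D := hf.continuousOn.integrableOn_compact hD
  have hr : volume.real D ≠ 0 := (ENNReal.toReal_ne_zero.2 ⟨hD0, hDv⟩)
  have h1 : volume.real D * (f x - ⨍ y in D, f y) = ∫ y in D, (f x - f y) := by
    rw [integral_sub (f := fun _ => f x) (integrableOn_const hDv) hint, setAverage_eq]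
    simp only [integral_const, smul_eq_mul, MeasurableSet.univ, measureReal_restrict_apply,
      univ_inter]
    field_simp
  have h2 := sq_lintegral_le (volume.restrict D) (h := fun y => ‖f x - f y‖ₑ) (by fun_prop)
  have h3 : (volume D * ‖f x - ⨍ y in D, f y‖ₑ) ^ 2 ≤ (∫⁻ y in D, ‖f x - f y‖ₑ) ^ 2 := by
    gcongr
    refine le_trans (le_of_eq ?_) (enorm_integral_le_lintegral_enorm _)
    rw [← h1, enorm_mul, Measure.real, Real.enorm_of_nonneg ENNReal.toReal_nonneg,
      ENNReal.ofReal_toReal hDv]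
  have h4 := h3.trans h2
  rw [Measure.restrict_apply_univ, mul_pow, sq (volume D), mul_assoc] at h4
  rw [mul_comm]
  exact (ENNReal.mul_le_mul_iff_right hD0 hDv).1 h4

/-- The Poincaré inequality on convex bodies. -/
lemma integral_sub_average_sq_le {d : ℕ} {f : E d → ℝ} {K : ℝ≥0} (hf : LipschitzWith K f)
    {D : Set (E d)} (hD : IsCompact D) (hc : Convex ℝ D) (hD0 : volume D ≠ 0) :
    ∫ x in D, (f x - ⨍ y in D, f y) ^ 2 ≤
      2 ^ d * Metric.diam D ^ 2 * ∫ x in D, ‖∇ f x‖ ^ 2 := by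
  have hDv : volume D ≠ ⊤ := hD.measure_lt_top.ne
  have hfc := hf.continuous
  refine integral_sq_le_of_lintegral (by fun_prop) (by positivity) ?_
  -- Both sides carry the factor `volume D`, so the constant retains only the diameter and the
  -- dimension, not the shape of `D`.
  have h1 : (∫⁻ x in D, ‖f x - ⨍ y in D, f y‖ₑ ^ 2) * volume D ≤
      ENNReal.ofReal (Metric.diam D) ^ 2 * (2 ^ d * volume D * ∫⁻ x in D, gradSq f x) := by
    rw [← lintegral_mul_const _ (by fun_prop)]
    refine (lintegral_mono fun x => enorm_sub_average_sq_le hfc hD hD0 x).trans ?_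
    refine lintegral_pair_le hf hD.measurableSet hc fun x hx y hy => ?_
    rw [← ofReal_norm, ← dist_eq_norm]
    exact ENNReal.ofReal_le_ofReal (Metric.dist_le_diam_of_mem hD.isBounded hx hy)
  rw [lintegral_gradSq hf hDv] at h1
  rw [← ENNReal.mul_le_mul_iff_left hD0 hDv]
  refine h1.trans_eq ?_
  rw [ENNReal.ofReal_mul (by positivity), ENNReal.ofReal_mul (by positivity),
    ENNReal.ofReal_pow Metric.diam_nonneg, ENNReal.ofReal_pow (by norm_num), ENNReal.ofReal_ofNat]
  ring

/-- The variance of `u` over `D` is nonnegative. -/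
lemma sq_average_le {d : ℕ} {u : E d → ℝ} {D : Set (E d)} (hu : Continuous u) (hD : IsCompact D)
    (hD0 : volume D ≠ 0) :
    volume.real D * (⨍ y in D, u y) ^ 2 ≤ ∫ y in D, u y ^ 2 := by
  have hDv : volume D ≠ ⊤ := hD.measure_lt_top.ne
  have hr : 0 < volume.real D := ENNReal.toReal_pos hD0 hDv
  have hint : ∀ {g : E d → ℝ}, Continuous g → IntegrableOn g D := fun hg =>
    hg.continuousOn.integrableOn_compact hD
  set m := ⨍ y in D, u y with hm
  have e1 : ∫ y in D, u y = volume.real D * m := by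
    rw [hm, setAverage_eq, smul_eq_mul]; field_simp
  have h : 0 ≤ ∫ y in D, (u y - m) ^ 2 := integral_nonneg fun y => sq_nonneg _
  have e2 : ∫ y in D, (u y - m) ^ 2 = (∫ y in D, u y ^ 2) - 2 * m * (∫ y in D, u y) +
      volume.real D * m ^ 2 := by
    have : ∀ y, (u y - m) ^ 2 = u y ^ 2 - 2 * m * u y + m ^ 2 := fun y => by ring
    simp_rw [this]
    rw [integral_add (hint (by fun_prop)) (hint (by fun_prop)),
      integral_sub (hint (by fun_prop)) (hint (by fun_prop)), integral_const_mul]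
    simp
  rw [e2, e1] at h
  nlinarith

end LOD

/-! ### Facet description of cells, and the case of simplices -/

namespace LOD

open Set Filter Topology
open scoped ENNReal NNReal

/-- `polySpace` as a submodule. -/
def polySub (k : ElementKind) (d : ℕ) : Submodule ℝ (E d → ℝ) where
  carrier := polySpace k d
  zero_mem' := by
    cases k
    · exact ⟨0, 0, fun x => by simp⟩
    · exact ⟨0, fun x => by simp⟩
  add_mem' := by
    cases k
    · rintro f g ⟨c, u, h⟩ ⟨c', u', h'⟩
      refine ⟨c + c', u + u', fun x => ?_⟩
      simp only [Pi.add_apply, h, h', add_mul, Finset.sum_add_distrib]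
      ring
    · rintro f g ⟨c, h⟩ ⟨c', h'⟩
      refine ⟨c + c', fun x => ?_⟩
      simp only [Pi.add_apply, h, h', add_mul, Finset.sum_add_distrib]
  smul_mem' := by
    cases k
    · rintro r f ⟨c, u, h⟩
      refine ⟨r * c, fun i => r * u i, fun x => ?_⟩
      simp only [Pi.smul_apply, h, smul_eq_mul, mul_add, Finset.mul_sum, mul_assoc]
    · rintro r f ⟨c, h⟩
      refine ⟨fun S => r * c S, fun x => ?_⟩
      simp only [Pi.smul_apply, h, smul_eq_mul, Finset.mul_sum, mul_assoc]

lemma const_mem_polySub (k : ElementKind) (d : ℕ) (r : ℝ) : (fun _ => r) ∈ polySub k d := by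
  cases k
  · exact ⟨r, 0, fun x => by simp⟩
  · exact ⟨Pi.single ∅ r, fun x => by
      rw [Finset.sum_eq_single ∅] <;> simp +contextual⟩

lemma coord_mem_polySub (k : ElementKind) (d : ℕ) (i : Fin d) :
    (fun x : E d => x i) ∈ polySub k d := by
  cases k
  · exact ⟨0, Pi.single i 1, fun x => by simp [Pi.single_apply]⟩
  · exact ⟨Pi.single {i} 1, fun x => by
      rw [Finset.sum_eq_single {i}] <;> simp +contextual⟩

lemma affine_mem_polySub (k : ElementKind) {d : ℕ} (f : E d →ᵃ[ℝ] ℝ) : ⇑f ∈ polySub k d := by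
  have h : ⇑f = (fun _ => f 0) +
      ∑ i, f.linear (EuclideanSpace.single i 1) • (fun x : E d => x i) := by
    funext x
    have h1 : f x = f.linear x + f 0 := by
      have := f.map_vadd 0 x
      simpa using this
    have h2 : x = ∑ i, x i • EuclideanSpace.single i (1 : ℝ) := by
      ext j
      simp [Finset.sum_apply, Pi.single_apply]
    rw [h1]
    conv_lhs => rw [h2]
    simp [map_sum, mul_comm, add_comm]
  rw [h]
  exact add_mem (const_mem_polySub k d _)
    (sum_mem fun i _ => Submodule.smul_mem _ _ (coord_mem_polySub k d i))

lemma sum_smul_affineMap_apply {d : ℕ} {κ : Type*} (s : Finset κ) (c : κ → ℝ)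
    (g : κ → E d →ᵃ[ℝ] ℝ) (x : E d) : (∑ r ∈ s, c r • g r) x = ∑ r ∈ s, c r * g r x := by
  classical
  induction s using Finset.induction_on with
  | empty => simp
  | insert a s ha ih => simp [Finset.sum_insert ha, ih]

/-- The description of a cell by the affine functions that cut out its facets. Each of them takes
the values `0` and `1` at the vertices, and each facet comes with a direction along which the cell
is moved into the facet. -/
structure CellFrame (k : ElementKind) {d : ℕ} (V : Finset (E d)) where
  /-- the index set of the facets -/
  ι : Type
  [fintype : Fintype ι]
  /-- the facet functions -/
  lam : ι → E d →ᵃ[ℝ] ℝ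
  /-- the directions -/
  dir : ι → E d
  mem_cell : ∀ x, x ∈ cell V ↔ ∀ i, 0 ≤ lam i x
  vertex : ∀ p ∈ V, ∀ i, lam i p = 0 ∨ lam i p = 1
  dir_self : ∀ i, (lam i).linear (dir i) = -1
  dir_ne : ∀ i j, j ≠ i → 0 ≤ (lam j).linear (dir i)
  exists_one : ∀ i, ∃ p ∈ V, lam i p = 1
  sep : ∀ p ∈ V, ∀ q ∈ V, p ≠ q → ∃ i, lam i p = 1 ∧ lam i q = 0
  -- Some vertex lies off facet `i` but on every other facet through `p`. This keeps facet functions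
  -- at `p` independent, so that a generic segment avoids faces of codimension two.
  edge : ∀ p ∈ V, ∀ i, lam i p = 0 →
    ∃ q ∈ V, lam i q = 1 ∧ ∀ j, j ≠ i → lam j p = 0 → lam j q = 0
  -- Expresses that a facet spans a hyperplane.
  span : ∀ i (f : E d →ᵃ[ℝ] ℝ), (∀ p ∈ V, lam i p = 0 → f p = 0) → ∃ c : ℝ, ∀ x, f x = c * lam i x
  -- For `d = 1` a facet is a single point. The second vertex is what permits comparing the
  -- diameters of cells sharing the facet.
  facet_two : 2 ≤ d → ∀ i, ∀ p ∈ V, ∃ q ∈ V, q ≠ p ∧ lam i q = 0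
  -- The product is the nodal basis function of `p`: one barycentric coordinate for a simplex, a
  -- product of `d` coordinate factors for a box.
  shape_mem : ∀ p ∈ V, (fun x => ∏ i, if lam i p = 1 then lam i x else 1) ∈ polySub k d
  repr : ∀ q ∈ polySub k d, ∀ x,
    q x = ∑ p ∈ V, q p * ∏ i, if lam i p = 1 then lam i x else 1
  card_le : V.card ≤ 2 ^ d

attribute [instance] CellFrame.fintype

/-- The properties of the frames of two cells which meet in a common face. -/
structure CellFrame.Compatible {k : ElementKind} {d : ℕ} {V W : Finset (E d)}
    (F : CellFrame k V) (F' : CellFrame k W) : Prop where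
  -- The facets of `V` through all common vertices cut out the face of `V` spanned by these
  -- vertices, which lies in `W`.
  face : ∀ x ∈ cell V, (∀ i, (∀ p ∈ V, p ∈ W → F.lam i p = 0) → F.lam i x = 0) → x ∈ cell W
  -- The map `p ↦ p + lam i p • (dir i - dir i')` slides a point into the common facet and out again
  -- on the other side. It fixes the facet, and asking that vertices land in `W` is enough by
  -- convexity.
  reflect : ∀ i i' (c : ℝ), c < 0 → (∀ x, F'.lam i' x = c * F.lam i x) →
    (∀ p ∈ V, F.lam i p = 0 → p ∈ W) → (∀ p ∈ W, F'.lam i' p = 0 → p ∈ V) →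
    ∀ p ∈ V, p + F.lam i p • (F.dir i - F'.dir i') ∈ cell W

section Simplex

variable {d : ℕ} {V : Finset (E d)}

/-- The barycentric coordinates of a simplex. -/
noncomputable def simplexBasis (h : IsSimplex V) : AffineBasis V ℝ (E d) :=
  ⟨fun x : V => (x : E d), h.2, by
    rw [h.2.affineSpan_eq_top_iff_card_eq_finrank_add_one]
    simp [h.1]⟩

lemma simplexBasis_apply (h : IsSimplex V) (q : V) : simplexBasis h q = (q : E d) := rfl

lemma simplexBasis_coord (h : IsSimplex V) (i : V) {p : E d} (hp : p ∈ V) :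
    (simplexBasis h).coord i p = if (i : E d) = p then 1 else 0 := by
  classical
  have := (simplexBasis h).coord_apply i ⟨p, hp⟩
  rw [simplexBasis_apply] at this
  simp only [this, Subtype.ext_iff]

lemma simplexBasis_coord_linear (h : IsSimplex V) (i : V) {p q : E d} (hp : p ∈ V) (hq : q ∈ V) :
    ((simplexBasis h).coord i).linear (p - q) =
      (if (i : E d) = p then 1 else 0) - if (i : E d) = q then 1 else 0 := by
  rw [← simplexBasis_coord h i hp, ← simplexBasis_coord h i hq]
  exact ((simplexBasis h).coord i).linearMap_vsub p q

lemma affineMap_eq_of_eqOn_simplex (h : IsSimplex V) {f g : E d →ᵃ[ℝ] ℝ}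
    (hfg : ∀ p ∈ V, f p = g p) (x : E d) : f x = g x := by
  have : f = g := by
    refine AffineMap.ext_on (simplexBasis h).tot ?_
    rintro _ ⟨p, rfl⟩
    exact hfg p p.2
  rw [this]

lemma exists_affineMap_of_mem_polySub_P1 {q : E d → ℝ} (hq : q ∈ polySub .P1 d) :
    ∃ f : E d →ᵃ[ℝ] ℝ, ⇑f = q := by
  obtain ⟨c, g, h⟩ := hq
  refine ⟨(∑ i, g i • (EuclideanSpace.proj i : E d →L[ℝ] ℝ).toLinearMap).toAffineMap +
    AffineMap.const ℝ _ c, ?_⟩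
  funext x
  rw [h]
  simp [add_comm]

/-- The frame of a simplex. -/
noncomputable def simplexFrame (hd : 1 ≤ d) (h : IsSimplex V) : CellFrame .P1 V where
  ι := V
  lam i := (simplexBasis h).coord i
  -- The vector from the vertex `i` to the barycenter of the opposite facet, which has `d` vertices.
  dir i := (d : ℝ)⁻¹ • ∑ r ∈ V.erase i, (r - (i : E d))
  mem_cell x := by
    have : cell V = convexHull ℝ (range (simplexBasis h)) := by
      rw [cell]; congr 1; ext x; simp [simplexBasis_apply]
    rw [this, AffineBasis.convexHull_eq_nonneg_coord]
    rfl
  vertex p hp i := by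
    rw [simplexBasis_coord h i hp]
    split_ifs <;> simp
  dir_self i := by
    have hd' : (d : ℝ) ≠ 0 := by positivity
    rw [map_smul, map_sum, Finset.sum_congr rfl (g := fun _ => (-1 : ℝ))]
    · simp [Finset.card_erase_of_mem i.2, h.1, hd']
    · intro r hr
      rw [simplexBasis_coord_linear h i (Finset.mem_of_mem_erase hr) i.2, if_pos rfl,
        if_neg (Finset.ne_of_mem_erase hr).symm]
      norm_num
  dir_ne i j hij := by
    rw [map_smul, map_sum]
    refine mul_nonneg (by positivity) (Finset.sum_nonneg fun r hr => ?_)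
    rw [simplexBasis_coord_linear h j (Finset.mem_of_mem_erase hr) i.2,
      if_neg (fun hh => hij (Subtype.ext hh))]
    split_ifs <;> simp
  exists_one i := ⟨i, i.2, by rw [simplexBasis_coord h i i.2, if_pos rfl]⟩
  sep p hp q hq hpq := ⟨⟨p, hp⟩, by
    rw [simplexBasis_coord h _ hp, simplexBasis_coord h _ hq]; simp [hpq]⟩
  edge p hp i hi := ⟨i, i.2, by rw [simplexBasis_coord h i i.2, if_pos rfl], fun j hj _ => by
    rw [simplexBasis_coord h j i.2, if_neg (fun hh => hj (Subtype.ext hh))]⟩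
  span i f hf := by
    refine ⟨f i, affineMap_eq_of_eqOn_simplex h (g := f i • (simplexBasis h).coord i)
      fun p hp => ?_⟩
    rcases eq_or_ne (i : E d) p with rfl | hne
    · simp [simplexBasis_coord h i i.2]
    · have h0 : (simplexBasis h).coord i p = 0 := by rw [simplexBasis_coord h i hp, if_neg hne]
      simp [hf p hp h0, h0]
  facet_two h2 i p hp := by
    have hc : 1 < V.card - 1 := by rw [h.1]; omega
    rw [← Finset.card_erase_of_mem i.2] at hc
    obtain ⟨q, hq, hqp⟩ := Finset.exists_mem_ne hc p
    refine ⟨q, Finset.mem_of_mem_erase hq, hqp, ?_⟩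
    rw [simplexBasis_coord h i (Finset.mem_of_mem_erase hq),
      if_neg (Finset.ne_of_mem_erase hq).symm]
  shape_mem p hp := by
    convert affine_mem_polySub .P1 ((simplexBasis h).coord ⟨p, hp⟩) using 2 with x
    rw [Fintype.prod_eq_single ⟨p, hp⟩]
    · rw [if_pos (by rw [simplexBasis_coord h _ hp, if_pos rfl])]
    · intro j hj
      rw [if_neg]
      rw [simplexBasis_coord h _ hp, if_neg (fun hh => hj (Subtype.ext hh))]
      norm_num
  repr q hq x := by
    obtain ⟨f, rfl⟩ := exists_affineMap_of_mem_polySub_P1 hq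
    have hprod : ∀ p : V, (∏ i, if (simplexBasis h).coord i p = 1
        then (simplexBasis h).coord i x else 1) = (simplexBasis h).coord p x := by
      intro p
      rw [Fintype.prod_eq_single p]
      · rw [if_pos (by rw [simplexBasis_coord h _ p.2, if_pos rfl])]
      · intro j hj
        rw [if_neg]
        rw [simplexBasis_coord h _ p.2, if_neg (fun hh => hj (Subtype.ext hh))]
        norm_num
    rw [← Finset.sum_coe_sort V, Finset.sum_congr rfl fun p _ => by rw [hprod p]]
    have := affineMap_eq_of_eqOn_simplex h (f := f)
      (g := ∑ p : V, f p • (simplexBasis h).coord p) (fun p hp => ?_) x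
    · rw [this, sum_smul_affineMap_apply]
    · have e : ((∑ r : V, f r • (simplexBasis h).coord r : E d →ᵃ[ℝ] ℝ)) p =
          ∑ r : V, f r * (simplexBasis h).coord r p :=
        sum_smul_affineMap_apply _ _ _ _
      rw [e, Finset.sum_eq_single ⟨p, hp⟩]
      · rw [simplexBasis_coord h _ hp]; simp
      · intro j _ hj
        rw [simplexBasis_coord h _ hp, if_neg (fun hh => hj (Subtype.ext hh)), mul_zero]
      · simp
  card_le := by rw [h.1]; exact Nat.lt_two_pow_self

lemma simplexFrame_lam (hd : 1 ≤ d) (h : IsSimplex V) (i : V) :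
    (simplexFrame hd h).lam i = (simplexBasis h).coord i := rfl

/-- For `face`: the barycentric coordinate of a vertex outside `W` vanishes at all common vertices,
hence at `x`, so `x` is a convex combination of common vertices. For `reflect`: the two facets have
the same vertices, hence the same barycenter, and the vertex opposite the facet in `V` is sent to
the one in `W`. -/
lemma simplexFrame_compatible (hd : 1 ≤ d) (h : IsSimplex V) {W : Finset (E d)}
    (h' : IsSimplex W) : (simplexFrame hd h).Compatible (simplexFrame hd h') where
  face x hx hface := by
    classical
    have hx' := ((simplexFrame hd h).mem_cell x).1 hx
    have hs : ∑ q : V, (simplexBasis h).coord q x = 1 :=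
      (simplexBasis h).sum_coord_apply_eq_one x
    have hc : ∑ q : V, (simplexBasis h).coord q x • (q : E d) = x := by
      have := (simplexBasis h).linear_combination_coord_eq_self x
      simpa [simplexBasis_apply] using this
    have hz : ∀ q : V, (q : E d) ∉ W → (simplexBasis h).coord q x = 0 := by
      intro q hq
      refine hface q fun p hp hpW => ?_
      change (simplexBasis h).coord q p = 0
      rw [simplexBasis_coord h q hp, if_neg]
      rintro rfl
      exact hq hpW
    rw [← hc]
    have hconv := convex_convexHull ℝ (W : Set (E d))
    have key : ∑ q ∈ Finset.univ.filter (fun q : V => (q : E d) ∈ W),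
        (simplexBasis h).coord q x • (q : E d) ∈ convexHull ℝ (W : Set (E d)) := by
      refine hconv.sum_mem (fun q _ => hx' q) ?_
        fun q hq => subset_convexHull ℝ _ (Finset.mem_filter.1 hq).2
      rw [Finset.sum_filter_of_ne, hs]
      intro q _ hne
      by_contra hq
      exact hne (hz q hq)
    rw [Finset.sum_filter_of_ne] at key
    · exact key
    · intro q _ hne
      by_contra hq
      exact hne (by rw [hz q hq, zero_smul])
  reflect := fun (i : V) (i' : W) c _ hlam hF hF' p hp => by
    have hVW : V.erase i = W.erase i' := by
      ext r
      constructor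
      · intro hr
        have h0 : (simplexBasis h).coord i r = 0 := by
          rw [simplexBasis_coord h i (Finset.mem_of_mem_erase hr),
            if_neg (Finset.ne_of_mem_erase hr).symm]
        have hrW := hF r (Finset.mem_of_mem_erase hr) h0
        refine Finset.mem_erase.2 ⟨?_, hrW⟩
        have h1 := hlam r
        simp only [simplexFrame_lam] at h1
        rw [h0, mul_zero, simplexBasis_coord h' i' hrW] at h1
        intro hh
        simp [hh] at h1
      · intro hr
        have h0 : (simplexBasis h').coord i' r = 0 := by
          rw [simplexBasis_coord h' i' (Finset.mem_of_mem_erase hr),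
            if_neg (Finset.ne_of_mem_erase hr).symm]
        have hrV := hF' r (Finset.mem_of_mem_erase hr) h0
        refine Finset.mem_erase.2 ⟨?_, hrV⟩
        have h1 := hlam r
        simp only [simplexFrame_lam] at h1
        rw [h0, simplexBasis_coord h i hrV] at h1
        intro hh
        simp [hh] at h1
        linarith
    change p + (simplexBasis h).coord i p • (((d : ℝ)⁻¹ • ∑ r ∈ V.erase i, (r - (i : E d))) -
      (d : ℝ)⁻¹ • ∑ r ∈ W.erase i', (r - (i' : E d))) ∈ _
    rcases eq_or_ne (i : E d) p with rfl | hne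
    · have hd' : (d : ℝ) ≠ 0 := by positivity
      rw [simplexBasis_coord h i i.2, if_pos rfl, one_smul, ← hVW, ← smul_sub,
        ← Finset.sum_sub_distrib]
      simp only [sub_sub_sub_cancel_left, Finset.sum_const, Finset.card_erase_of_mem i.2, h.1,
        Nat.add_sub_cancel]
      rw [← Nat.cast_smul_eq_nsmul ℝ, smul_smul, inv_mul_cancel₀ hd', one_smul, add_sub_cancel]
      exact subset_convexHull ℝ _ i'.2
    · have h0 : (simplexBasis h).coord i p = 0 := by rw [simplexBasis_coord h i hp, if_neg hne]
      rw [h0, zero_smul, add_zero]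
      exact subset_convexHull ℝ _ (hF p hp h0)

end Simplex

end LOD

/-! ### Facet description of boxes -/

namespace LOD

open Set Filter Topology
open scoped ENNReal NNReal

section Box

variable {d : ℕ}

/-- The vertices of the box with lower corner `a` and upper corner `b`. -/
noncomputable def boxCorner (a b : Fin d → ℝ) (s : Fin d → Bool) : E d :=
  WithLp.toLp 2 fun i => if s i then b i else a i

lemma boxCorner_apply (a b : Fin d → ℝ) (s : Fin d → Bool) (i : Fin d) :
    boxCorner a b s i = if s i then b i else a i := rfl

/-- The normalized coordinate functions of a box: `boxCoord a b (i, true)` vanishes on the lower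
facet `x i = a i` and `boxCoord a b (i, false)` on the upper facet `x i = b i`. -/
noncomputable def boxCoord (a b : Fin d → ℝ) (j : Fin d × Bool) : E d →ᵃ[ℝ] ℝ :=
  (b j.1 - a j.1)⁻¹ • (if j.2 then
    (EuclideanSpace.proj j.1 : E d →L[ℝ] ℝ).toLinearMap.toAffineMap - AffineMap.const ℝ _ (a j.1)
  else
    AffineMap.const ℝ _ (b j.1) - (EuclideanSpace.proj j.1 : E d →L[ℝ] ℝ).toLinearMap.toAffineMap)

lemma boxCoord_true (a b : Fin d → ℝ) (i : Fin d) (x : E d) :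
    boxCoord a b (i, true) x = (x i - a i) / (b i - a i) := by
  simp [boxCoord, div_eq_inv_mul]

lemma boxCoord_false (a b : Fin d → ℝ) (i : Fin d) (x : E d) :
    boxCoord a b (i, false) x = (b i - x i) / (b i - a i) := by
  simp [boxCoord, div_eq_inv_mul]

lemma boxCoord_linear_true (a b : Fin d → ℝ) (i : Fin d) (v : E d) :
    (boxCoord a b (i, true)).linear v = v i / (b i - a i) := by
  simp [boxCoord, div_eq_inv_mul]

lemma boxCoord_linear_false (a b : Fin d → ℝ) (i : Fin d) (v : E d) :
    (boxCoord a b (i, false)).linear v = - v i / (b i - a i) := by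
  simp [boxCoord, div_eq_inv_mul]

variable {a b : Fin d → ℝ}

lemma boxCoord_corner (hab : ∀ i, a i < b i) (s : Fin d → Bool) (j : Fin d × Bool) :
    boxCoord a b j (boxCorner a b s) = if s j.1 = j.2 then 1 else 0 := by
  obtain ⟨i, β⟩ := j
  have h : b i - a i ≠ 0 := (sub_pos.2 (hab i)).ne'
  cases β
  · rw [boxCoord_false, boxCorner_apply]
    cases s i <;> simp [h]
  · rw [boxCoord_true, boxCorner_apply]
    cases s i <;> simp [h]

lemma boxCoord_nonneg_iff (hab : ∀ i, a i < b i) (x : E d) :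
    (∀ j, 0 ≤ boxCoord a b j x) ↔ ∀ i, a i ≤ x i ∧ x i ≤ b i := by
  have h : ∀ i, 0 < b i - a i := fun i => sub_pos.2 (hab i)
  constructor
  · intro hx i
    have h1 := hx (i, true)
    have h2 := hx (i, false)
    rw [boxCoord_true, le_div_iff₀ (h i)] at h1
    rw [boxCoord_false, le_div_iff₀ (h i)] at h2
    constructor <;> linarith
  · rintro hx ⟨i, β⟩
    cases β
    · rw [boxCoord_false]
      exact div_nonneg (by linarith [(hx i).2]) (h i).le
    · rw [boxCoord_true]
      exact div_nonneg (by linarith [(hx i).1]) (h i).le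

lemma boxCoord_prod_shape (hab : ∀ i, a i < b i) (s : Fin d → Bool) (x : E d) :
    (∏ j, if boxCoord a b j (boxCorner a b s) = 1 then boxCoord a b j x else 1) =
      ∏ i, boxCoord a b (i, s i) x := by
  rw [Fintype.prod_prod_type]
  refine Finset.prod_congr rfl fun i _ => ?_
  rw [Fintype.prod_bool]
  simp only [boxCoord_corner hab]
  cases s i <;> simp

/-- Multilinear interpolation at the corners is exact: a monomial factors over the coordinates, and
linear interpolation in one variable reproduces `1` and `x i`. -/
lemma boxCoord_repr (hab : ∀ i, a i < b i) {q : E d → ℝ} (hq : q ∈ polySub .Q1 d) (x : E d) :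
    q x = ∑ s, q (boxCorner a b s) * ∏ i, boxCoord a b (i, s i) x := by
  obtain ⟨c, hc⟩ := hq
  have hmono : ∀ S : Finset (Fin d), ∏ i ∈ S, x i =
      ∑ s, (∏ i ∈ S, boxCorner a b s i) * ∏ i, boxCoord a b (i, s i) x := by
    intro S
    have h1 : ∀ y : E d, ∏ i ∈ S, y i = ∏ i, if i ∈ S then y i else 1 := fun y => by
      rw [Finset.prod_ite_mem, Finset.univ_inter]
    simp_rw [h1, ← Finset.prod_mul_distrib, boxCorner_apply]
    rw [← Fintype.piFinset_univ, ← Finset.prod_univ_sum (fun _ => Finset.univ)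
      (fun i β => (if i ∈ S then (if β then b i else a i) else 1) * boxCoord a b (i, β) x)]
    refine Finset.prod_congr rfl fun i _ => ?_
    have h : b i - a i ≠ 0 := (sub_pos.2 (hab i)).ne'
    rw [Fintype.sum_bool, boxCoord_true, boxCoord_false]
    by_cases hiS : i ∈ S <;> simp [hiS] <;> field_simp <;> ring
  rw [hc, Finset.sum_congr rfl fun S _ => by rw [hmono S]]
  simp only [hc, Finset.mul_sum, Finset.sum_mul]
  rw [Finset.sum_comm]
  refine Finset.sum_congr rfl fun s _ => Finset.sum_congr rfl fun S _ => ?_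
  ring

lemma boxCoord_prod_mem (s : Fin d → Bool) :
    (fun x => ∏ i, boxCoord a b (i, s i) x) ∈ polySub .Q1 d := by
  classical
  have h : ∀ i, ∃ u v : ℝ, ∀ x : E d, boxCoord a b (i, s i) x = u * x i + v := by
    intro i
    cases s i
    · exact ⟨-(b i - a i)⁻¹, b i / (b i - a i), fun x => by rw [boxCoord_false]; ring⟩
    · exact ⟨(b i - a i)⁻¹, - a i / (b i - a i), fun x => by rw [boxCoord_true]; ring⟩
  choose u v huv using h
  refine ⟨fun S => (∏ i ∈ S, u i) * ∏ i ∈ Finset.univ \ S, v i, fun x => ?_⟩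
  simp only [huv]
  rw [Finset.prod_add, Finset.powerset_univ]
  refine Finset.sum_congr rfl fun S _ => ?_
  rw [Finset.prod_mul_distrib]
  ring

variable {V : Finset (E d)}

lemma boxCorner_injective (hab : ∀ i, a i < b i) : Function.Injective (boxCorner a b) := by
  intro s s' h
  funext i
  have := congrArg (fun y : E d => y i) h
  simp only [boxCorner_apply] at this
  have h1 := (hab i).ne
  cases hs : s i <;> cases hs' : s' i <;> simp_all

lemma mem_box_iff (hV : ∀ x : E d, x ∈ V ↔ ∀ i, x i = a i ∨ x i = b i) (p : E d) :
    p ∈ V ↔ ∃ s, boxCorner a b s = p := by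
  classical
  rw [hV]
  constructor
  · intro h
    refine ⟨fun i => decide (p i = b i), ?_⟩
    ext i
    rw [boxCorner_apply]
    rcases h i with h | h
    · by_cases hh : p i = b i <;> simp [hh]
      exact h ▸ rfl
    · simp [h]
  · rintro ⟨s, rfl⟩ i
    rw [boxCorner_apply]
    cases s i <;> simp

lemma sum_box (hab : ∀ i, a i < b i) (hV : ∀ x : E d, x ∈ V ↔ ∀ i, x i = a i ∨ x i = b i)
    (g : E d → ℝ) : ∑ p ∈ V, g p = ∑ s, g (boxCorner a b s) := by
  classical
  have : V = Finset.univ.image (boxCorner a b) := by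
    ext p
    simp [mem_box_iff hV]
  rw [this, Finset.sum_image]
  exact (boxCorner_injective hab).injOn

/-- For the nontrivial inclusion, the nodal basis functions at `x` serve as weights: they are
nonnegative and sum to one, and interpolation of the coordinates shows that they average the corners
to `x`. -/
lemma mem_cell_box (hab : ∀ i, a i < b i) (hV : ∀ x : E d, x ∈ V ↔ ∀ i, x i = a i ∨ x i = b i)
    (x : E d) : x ∈ cell V ↔ ∀ i, a i ≤ x i ∧ x i ≤ b i := by
  constructor
  · intro hx
    have hc : Convex ℝ {y : E d | ∀ i, a i ≤ y i ∧ y i ≤ b i} := by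
      intro y hy z hz s t hs ht hst i
      exact convex_Icc (a i) (b i) (hy i) (hz i) hs ht hst
    refine convexHull_min (fun p hp => ?_) hc hx
    intro i
    rcases (hV p).1 hp i with h | h <;> rw [h] <;> simp [(hab i).le]
  · intro hx
    rw [← boxCoord_nonneg_iff hab] at hx
    have h1 : ∑ s : Fin d → Bool, ∏ i, boxCoord a b (i, s i) x = 1 := by
      have := boxCoord_repr hab (const_mem_polySub .Q1 d 1) x
      simpa using this.symm
    have h2 : x = ∑ s : Fin d → Bool, (∏ i, boxCoord a b (i, s i) x) • boxCorner a b s := by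
      ext i
      have := boxCoord_repr hab (coord_mem_polySub .Q1 d i) x
      simp only at this
      rw [this]
      simp [mul_comm]
    rw [h2]
    refine (convex_convexHull ℝ _).sum_mem (fun s _ => Finset.prod_nonneg fun i _ => hx _) h1
      fun s _ => subset_convexHull ℝ _ ?_
    exact (mem_box_iff hV _).2 ⟨s, rfl⟩

/-- The direction perpendicular to a facet of a box. -/
noncomputable def boxDir (a b : Fin d → ℝ) (j : Fin d × Bool) : E d :=
  EuclideanSpace.single j.1 (if j.2 then -(b j.1 - a j.1) else b j.1 - a j.1)

/-- The frame of a box. -/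
noncomputable def boxFrameOf (hab : ∀ i, a i < b i)
    (hV : ∀ x : E d, x ∈ V ↔ ∀ i, x i = a i ∨ x i = b i) : CellFrame .Q1 V where
  ι := Fin d × Bool
  lam := boxCoord a b
  dir := boxDir a b
  mem_cell x := by rw [mem_cell_box hab hV, boxCoord_nonneg_iff hab]
  vertex p hp j := by
    obtain ⟨s, rfl⟩ := (mem_box_iff hV p).1 hp
    rw [boxCoord_corner hab]
    split_ifs <;> simp
  dir_self := by
    rintro ⟨i, β⟩
    have h : b i - a i ≠ 0 := (sub_pos.2 (hab i)).ne'
    cases β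
    · rw [boxCoord_linear_false]; simp [boxDir]; field_simp; ring
    · rw [boxCoord_linear_true]; simp [boxDir]; field_simp; ring
  dir_ne := by
    rintro ⟨i, β⟩ ⟨j, γ⟩ hij
    have h := sub_pos.2 (hab j)
    rcases eq_or_ne i j with rfl | hne
    · cases β <;> cases γ
      · simp at hij
      · rw [boxCoord_linear_true]; simp [boxDir, h.ne']
      · rw [boxCoord_linear_false]; simp [boxDir, h.ne']
      · simp at hij
    · cases γ
      · rw [boxCoord_linear_false]; simp [boxDir, hne.symm]
      · rw [boxCoord_linear_true]; simp [boxDir, hne.symm]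
  exists_one j := ⟨boxCorner a b fun _ => j.2, (mem_box_iff hV _).2 ⟨_, rfl⟩, by
    rw [boxCoord_corner hab]; simp⟩
  sep p hp q hq hpq := by
    obtain ⟨s, rfl⟩ := (mem_box_iff hV p).1 hp
    obtain ⟨t, rfl⟩ := (mem_box_iff hV q).1 hq
    obtain ⟨i, hi⟩ : ∃ i, s i ≠ t i := by
      by_contra! hh
      exact hpq (by rw [funext hh])
    refine ⟨(i, s i), ?_, ?_⟩ <;> rw [boxCoord_corner hab]
    · simp
    · simp [hi.symm]
  edge p hp j hj := by
    classical
    obtain ⟨s, rfl⟩ := (mem_box_iff hV p).1 hp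
    refine ⟨boxCorner a b (Function.update s j.1 j.2), (mem_box_iff hV _).2 ⟨_, rfl⟩, ?_, ?_⟩
    · rw [boxCoord_corner hab]; simp
    · intro l hl h0
      rw [boxCoord_corner hab] at h0 hj ⊢
      rcases eq_or_ne l.1 j.1 with h | h
      · rw [h, Function.update_self, if_neg]
        exact fun h2 => hl (Prod.ext h h2.symm)
      · rwa [Function.update_of_ne h]
  span j f hf := by
    classical
    refine ⟨f (boxCorner a b fun _ => j.2), fun x => ?_⟩
    rw [boxCoord_repr hab (affine_mem_polySub .Q1 f) x,
      boxCoord_repr hab (affine_mem_polySub .Q1 (boxCoord a b j)) x, Finset.mul_sum]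
    refine Finset.sum_congr rfl fun s _ => ?_
    rw [← mul_assoc]
    congr 1
    have hz : ∀ t : Fin d → Bool, t j.1 ≠ j.2 → f (boxCorner a b t) = 0 := fun t ht =>
      hf _ ((mem_box_iff hV _).2 ⟨_, rfl⟩) (by rw [boxCoord_corner hab, if_neg ht])
    rw [boxCoord_corner hab]
    split_ifs with h
    -- An affine function changes by the same amount along parallel edges. All edges leaving the
    -- facet `j` end off or on it in pairs and `f` vanishes at the ends lying on the facet, so `f`
    -- is constant on the opposite corners.
    · have key : ∀ t : Fin d → Bool, t j.1 = j.2 →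
          f (boxCorner a b t) = - f.linear (boxCorner a b (Function.update t j.1 (!j.2)) -
            boxCorner a b t) := by
        intro t ht
        have h1 := f.linearMap_vsub (boxCorner a b (Function.update t j.1 (!j.2)))
          (boxCorner a b t)
        rw [hz (Function.update t j.1 (!j.2)) (by simp)] at h1
        simp only [vsub_eq_sub] at h1
        rw [h1]; ring
      rw [mul_one, key s h, key _ rfl]
      congr 2
      ext l
      simp only [PiLp.sub_apply, boxCorner_apply]
      rcases eq_or_ne l j.1 with rfl | hl
      · simp [h]
      · simp [hl]
    · rw [mul_zero, hz s h]
  facet_two h2 j p hp := by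
    classical
    obtain ⟨s, rfl⟩ := (mem_box_iff hV p).1 hp
    have : Nontrivial (Fin d) := Fin.nontrivial_iff_two_le.2 h2
    obtain ⟨l, hl⟩ := exists_ne j.1
    refine ⟨boxCorner a b (Function.update (fun _ => !j.2) l (!(s l))),
      (mem_box_iff hV _).2 ⟨_, rfl⟩, ?_, ?_⟩
    · intro h
      have := congrFun (boxCorner_injective hab h) l
      simp at this
    · rw [boxCoord_corner hab, Function.update_of_ne hl.symm]
      simp
  shape_mem p hp := by
    obtain ⟨s, rfl⟩ := (mem_box_iff hV p).1 hp
    simp only [boxCoord_prod_shape hab]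
    exact boxCoord_prod_mem s
  repr q hq x := by
    rw [sum_box hab hV, boxCoord_repr hab hq x]
    simp only [boxCoord_prod_shape hab]
  card_le := by
    classical
    have : V = Finset.univ.image (boxCorner a b) := by
      ext p
      simp [mem_box_iff hV]
    rw [this]
    refine Finset.card_image_le.trans ?_
    simp

/-- An exposed point of a convex hull belongs to the generating set. -/
lemma mem_of_mem_convexHull_of_le {S : Set (E d)} {l : E d} (hl : l ∈ convexHull ℝ S)
    (f : E d →ₗ[ℝ] ℝ) (hf : ∀ y ∈ S, y ≠ l → f l < f y) : l ∈ S := by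
  by_contra hn
  have hc : Convex ℝ {y : E d | f l < f y} := convex_halfSpace_gt f.isLinear (f l)
  have := convexHull_min (s := S) (fun y hy => hf y hy fun h => hn (h ▸ hy)) hc hl
  exact lt_irrefl (f l) this

lemma sum_lt_of_le_of_ne {x y : E d} (h : ∀ i, x i ≤ y i) (hne : y ≠ x) :
    ∑ i, x i < ∑ i, y i := by
  refine Finset.sum_lt_sum (fun i _ => h i) ?_
  by_contra! hh
  exact hne (by ext i; exact le_antisymm (hh i (Finset.mem_univ i)) (h i))

/-- Two boxes meet in the box with corners `max a a'` and `min b b'`. By conformity this box is the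
hull of the common vertices, so its two extreme corners are themselves common vertices. Hence in
each coordinate the intersection is either the full side of `V` or one endpoint of it. -/
lemma boxFrameOf_compatible (hd : 1 ≤ d) (hab : ∀ i, a i < b i)
    (hV : ∀ x : E d, x ∈ V ↔ ∀ i, x i = a i ∨ x i = b i) {a' b' : Fin d → ℝ} {W : Finset (E d)}
    (hab' : ∀ i, a' i < b' i) (hW : ∀ x : E d, x ∈ W ↔ ∀ i, x i = a' i ∨ x i = b' i)
    (hVW : cell V ∩ cell W = convexHull ℝ ((V : Set (E d)) ∩ (W : Set (E d)))) :
    (boxFrameOf hab hV).Compatible (boxFrameOf hab' hW) where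
  face x hx hface := by
    replace hface : ∀ j, (∀ p ∈ V, p ∈ W → boxCoord a b j p = 0) → boxCoord a b j x = 0 := hface
    have hx' := (mem_cell_box hab hV x).1 hx
    have hpos : ∀ i, 0 < b i - a i := fun i => sub_pos.2 (hab i)
    -- Without common vertices the hypothesis on `x` applies vacuously to two opposite facets, and
    -- `x` would lie on both.
    obtain ⟨r, hrV, hrW⟩ : ∃ r, r ∈ V ∧ r ∈ W := by
      by_contra! hno
      have h1 := hface (⟨0, hd⟩, true) fun p hp hpW => absurd hpW (hno p hp)
      have h2 := hface (⟨0, hd⟩, false) fun p hp hpW => absurd hpW (hno p hp)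
      have h3 := hpos ⟨0, hd⟩
      rw [boxCoord_true, div_eq_zero_iff, or_iff_left h3.ne'] at h1
      rw [boxCoord_false, div_eq_zero_iff, or_iff_left h3.ne'] at h2
      linarith
    have hcell : ∀ y, y ∈ cell V ∩ cell W ↔ ∀ i, max (a i) (a' i) ≤ y i ∧ y i ≤ min (b i) (b' i) := by
      intro y
      rw [mem_inter_iff, mem_cell_box hab hV, mem_cell_box hab' hW, ← forall_and]
      refine forall_congr' fun i => ?_
      rw [max_le_iff, le_min_iff]
      tauto
    have hr := (hcell r).1 ⟨subset_convexHull ℝ _ hrV, subset_convexHull ℝ _ hrW⟩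
    have hS : ∀ p ∈ (V : Set (E d)) ∩ (W : Set (E d)),
        ∀ i, max (a i) (a' i) ≤ p i ∧ p i ≤ min (b i) (b' i) := fun p hp =>
      (hcell p).1 ⟨subset_convexHull ℝ _ hp.1, subset_convexHull ℝ _ hp.2⟩
    let L : E d →ₗ[ℝ] ℝ := ∑ i, (EuclideanSpace.proj i : E d →L[ℝ] ℝ).toLinearMap
    have hL : ∀ y : E d, L y = ∑ i, y i := fun y => by simp [L]
    have hlow : (WithLp.toLp 2 fun i => max (a i) (a' i) : E d) ∈ (V : Set (E d)) ∩ (W : Set (E d)) := by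
      refine mem_of_mem_convexHull_of_le (hVW ▸ (hcell _).2 fun i => ⟨le_rfl, (hr i).1.trans (hr i).2⟩)
        L fun y hy hne => ?_
      rw [hL, hL]
      exact sum_lt_of_le_of_ne (fun i => (hS y hy i).1) hne
    have hupp : (WithLp.toLp 2 fun i => min (b i) (b' i) : E d) ∈ (V : Set (E d)) ∩ (W : Set (E d)) := by
      refine mem_of_mem_convexHull_of_le (hVW ▸ (hcell _).2 fun i => ⟨(hr i).1.trans (hr i).2, le_rfl⟩)
        (-L) fun y hy hne => ?_
      rw [LinearMap.neg_apply, LinearMap.neg_apply, hL, hL, neg_lt_neg_iff]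
      exact sum_lt_of_le_of_ne (fun i => (hS y hy i).2) hne.symm
    rw [mem_cell_box hab' hW]
    intro i
    have h1 : max (a i) (a' i) = a i ∨ max (a i) (a' i) = b i := (hV _).1 hlow.1 i
    have h2 : min (b i) (b' i) = a i ∨ min (b i) (b' i) = b i := (hV _).1 hupp.1 i
    have h3 := (hr i).1.trans (hr i).2
    have h4 := hab i
    have hla := le_max_right (a i) (a' i)
    have hub := min_le_right (b i) (b' i)
    rcases h3.lt_or_eq with hlt | heq
    · have e1 : max (a i) (a' i) = a i := by
        rcases h1 with h | h
        · exact h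
        · exact absurd (hlt.trans_le (min_le_left _ _)) (by rw [h]; exact lt_irrefl _)
      have e2 : min (b i) (b' i) = b i := by
        rcases h2 with h | h
        · exact absurd ((le_max_left (a i) (a' i)).trans_lt hlt) (by rw [h]; exact lt_irrefl _)
        · exact h
      constructor <;> linarith [(hx' i).1, (hx' i).2]
    · have hval : ∀ p ∈ V, p ∈ W → p i = max (a i) (a' i) := fun p hp hpW =>
        le_antisymm (heq ▸ (hS p ⟨hp, hpW⟩ i).2) (hS p ⟨hp, hpW⟩ i).1
      have hxi : x i = max (a i) (a' i) := by
        rcases h1 with h | h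
        · have := hface (i, true) fun p hp hpW => by
            rw [boxCoord_true, hval p hp hpW, h, sub_self, zero_div]
          rw [boxCoord_true, div_eq_zero_iff, or_iff_left (hpos i).ne'] at this
          linarith
        · have := hface (i, false) fun p hp hpW => by
            rw [boxCoord_false, hval p hp hpW, h, sub_self, zero_div]
          rw [boxCoord_false, div_eq_zero_iff, or_iff_left (hpos i).ne'] at this
          linarith
      rw [hxi]
      exact ⟨hla, heq ▸ hub⟩
  reflect := fun (j : Fin d × Bool) (j' : Fin d × Bool) c hc hlam hF _ p hp => by
    classical
    replace hlam : ∀ x, boxCoord a' b' j' x = c * boxCoord a b j x := hlam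
    replace hF : ∀ p ∈ V, boxCoord a b j p = 0 → p ∈ W := hF
    change p + boxCoord a b j p • (boxDir a b j - boxDir a' b' j') ∈ cell W
    obtain ⟨i, β⟩ := j
    obtain ⟨i', β'⟩ := j'
    have hpos := sub_pos.2 (hab i)
    have hpos' := sub_pos.2 (hab' i')
    obtain ⟨s, rfl⟩ := (mem_box_iff hV p).1 hp
    -- the facet point below `p`
    have hq : boxCorner a b (Function.update s i (!β)) ∈ W :=
      hF _ ((mem_box_iff hV _).2 ⟨_, rfl⟩) (by rw [boxCoord_corner hab]; simp)
    have hq' := (mem_cell_box hab' hW _).1 (subset_convexHull ℝ _ hq)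
    have hlin : ∀ v, (boxCoord a' b' (i', β')).linear v = c * (boxCoord a b (i, β)).linear v := by
      intro v
      have h1 := (boxCoord a' b' (i', β')).map_vadd 0 v
      have h2 := (boxCoord a b (i, β)).map_vadd 0 v
      simp only [vadd_eq_add, add_zero] at h1 h2
      have h3 := hlam v
      rw [h1, h2, hlam 0] at h3
      linarith
    -- Proportional facet functions belong to the same axis; the negative factor then forces
    -- opposite sides.
    have hii : i' = i := by
      by_contra hne
      have := hlin (EuclideanSpace.single i' 1)
      cases β <;> cases β' <;>
        simp [boxCoord_linear_true, boxCoord_linear_false, Ne.symm hne, hpos'.ne'] at this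
    subst hii
    have hββ : β' = !β := by
      have := hlin (EuclideanSpace.single i' 1)
      have h3 := inv_pos.2 hpos
      have h4 := inv_pos.2 hpos'
      cases β <;> cases β' <;>
        simp [boxCoord_linear_true, boxCoord_linear_false, neg_div] at this ⊢ <;> nlinarith
    subst hββ
    have h0 := hlam (boxCorner a b (Function.update s i' (!β)))
    rw [boxCoord_corner hab, if_neg (by simp), mul_zero] at h0
    rw [mem_cell_box hab' hW]
    intro l
    have hl := hq' l
    rcases eq_or_ne l i' with rfl | hne
    · rw [boxCoord_corner hab]
      cases β
      · simp only [Bool.not_false, boxCoord_true, boxCorner_apply, Function.update_self,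
          if_true, div_eq_zero_iff, or_iff_left hpos'.ne'] at h0
        cases hs : s l <;> simp [boxCorner_apply, boxDir, hs] <;> constructor <;> linarith
      · simp only [Bool.not_true, boxCoord_false, boxCorner_apply, Function.update_self,
          div_eq_zero_iff, or_iff_left hpos'.ne'] at h0
        cases hs : s l <;> simp [boxCorner_apply, boxDir, hs] at h0 ⊢ <;> constructor <;> linarith
    · rw [boxCorner_apply, Function.update_of_ne hne] at hl
      simpa [boxCorner_apply, boxDir, hne] using hl

end Box

/-- The frame of an admissible cell. -/
noncomputable def cellFrame {k : ElementKind} {d : ℕ} (hd : 1 ≤ d) {V : Finset (E d)}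
    (h : IsCell k V) : CellFrame k V :=
  match k, h with
  | .P1, h => simplexFrame hd h
  | .Q1, h => boxFrameOf h.choose_spec.choose_spec.1 h.choose_spec.choose_spec.2

lemma cellFrame_compatible {k : ElementKind} {d : ℕ} (hd : 1 ≤ d) {V W : Finset (E d)}
    (h : IsCell k V) (h' : IsCell k W)
    (hVW : cell V ∩ cell W = convexHull ℝ ((V : Set (E d)) ∩ (W : Set (E d)))) :
    (cellFrame hd h).Compatible (cellFrame hd h') := by
  cases k
  · exact simplexFrame_compatible hd h h'
  · exact boxFrameOf_compatible hd h.choose_spec.choose_spec.1 h.choose_spec.choose_spec.2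
      h'.choose_spec.choose_spec.1 h'.choose_spec.choose_spec.2 hVW

end LOD

/-! ### Cells meeting in a common face -/

namespace LOD

open Set Filter Topology
open scoped ENNReal NNReal

lemma subset_cell {d : ℕ} (V : Finset (E d)) {p : E d} (hp : p ∈ V) : p ∈ cell V :=
  subset_convexHull ℝ _ hp

lemma convex_cell {d : ℕ} (V : Finset (E d)) : Convex ℝ (cell V) := convex_convexHull ℝ _

lemma isCompact_cell {d : ℕ} (V : Finset (E d)) : IsCompact (cell V) :=
  V.finite_toSet.isCompact_convexHull (𝕜 := ℝ)

lemma isClosed_cell {d : ℕ} (V : Finset (E d)) : IsClosed (cell V) := (isCompact_cell V).isClosed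

lemma affineMap_sub {d : ℕ} (f : E d →ᵃ[ℝ] ℝ) (x y : E d) : f.linear (x - y) = f x - f y :=
  f.linearMap_vsub x y

lemma affineMap_add {d : ℕ} (f : E d →ᵃ[ℝ] ℝ) (x v : E d) : f (x + v) = f x + f.linear v := by
  have := affineMap_sub f (x + v) x
  rw [add_sub_cancel_left] at this
  linarith

lemma affineMap_add_smul {d : ℕ} (f : E d →ᵃ[ℝ] ℝ) (x v : E d) (t : ℝ) :
    f (x + t • v) = f x + t * f.linear v := by
  rw [affineMap_add, map_smul, smul_eq_mul]

lemma continuous_affineMap {d : ℕ} (f : E d →ᵃ[ℝ] ℝ) : Continuous f :=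
  f.continuous_of_finiteDimensional

namespace CellFrame

variable {k : ElementKind} {d : ℕ} {V W : Finset (E d)} (F : CellFrame k V) (F' : CellFrame k W)

lemma lam_nonneg {x : E d} (hx : x ∈ cell V) (i : F.ι) : 0 ≤ F.lam i x := (F.mem_cell x).1 hx i

lemma lam_le_one {x : E d} (hx : x ∈ cell V) (i : F.ι) : F.lam i x ≤ 1 := by
  have hc : Convex ℝ {y : E d | F.lam i y ≤ 1} := by
    have := (convex_Iic (1 : ℝ)).affine_preimage (F.lam i)
    exact this
  refine convexHull_min (fun p hp => ?_) hc hx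
  rcases F.vertex p hp i with h | h <;> simp [h]

lemma nonempty (F : CellFrame k V) : V.Nonempty := by
  by_contra h
  rw [Finset.not_nonempty_iff_eq_empty] at h
  subst h
  have := F.repr _ (const_mem_polySub k d 1) 0
  simp at this

/-- The barycenter of a set of vertices lies strictly inside each facet function that does not
vanish on all of them. -/
lemma barycenter_spec {S : Finset (E d)} (hS : S.Nonempty) (hSV : S ⊆ V) :
    ∃ x, (∀ f : E d →ᵃ[ℝ] ℝ, (∀ p ∈ S, f p = 0) → f x = 0) ∧
      (∀ f : E d →ᵃ[ℝ] ℝ, (∀ p ∈ S, 0 ≤ f p) → (∃ p ∈ S, f p ≠ 0) → 0 < f x) ∧ x ∈ cell V := by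
  have hcard : (0 : ℝ) < S.card := by exact_mod_cast hS.card_pos
  have hw : ∑ p ∈ S, (S.card : ℝ)⁻¹ = 1 := by simp [hcard.ne']
  have key : ∀ f : E d →ᵃ[ℝ] ℝ, f (∑ p ∈ S, (S.card : ℝ)⁻¹ • p) = (S.card : ℝ)⁻¹ * ∑ p ∈ S, f p := by
    intro f
    have h1 : ∀ y, f y = f.linear y + f 0 := fun y => by simpa [add_comm] using affineMap_add f 0 y
    rw [h1, ← Finset.smul_sum, map_smul, map_sum, smul_eq_mul,
      Finset.sum_congr rfl fun p _ => h1 p, Finset.sum_add_distrib]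
    simp only [Finset.sum_const, nsmul_eq_mul, mul_add]
    field_simp
  refine ⟨∑ p ∈ S, (S.card : ℝ)⁻¹ • p, fun f hf => ?_, fun f h0 h1 => ?_, ?_⟩
  · rw [key, Finset.sum_eq_zero hf, mul_zero]
  · rw [key]
    obtain ⟨p, hp, hne⟩ := h1
    exact mul_pos (inv_pos.2 hcard)
      (Finset.sum_pos' h0 ⟨p, hp, lt_of_le_of_ne (h0 p hp) hne.symm⟩)
  · exact (convex_cell V).sum_mem (fun _ _ => by positivity) hw fun p hp => subset_cell V (hSV hp)

lemma vertex_nonneg {p : E d} (hp : p ∈ V) (i : F.ι) : 0 ≤ F.lam i p :=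
  F.lam_nonneg (subset_cell V hp) i

lemma exists_interior : ∃ x, ∀ i, 0 < F.lam i x := by
  obtain ⟨x, -, hx, -⟩ := barycenter_spec F.nonempty (Finset.Subset.refl V)
  refine ⟨x, fun i => hx _ (fun p hp => F.vertex_nonneg hp i) ?_⟩
  obtain ⟨p, hp, h1⟩ := F.exists_one i
  exact ⟨p, hp, by simp [h1]⟩

lemma eventually_pos {f : E d →ᵃ[ℝ] ℝ} {x : E d} (h : 0 < f x) : ∀ᶠ y in 𝓝 x, 0 < f y :=
  (continuous_affineMap f).continuousAt.eventually_const_lt h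

/-- A point with `lam i x = 0` leaves the cell at once along `dir i`, since `lam i` decreases at
unit rate there. -/
lemma mem_interior_iff (x : E d) : x ∈ interior (cell V) ↔ ∀ i, 0 < F.lam i x := by
  constructor
  · intro hx i
    refine lt_of_le_of_ne (F.lam_nonneg (interior_subset hx) i) fun h0 => ?_
    have h1 : Tendsto (fun t : ℝ => x + t • F.dir i) (𝓝[>] 0) (𝓝 x) := by
      have : Continuous fun t : ℝ => x + t • F.dir i := by fun_prop
      have := this.tendsto 0
      rw [zero_smul, add_zero] at this
      exact this.mono_left nhdsWithin_le_nhds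
    have h2 : ∀ᶠ t in 𝓝[>] (0 : ℝ), x + t • F.dir i ∈ interior (cell V) :=
      h1.eventually (isOpen_interior.mem_nhds hx)
    obtain ⟨t, ht, ht0⟩ := (h2.and self_mem_nhdsWithin).exists
    have := F.lam_nonneg (interior_subset ht) i
    rw [affineMap_add_smul, F.dir_self, ← h0] at this
    have : (0 : ℝ) < t := ht0
    linarith
  · intro hx
    rw [mem_interior_iff_mem_nhds]
    have : ∀ᶠ y in 𝓝 x, ∀ i, 0 < F.lam i y := eventually_all.2 fun i => eventually_pos (hx i)
    filter_upwards [this] with y hy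
    exact (F.mem_cell y).2 fun i => (hy i).le

lemma volume_pos (F : CellFrame k V) : volume (cell V) ≠ 0 := by
  obtain ⟨x, hx⟩ := F.exists_interior
  have : (interior (cell V)).Nonempty := ⟨x, (F.mem_interior_iff x).2 hx⟩
  exact (Measure.measure_pos_of_nonempty_interior _ this).ne'

/-- A nodal basis function of a cell. -/
noncomputable def shape (p x : E d) : ℝ := ∏ i, if F.lam i p = 1 then F.lam i x else 1

lemma shape_nonneg {x : E d} (hx : x ∈ cell V) (p : E d) : 0 ≤ F.shape p x :=
  Finset.prod_nonneg fun i _ => by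
    split_ifs
    · exact F.lam_nonneg hx i
    · exact zero_le_one

lemma shape_pos_iff {x : E d} (hx : x ∈ cell V) (p : E d) :
    0 < F.shape p x ↔ ∀ i, F.lam i p = 1 → 0 < F.lam i x := by
  constructor
  · intro h i hi
    refine lt_of_le_of_ne (F.lam_nonneg hx i) fun h0 => h.ne' ?_
    exact Finset.prod_eq_zero (Finset.mem_univ i) (by rw [if_pos hi, ← h0])
  · intro h
    exact Finset.prod_pos fun i _ => by
      split_ifs with hi
      · exact h i hi
      · exact zero_lt_one

lemma shape_self (p : E d) : F.shape p p = 1 :=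
  Finset.prod_eq_one fun i _ => by
    split_ifs with h
    · exact h
    · rfl

lemma shape_of_ne {p q : E d} (hp : p ∈ V) (hq : q ∈ V) (hpq : p ≠ q) : F.shape p q = 0 := by
  obtain ⟨i, h1, h0⟩ := F.sep p hp q hq hpq
  exact Finset.prod_eq_zero (Finset.mem_univ i) (by rw [if_pos h1, h0])

lemma sum_shape (x : E d) : ∑ p ∈ V, F.shape p x = 1 := by
  have := F.repr _ (const_mem_polySub k d 1) x
  simpa [shape] using this.symm

lemma repr_shape {q : E d → ℝ} (hq : q ∈ polySub k d) (x : E d) :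
    q x = ∑ p ∈ V, q p * F.shape p x := F.repr q hq x

lemma shape_mem_polySub {p : E d} (hp : p ∈ V) : F.shape p ∈ polySub k d := F.shape_mem p hp

variable {F F'}

/-- The smallest face of `V` containing `x` is spanned by common vertices. Indeed a facet function
vanishing at all common vertices vanishes at `x`, so it cannot equal `1` at `p` and must vanish
there; this puts `p` into the cell of `W`. Finally `p` is a vertex of `W`, being exposed by the sum
of the facet functions that vanish at it. -/
lemma mem_of_shape_pos (hc : F.Compatible F')
    (hVW : cell V ∩ cell W = convexHull ℝ ((V : Set (E d)) ∩ (W : Set (E d)))) {x p : E d}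
    (hxV : x ∈ cell V) (hxW : x ∈ cell W) (hp : p ∈ V) (h : ∀ i, F.lam i p = 1 → 0 < F.lam i x) :
    p ∈ W := by
  classical
  have hx : x ∈ convexHull ℝ ((V : Set (E d)) ∩ (W : Set (E d))) := hVW ▸ ⟨hxV, hxW⟩
  have hpW : p ∈ cell W := by
    refine hc.face p (subset_cell V hp) fun i hi => ?_
    refine (F.vertex p hp i).resolve_right fun h1 => (h i h1).ne' ?_
    have hcv : Convex ℝ {y : E d | F.lam i y = 0} := by
      have := (convex_singleton (0 : ℝ)).affine_preimage (F.lam i)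
      exact this
    exact convexHull_min (fun q hq => hi q hq.1 hq.2) hcv hx
  have hpc : p ∈ convexHull ℝ ((V : Set (E d)) ∩ (W : Set (E d))) :=
    hVW ▸ ⟨subset_cell V hp, hpW⟩
  refine (mem_of_mem_convexHull_of_le hpc
    (∑ i ∈ Finset.univ.filter (fun i => F.lam i p = 0), (F.lam i).linear) fun y hy hne => ?_).2
  rw [← sub_pos, ← map_sub, LinearMap.sum_apply]
  refine Finset.sum_pos' (fun i hi => ?_) ?_
  · rw [affineMap_sub, (Finset.mem_filter.1 hi).2, sub_zero]
    exact F.vertex_nonneg hy.1 i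
  · obtain ⟨i, h1, h0⟩ := F.sep y hy.1 p hp hne
    refine ⟨i, Finset.mem_filter.2 ⟨Finset.mem_univ i, h0⟩, ?_⟩
    rw [affineMap_sub, h0, h1]
    norm_num

lemma vertex_mem_of_mem_cell (hc : F.Compatible F')
    (hVW : cell V ∩ cell W = convexHull ℝ ((V : Set (E d)) ∩ (W : Set (E d)))) {p : E d}
    (hp : p ∈ V) (hpW : p ∈ cell W) : p ∈ W :=
  mem_of_shape_pos hc hVW (subset_cell V hp) hpW hp fun i h => by rw [h]; exact one_pos

/-- At an interior point all nodal basis functions are positive, so all vertices are shared; the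
roles of the cells can then be exchanged. -/
lemma eq_of_mem_interior (hc : F.Compatible F') (hc' : F'.Compatible F)
    (hVW : cell V ∩ cell W = convexHull ℝ ((V : Set (E d)) ∩ (W : Set (E d)))) {x : E d}
    (hx : ∀ i, 0 < F.lam i x) (hxW : x ∈ cell W) : V = W := by
  have hxV : x ∈ cell V := (F.mem_cell x).2 fun i => (hx i).le
  have h1 : V ⊆ W := fun p hp => mem_of_shape_pos hc hVW hxV hxW hp fun i _ => hx i
  have h2 : x ∈ interior (cell W) := by
    refine interior_mono ?_ ((F.mem_interior_iff x).2 hx)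
    exact convexHull_mono (Finset.coe_subset.2 h1)
  have hWV : cell W ∩ cell V = convexHull ℝ ((W : Set (E d)) ∩ (V : Set (E d))) := by
    rw [inter_comm, hVW, inter_comm]
  exact h1.antisymm fun p hp =>
    mem_of_shape_pos hc' hWV hxW hxV hp fun i _ => (F'.mem_interior_iff x).1 h2 i

lemma span_pos {i j : F.ι} (h : ∀ p ∈ V, F.lam i p = 0 → F.lam j p = 0) :
    ∃ c : ℝ, 0 < c ∧ ∀ x, F.lam j x = c * F.lam i x := by
  obtain ⟨c, hcx⟩ := F.span i (F.lam j) h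
  refine ⟨c, ?_, hcx⟩
  obtain ⟨p, hp, h1⟩ := F.exists_one i
  obtain ⟨q, hq, h2⟩ := F.exists_one j
  have h3 := F.vertex_nonneg hp j
  rw [hcx, h1, mul_one] at h3
  refine lt_of_le_of_ne h3 fun h0 => ?_
  rw [hcx, ← h0, zero_mul] at h2
  exact zero_ne_one h2

/-- Otherwise `lam j` would be a positive multiple of `lam i`, hence decreasing along `dir i`,
against `dir_ne`. -/
lemma eq_of_span {i j : F.ι} (h : ∀ p ∈ V, F.lam i p = 0 → F.lam j p = 0) : j = i := by
  by_contra hne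
  obtain ⟨c, hc0, hcx⟩ := span_pos h
  have h1 := F.dir_ne i j hne
  have h2 : (F.lam j).linear (F.dir i) = c * (F.lam i).linear (F.dir i) := by
    have e1 := affineMap_add (F.lam j) 0 (F.dir i)
    have e2 := affineMap_add (F.lam i) 0 (F.dir i)
    rw [hcx, hcx 0, e2] at e1
    linarith
  rw [h2, F.dir_self] at h1
  linarith

/-- A facet of a cell whose vertices belong to another cell is a facet of the other cell, which
lies on the other side of it. -/
lemma exists_opposite_facet (hc : F.Compatible F') (hc' : F'.Compatible F)
    (hVW : cell V ∩ cell W = convexHull ℝ ((V : Set (E d)) ∩ (W : Set (E d)))) (hne : V ≠ W)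
    {i : F.ι} {p : E d} (hp : p ∈ V) (hpi : F.lam i p = 0)
    (hF : ∀ q ∈ V, F.lam i q = 0 → q ∈ W) :
    ∃ (i' : F'.ι) (c : ℝ), c < 0 ∧ (∀ x, F'.lam i' x = c * F.lam i x) ∧
      ∀ q ∈ W, F'.lam i' q = 0 → q ∈ V := by
  classical
  have hWV : cell W ∩ cell V = convexHull ℝ ((W : Set (E d)) ∩ (V : Set (E d))) := by
    rw [inter_comm, hVW, inter_comm]
  have hspan : ∀ j : F'.ι, (∀ q ∈ W, q ∈ V → F'.lam j q = 0) →
      ∃ c : ℝ, c ≠ 0 ∧ ∀ x, F'.lam j x = c * F.lam i x := by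
    intro j hj
    obtain ⟨c, hcx⟩ := F.span i (F'.lam j) fun q hq h0 => hj q (hF q hq h0) hq
    refine ⟨c, ?_, hcx⟩
    rintro rfl
    obtain ⟨q, hq, h1⟩ := F'.exists_one j
    rw [hcx, zero_mul] at h1
    exact zero_ne_one h1
  -- A negative factor gives the opposite facet. If there is none, all facet functions of `W` that
  -- vanish on the common vertices have the same sign as `lam i`, so `W` lies on the same side of
  -- the facet as `V` and the interiors overlap.
  by_cases hex : ∃ (j : F'.ι) (c : ℝ), c < 0 ∧ (∀ q ∈ W, q ∈ V → F'.lam j q = 0) ∧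
      ∀ x, F'.lam j x = c * F.lam i x
  · obtain ⟨j, c, hc0, hj, hcx⟩ := hex
    refine ⟨j, c, hc0, hcx, fun q hq h0 => ?_⟩
    refine vertex_mem_of_mem_cell hc' hWV hq (hc'.face q (subset_cell W hq) fun m hm => ?_)
    obtain ⟨c', -, hcx'⟩ := hspan m hm
    rw [hcx, mul_eq_zero, or_iff_right hc0.ne] at h0
    rw [hcx', h0, mul_zero]
  · exfalso
    push Not at hex
    set S := V ∩ W with hS
    have hSne : S.Nonempty := ⟨p, Finset.mem_inter.2 ⟨hp, hF p hp hpi⟩⟩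
    obtain ⟨x, hx0, hxp, -⟩ := barycenter_spec hSne (Finset.inter_subset_left : S ⊆ V)
    -- pushing the barycenter of the common vertices off the facet leads into both interiors
    have hev : ∀ {U : Finset (E d)} (G : CellFrame k U) (m : G.ι), S ⊆ U →
        ((∀ q ∈ S, G.lam m q = 0) → ∃ c : ℝ, 0 < c ∧ ∀ x, G.lam m x = c * F.lam i x) →
        ∀ᶠ t in 𝓝[>] (0 : ℝ), 0 < G.lam m (x + t • (-F.dir i)) := by
      intro U G m hSU hm
      by_cases hz : ∀ q ∈ S, G.lam m q = 0
      · obtain ⟨c, hc0, hcx⟩ := hm hz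
        filter_upwards [self_mem_nhdsWithin] with t ht
        have ht' : (0 : ℝ) < t := ht
        have hxi : c * F.lam i x = 0 := by rw [← hcx]; exact hx0 _ hz
        rw [hcx, affineMap_add_smul, map_neg, F.dir_self, mul_add, hxi]
        simp only [neg_neg, mul_one, zero_add]
        positivity
      · push Not at hz
        have h1 := hxp (G.lam m) (fun q hq => G.vertex_nonneg (hSU hq) m) hz
        have h2 : Continuous fun t : ℝ => G.lam m (x + t • (-F.dir i)) :=
          (continuous_affineMap _).comp (by fun_prop)
        have h3 := h2.tendsto 0
        rw [zero_smul, add_zero] at h3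
        exact (h3.eventually (eventually_gt_nhds h1)).filter_mono nhdsWithin_le_nhds
    have h1 : ∀ᶠ t in 𝓝[>] (0 : ℝ), ∀ m, 0 < F.lam m (x + t • (-F.dir i)) :=
      eventually_all.2 fun m => hev F m Finset.inter_subset_left fun hz =>
        span_pos fun q hq h0 => hz q (Finset.mem_inter.2 ⟨hq, hF q hq h0⟩)
    have h2 : ∀ᶠ t in 𝓝[>] (0 : ℝ), ∀ m, 0 < F'.lam m (x + t • (-F.dir i)) :=
      eventually_all.2 fun m => hev F' m Finset.inter_subset_right fun hz => by
        have hz' : ∀ q ∈ W, q ∈ V → F'.lam m q = 0 := fun q hq hqV =>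
          hz q (Finset.mem_inter.2 ⟨hqV, hq⟩)
        obtain ⟨c, hc0, hcx⟩ := hspan m hz'
        refine ⟨c, lt_of_le_of_ne (not_lt.1 fun hneg => ?_) hc0.symm, hcx⟩
        obtain ⟨y, hy⟩ := hex m c hneg hz'
        exact hy (hcx y)
    obtain ⟨t, ht1, ht2⟩ := (h1.and h2).exists
    exact hne (eq_of_mem_interior hc hc' hVW ht1 ((F'.mem_cell _).2 fun m => (ht2 m).le))

/-- Two cells which share a facet cover a neighborhood of each relatively interior point of it. -/
lemma eventually_mem_union (hc : F.Compatible F') {i : F.ι} {i' : F'.ι} {c : ℝ} (hc0 : c < 0)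
    (hcx : ∀ x, F'.lam i' x = c * F.lam i x) (hF : ∀ q ∈ V, F.lam i q = 0 → q ∈ W) {x : E d}
    (hx0 : F.lam i x = 0) (hxp : ∀ j, j ≠ i → 0 < F.lam j x) :
    ∀ᶠ y in 𝓝 x, y ∈ cell V ∪ cell W := by
  have hfacet : ∀ y, F.lam i y = 0 → (∀ j, j ≠ i → 0 ≤ F.lam j y) → y ∈ cell W := by
    intro y hy0 hyp
    refine hc.face y ((F.mem_cell y).2 fun j => ?_) fun j hj => ?_
    · rcases eq_or_ne j i with rfl | h
      · exact hy0.ge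
      · exact hyp j h
    · obtain ⟨c', -, hcx'⟩ := span_pos (F := F) (i := i) (j := j) fun q hq h0 => hj q hq (hF q hq h0)
      rw [hcx', hy0, mul_zero]
  have hxW : x ∈ cell W := hfacet x hx0 fun j hj => (hxp j hj).le
  have hpos' : ∀ m, m ≠ i' → 0 < F'.lam m x := by
    intro m hm
    refine lt_of_le_of_ne (F'.lam_nonneg hxW m) fun h0 => hm ?_
    -- The segment from `p` to `x` can be prolonged a little inside the facet. A function that is
    -- affine, nonnegative at both ends and zero at `x` vanishes at `p`.
    have hz : ∀ p ∈ V, F.lam i p = 0 → F'.lam m p = 0 := by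
      intro p hp hpi
      have hev : ∀ᶠ t in 𝓝[>] (0 : ℝ), ∀ j, j ≠ i → 0 ≤ F.lam j (x + t • (x - p)) := by
        refine eventually_all.2 fun j => ?_
        by_cases hj : j = i
        · exact Eventually.of_forall fun t h => absurd hj h
        have h2 : Continuous fun t : ℝ => F.lam j (x + t • (x - p)) :=
          (continuous_affineMap _).comp (by fun_prop)
        have h3 := h2.tendsto 0
        rw [zero_smul, add_zero] at h3
        filter_upwards [(h3.eventually (eventually_gt_nhds (hxp j hj))).filter_mono
          nhdsWithin_le_nhds] with t ht _ using ht.le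
      obtain ⟨t, ht, ht0⟩ := (hev.and self_mem_nhdsWithin).exists
      have ht0' : (0 : ℝ) < t := ht0
      have hmem := hfacet (x + t • (x - p))
        (by rw [affineMap_add_smul, affineMap_sub, hx0, hpi]; ring) ht
      have h4 := F'.lam_nonneg hmem m
      rw [affineMap_add_smul, affineMap_sub, ← h0] at h4
      have h5 := F'.vertex_nonneg (hF p hp hpi) m
      nlinarith
    refine eq_of_span fun q hq hq0 => ?_
    obtain ⟨c', hcx'⟩ := F.span i (F'.lam m) hz
    rw [hcx, mul_eq_zero, or_iff_right hc0.ne] at hq0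
    rw [hcx', hq0, mul_zero]
  have h1 : ∀ᶠ y in 𝓝 x, ∀ j, j ≠ i → 0 < F.lam j y := eventually_all.2 fun j => by
    by_cases hj : j = i
    · exact Eventually.of_forall fun t h => absurd hj h
    · filter_upwards [eventually_pos (hxp j hj)] with y hy _ using hy
  have h2 : ∀ᶠ y in 𝓝 x, ∀ j, j ≠ i' → 0 < F'.lam j y := eventually_all.2 fun j => by
    by_cases hj : j = i'
    · exact Eventually.of_forall fun t h => absurd hj h
    · filter_upwards [eventually_pos (hpos' j hj)] with y hy _ using hy
  filter_upwards [h1, h2] with y hy1 hy2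
  rcases le_or_gt 0 (F.lam i y) with hi | hi
  · refine Or.inl ((F.mem_cell y).2 fun j => ?_)
    rcases eq_or_ne j i with rfl | h
    · exact hi
    · exact (hy1 j h).le
  · refine Or.inr ((F'.mem_cell y).2 fun j => ?_)
    rcases eq_or_ne j i' with rfl | h
    · rw [hcx]; exact (mul_pos_of_neg_of_neg hc0 hi).le
    · exact (hy2 j h).le

/-- On the intersection of two cells the nodal basis functions of common vertices agree. -/
lemma shape_eq_shape (hc : F.Compatible F')
    (hVW : cell V ∩ cell W = convexHull ℝ ((V : Set (E d)) ∩ (W : Set (E d)))) {x p : E d}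
    (hxV : x ∈ cell V) (hxW : x ∈ cell W) (hpV : p ∈ V) (hpW : p ∈ W) :
    F'.shape p x = F.shape p x := by
  rw [F.repr_shape (F'.shape_mem_polySub hpW) x, Finset.sum_eq_single_of_mem p hpV, F'.shape_self,
    one_mul]
  intro q hq hqp
  by_cases hqW : q ∈ W
  · rw [F'.shape_of_ne hpW hqW hqp.symm, zero_mul]
  · have : F.shape q x = 0 := by
      refine le_antisymm (not_lt.1 fun h => hqW ?_) (F.shape_nonneg hxV q)
      exact mem_of_shape_pos hc hVW hxV hxW hq ((F.shape_pos_iff hxV q).1 h)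
    rw [this, mul_zero]

end CellFrame

end LOD

/-! ### Cells around a vertex and crossing of facets -/

namespace LOD

open Set Filter Topology
open scoped ENNReal NNReal

/-- Finitely many nonzero affine functions are simultaneously nonzero at some point of any nonempty
open set. -/
lemma exists_mem_forall_affine_ne_zero {d : ℕ} {O : Set (E d)} (hO : IsOpen O) (hne : O.Nonempty)
    {S : Set (E d →ᵃ[ℝ] ℝ)} (hS : S.Finite) (h : ∀ f ∈ S, ∃ y, f y ≠ 0) :
    ∃ a ∈ O, ∀ f ∈ S, f a ≠ 0 := by
  induction S, hS using Set.Finite.induction_on generalizing O with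
  | empty => exact ⟨hne.some, hne.some_mem, by simp⟩
  | @insert f S _ _ ih =>
    obtain ⟨y, hy⟩ := h f (mem_insert _ _)
    have hO' : IsOpen (O ∩ {z | f z ≠ 0}) :=
      hO.inter (isOpen_ne_fun (continuous_affineMap f) continuous_const)
    have hne' : (O ∩ {z | f z ≠ 0}).Nonempty := by
      obtain ⟨x, hx⟩ := hne
      by_cases hfx : f x = 0
      · have hc : Continuous fun t : ℝ => x + t • (y - x) := by fun_prop
        have ht := hc.tendsto 0
        rw [zero_smul, add_zero] at ht
        have hev : ∀ᶠ t in 𝓝[>] (0 : ℝ), x + t • (y - x) ∈ O :=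
          (ht.eventually (hO.mem_nhds hx)).filter_mono nhdsWithin_le_nhds
        obtain ⟨t, ht, ht0⟩ := (hev.and self_mem_nhdsWithin).exists
        refine ⟨_, ht, ?_⟩
        have ht0' : (0 : ℝ) < t := ht0
        rw [mem_ofPred_eq, affineMap_add_smul, affineMap_sub, hfx]
        simp [ht0'.ne', hy]
      · exact ⟨x, hx, hfx⟩
    obtain ⟨a, ha, hal⟩ := ih hO' hne' fun g hg => h g (mem_insert_of_mem _ hg)
    exact ⟨a, ha.1, forall_mem_insert.2 ⟨ha.2, hal⟩⟩

namespace Mesh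

variable {k : ElementKind} {d : ℕ} (M : Mesh k d) (hd : 1 ≤ d)

/-- The frame of a cell of the mesh. -/
noncomputable def frame {V : Finset (E d)} (hV : V ∈ M.cells) : CellFrame k V :=
  cellFrame hd (M.isCell V hV)

lemma compatible {V W : Finset (E d)} (hV : V ∈ M.cells) (hW : W ∈ M.cells) :
    (M.frame hd hV).Compatible (M.frame hd hW) :=
  cellFrame_compatible hd _ _ (M.conforming V hV W hW)

lemma mem_star {p : E d} {V : Finset (E d)} : V ∈ M.star p ↔ V ∈ M.cells ∧ p ∈ V := by
  classical
  rw [star, Finset.mem_filter]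

lemma isOpen_domain : IsOpen M.domain := isOpen_interior

lemma exists_cell_of_mem_domain {x : E d} (hx : x ∈ M.domain) : ∃ V ∈ M.cells, x ∈ cell V := by
  simpa using interior_subset hx

lemma eventually_mem_cell (x : E d) :
    ∀ᶠ y in 𝓝 x, ∀ V ∈ M.cells, y ∈ cell V → x ∈ cell V := by
  refine (Finset.eventually_all M.cells).2 ?_
  intro V _
  by_cases hx : x ∈ cell V
  · exact Eventually.of_forall fun _ _ => hx
  · filter_upwards [(isClosed_cell V).isOpen_compl.mem_nhds hx] with y hy h using absurd h hy

lemma mem_domain_iff (x : E d) :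
    x ∈ M.domain ↔ ∀ᶠ y in 𝓝 x, ∃ V ∈ M.cells, y ∈ cell V := by
  rw [domain, mem_interior_iff_mem_nhds]
  refine eventually_congr (Eventually.of_forall fun y => ?_)
  exact mem_iUnion₂.trans (by simp)

lemma interior_subset_domain {V : Finset (E d)} (hV : V ∈ M.cells) :
    interior (cell V) ⊆ M.domain :=
  interior_mono (subset_biUnion_of_mem (u := fun V => cell V) hV)

/-- The relative interior of a facet that belongs to a single cell lies on the boundary. -/
lemma notMem_domain_of_unshared {V : Finset (E d)} (hV : V ∈ M.cells) {i : (M.frame hd hV).ι}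
    (hu : ∀ W ∈ M.cells, W ≠ V → ∃ q ∈ V, (M.frame hd hV).lam i q = 0 ∧ q ∉ W) {x : E d}
    (hx0 : (M.frame hd hV).lam i x = 0) (hxp : ∀ j, j ≠ i → 0 < (M.frame hd hV).lam j x) :
    x ∉ M.domain := by
  intro hx
  have hxV : x ∈ cell V := ((M.frame hd hV).mem_cell x).2 fun j => by
    rcases eq_or_ne j i with rfl | h
    · exact hx0.ge
    · exact (hxp j h).le
  -- Close to `x` only cells containing `x` occur, and such a cell contains all vertices of the
  -- facet, so it is `V`.
  have hi : x ∈ interior (cell V) := by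
    rw [mem_interior_iff_mem_nhds]
    filter_upwards [(M.mem_domain_iff x).1 hx, M.eventually_mem_cell x] with y ⟨W, hW, hyW⟩ hy
    rcases eq_or_ne W V with rfl | hne
    · exact hyW
    · obtain ⟨q, hq, hq0, hqW⟩ := hu W hW hne
      refine absurd ?_ hqW
      refine CellFrame.mem_of_shape_pos (M.compatible hd hV hW) (M.conforming V hV W hW) hxV
        (hy W hW hyW) hq fun j hj => hxp j ?_
      rintro rfl
      rw [hq0] at hj
      exact zero_ne_one hj
  exact (((M.frame hd hV).mem_interior_iff x).1 hi i).ne' hx0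

/-- Two cells with vertex `p` that share a facet containing `p`. -/
def FacetAdj (p : E d) (V W : Finset (E d)) : Prop :=
  ∃ (hV : V ∈ M.cells) (_ : W ∈ M.cells), p ∈ V ∧ V ≠ W ∧
    ∃ i, (M.frame hd hV).lam i p = 0 ∧ ∀ q ∈ V, (M.frame hd hV).lam i q = 0 → q ∈ W

lemma FacetAdj.symm {M : Mesh k d} {hd : 1 ≤ d} {p : E d} {V W : Finset (E d)}
    (h : M.FacetAdj hd p V W) : M.FacetAdj hd p W V := by
  obtain ⟨hV, hW, hp, hne, i, hi, hF⟩ := h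
  obtain ⟨i', c, hc, hcx, hF'⟩ := CellFrame.exists_opposite_facet (M.compatible hd hV hW)
    (M.compatible hd hW hV) (M.conforming V hV W hW) hne hp hi hF
  exact ⟨hW, hV, hF p hp hi, hne.symm, i', by rw [hcx, hi, mul_zero], hF'⟩

/-- The graph of the cells with vertex `p`, in which neighbors share a facet at `p`. -/
def starGraph (p : E d) : SimpleGraph (M.star p) where
  Adj V W := M.FacetAdj hd p V W
  symm := ⟨fun _ _ h => h.symm⟩
  loopless := ⟨fun _ ⟨_, _, _, hne, _⟩ => hne rfl⟩

/-- A facet at `p` that belongs to a single cell. -/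
def HasFreeFacet (p : E d) (V : Finset (E d)) : Prop :=
  ∃ (hV : V ∈ M.cells) (i : (M.frame hd hV).ι), (M.frame hd hV).lam i p = 0 ∧
    ∀ W ∈ M.cells, W ≠ V → ∃ q ∈ V, (M.frame hd hV).lam i q = 0 ∧ q ∉ W

/-- In this neighborhood the only facets of cells at `p` that can be met are those through `p`. -/
lemma exists_ball (p : E d) : ∃ B : Set (E d), IsOpen B ∧ Convex ℝ B ∧ p ∈ B ∧
    ∀ V (hV : V ∈ M.cells), ∀ i, (M.frame hd hV).lam i p = 1 →
      ∀ y ∈ B, 0 < (M.frame hd hV).lam i y := by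
  have h : ∀ᶠ y in 𝓝 p, ∀ V : M.cells, ∀ i, (M.frame hd V.2).lam i p = 1 →
      0 < (M.frame hd V.2).lam i y := by
    refine eventually_all.2 fun V => eventually_all.2 fun i => ?_
    by_cases hi : (M.frame hd V.2).lam i p = 1
    · filter_upwards [CellFrame.eventually_pos (x := p) (by rw [hi]; exact one_pos)] with y hy _
        using hy
    · exact Eventually.of_forall fun y h => absurd h hi
  obtain ⟨ε, hε, hb⟩ := Metric.eventually_nhds_iff_ball.1 h
  exact ⟨Metric.ball p ε, Metric.isOpen_ball, convex_ball p ε, Metric.mem_ball_self hε,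
    fun V hV i hi y hy => hb y hy ⟨V, hV⟩ i hi⟩

lemma exists_interior_mem_open (hd : 1 ≤ d) {p : E d} {V : Finset (E d)} (hV : V ∈ M.cells) (hp : p ∈ V)
    {B : Set (E d)} (hB : IsOpen B) (hpB : p ∈ B) : (interior (cell V) ∩ B).Nonempty := by
  obtain ⟨x, hx⟩ := (cellFrame hd (M.isCell V hV)).exists_interior
  have hcl : p ∈ closure (interior (cell V)) := by
    rw [(convex_cell V).closure_interior_eq_closure_of_nonempty_interior
      ⟨x, ((cellFrame hd (M.isCell V hV)).mem_interior_iff x).2 hx⟩]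
    exact subset_closure (subset_cell V hp)
  rw [inter_comm]
  exact mem_closure_iff.1 hcl B hB hpB

/-- The dichotomy for the cells at a vertex `p` that can be reached from a given one by crossing
facets at `p`: either one of them has a facet on the boundary, or they are all the cells at `p`
and cover a neighborhood of `p`. -/
lemma reachable_hasFreeFacet_or {p : E d} (T : M.star p) :
    (∃ V, (M.starGraph hd p).Reachable T V ∧ M.HasFreeFacet hd p V) ∨
      (p ∈ M.domain ∧ ∀ W, (M.starGraph hd p).Reachable T W) := by
  classical
  rw [or_iff_not_imp_left]
  intro hno
  push Not at hno
  obtain ⟨hT, hpT⟩ := M.mem_star.1 T.2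
  obtain ⟨B, hBo, hBc, hpB, hBpos⟩ := M.exists_ball hd p
  set U : Set (E d) := ⋃ V ∈ {V : M.star p | (M.starGraph hd p).Reachable T V}, cell V.1 with hU
  have hUc : IsClosed U := (Set.toFinite _).isClosed_biUnion fun V _ => isClosed_cell V.1
  have hstar : ∀ V : M.star p, V.1 ∈ M.cells := fun V => (M.mem_star.1 V.2).1
  have hpV : ∀ V : M.star p, p ∈ V.1 := fun V => (M.mem_star.1 V.2).2
  -- a generic starting point
  obtain ⟨a, ⟨haT, haB⟩, hagen⟩ := exists_mem_forall_affine_ne_zero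
    (isOpen_interior.inter hBo) (M.exists_interior_mem_open hd hT hpT hBo hpB)
    (S := range fun j : (Σ V : M.star p, (M.frame hd (hstar V)).ι) =>
      (M.frame hd (hstar j.1)).lam j.2) (Set.finite_range _) (by
        rintro _ ⟨⟨V, i⟩, rfl⟩
        obtain ⟨q, -, h1⟩ := (M.frame hd (hstar V)).exists_one i
        exact ⟨q, by simp only [h1]; norm_num⟩)
  have hagen' : ∀ (V : M.star p) i, (M.frame hd (hstar V)).lam i a ≠ 0 := fun V i =>
    hagen _ ⟨⟨V, i⟩, rfl⟩
  -- the neighborhood is covered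
  have hcover : B ⊆ U := by
    by_contra hBU
    obtain ⟨z0, hz0B, hz0U⟩ := not_subset.1 hBU
    -- If `lam i` and `lam j` vanish at the same point of the segment from `a` to `z`, then `lam i a
    -- * lam j - lam j a * lam i` vanishes at `z`. A generic `z` off `U` excludes this, so the
    -- segment crosses one facet of a cell at a time. The combinations are nonzero by `edge`.
    obtain ⟨z, ⟨hzB, hzU⟩, hzgen⟩ := exists_mem_forall_affine_ne_zero
      (hBo.inter hUc.isOpen_compl) ⟨z0, hz0B, hz0U⟩
      (S := ⋃ V : M.star p, ⋃ i ∈ {i | (M.frame hd (hstar V)).lam i p = 0},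
        ⋃ j ∈ {j | (M.frame hd (hstar V)).lam j p = 0 ∧ j ≠ i},
        {(M.frame hd (hstar V)).lam i a • (M.frame hd (hstar V)).lam j -
          (M.frame hd (hstar V)).lam j a • (M.frame hd (hstar V)).lam i})
      (Set.finite_iUnion fun V => (Set.toFinite _).biUnion fun i _ =>
        (Set.toFinite _).biUnion fun j _ => Set.finite_singleton _) (by
        intro f hf
        simp only [mem_iUnion, mem_singleton_iff, mem_ofPred_eq] at hf
        obtain ⟨V, i, hi, j, ⟨hj, hji⟩, rfl⟩ := hf
        obtain ⟨q, hq, hqi, hqo⟩ := (M.frame hd (hstar V)).edge p (hpV V) i hi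
        refine ⟨q, ?_⟩
        simp [hqi, hqo j hji hj, hagen' V j])
    refine hzU ?_
    -- The parameters whose points lie in `U` form a closed set containing `0`. It remains to see
    -- that `U` is a neighborhood of each point reached: trivially inside a cell, and otherwise by
    -- passing to the neighbor across the single facet met, which exists because no reachable cell
    -- has a free facet.
    have hseg : Icc (0 : ℝ) 1 ⊆ {s : ℝ | a + s • (z - a) ∈ U} := by
      have hcont : Continuous fun s : ℝ => a + s • (z - a) := by fun_prop
      refine IsClosed.Icc_subset_of_forall_mem_nhdsWithin
        ((hUc.preimage hcont).inter isClosed_Icc) ?_ ?_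
      · rw [mem_ofPred_eq, zero_smul, add_zero]
        exact mem_biUnion (x := T) (SimpleGraph.Reachable.refl T) (interior_subset haT)
      · rintro s ⟨hs, hs0, hs1⟩
        refine mem_nhdsWithin_of_mem_nhds (hcont.continuousAt ?_)
        obtain ⟨V, hVr, hxV⟩ := mem_iUnion₂.1 hs
        set x := a + s • (z - a) with hx
        have hxB : x ∈ B := hBc.add_smul_sub_mem haB hzB ⟨hs0, hs1.le⟩
        set F := M.frame hd (hstar V) with hF
        have hVU : cell V.1 ⊆ U := subset_biUnion_of_mem
          (u := fun V : M.star p => cell V.1) hVr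
        by_cases hint : ∀ i, 0 < F.lam i x
        · exact mem_of_superset (mem_interior_iff_mem_nhds.1 ((F.mem_interior_iff x).2 hint)) hVU
        push Not at hint
        obtain ⟨i, hi⟩ := hint
        have hxi : F.lam i x = 0 := le_antisymm hi (F.lam_nonneg hxV i)
        have hp0 : ∀ j, F.lam j x = 0 → F.lam j p = 0 := fun j hj =>
          (F.vertex p (hpV V) j).resolve_right fun h1 => (hBpos V.1 (hstar V) j h1 x hxB).ne' hj
        have hxp : ∀ j, j ≠ i → 0 < F.lam j x := by
          intro j hji
          refine lt_of_le_of_ne (F.lam_nonneg hxV j) fun h0 => ?_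
          have hg := hzgen _ (mem_iUnion.2 ⟨V, mem_biUnion (hp0 i hxi)
            (mem_biUnion (show j ∈ {j | F.lam j p = 0 ∧ j ≠ i} from ⟨hp0 j h0.symm, hji⟩)
              (mem_singleton _))⟩)
          simp only [AffineMap.coe_sub, AffineMap.coe_smul, Pi.sub_apply, Pi.smul_apply,
            smul_eq_mul] at hg
          rw [hx, affineMap_add_smul, affineMap_sub] at hxi h0
          rcases eq_or_ne s 0 with rfl | hsne
          · exact hagen' V i (by simpa using hxi)
          · refine hg ((mul_eq_zero.1 (?_ : s * _ = 0)).resolve_left hsne)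
            linear_combination (-F.lam j a) * hxi - (F.lam i a) * h0
        have hshared : ∃ W ∈ M.cells, W ≠ V.1 ∧ ∀ q ∈ V.1, F.lam i q = 0 → q ∈ W := by
          by_contra! hcon
          exact hno V hVr ⟨hstar V, i, hp0 i hxi, hcon⟩
        obtain ⟨W, hW, hWV, hFW⟩ := hshared
        have hadj : M.FacetAdj hd p V.1 W :=
          ⟨hstar V, hW, hpV V, hWV.symm, i, hp0 i hxi, hFW⟩
        have hWr : (M.starGraph hd p).Reachable T
            ⟨W, M.mem_star.2 ⟨hW, hFW p (hpV V) (hp0 i hxi)⟩⟩ :=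
          hVr.trans (SimpleGraph.Adj.reachable hadj)
        obtain ⟨i', c, hc, hcx, -⟩ := CellFrame.exists_opposite_facet
          (M.compatible hd (hstar V) hW) (M.compatible hd hW (hstar V))
          (M.conforming V.1 (hstar V) W hW) hWV.symm (hpV V) (hp0 i hxi) hFW
        refine mem_of_superset (CellFrame.eventually_mem_union (M.compatible hd (hstar V) hW)
          hc hcx hFW hxi hxp) (union_subset hVU ?_)
        exact subset_biUnion_of_mem (s := {V : M.star p | (M.starGraph hd p).Reachable T V})
          (u := fun V : M.star p => cell V.1) hWr
    have := hseg (right_mem_Icc.2 zero_le_one)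
    simpa using this
  refine ⟨(M.mem_domain_iff p).2 ?_, fun W => ?_⟩
  · filter_upwards [hBo.mem_nhds hpB] with y hy
    obtain ⟨V, -, hyV⟩ := mem_iUnion₂.1 (hcover hy)
    exact ⟨V.1, hstar V, hyV⟩
  -- Every cell at `p` has interior points near `p`; these are covered by a reachable cell, which
  -- must be the same cell.
  · obtain ⟨y, hyW, hyB⟩ := M.exists_interior_mem_open hd (hstar W) (hpV W) hBo hpB
    obtain ⟨V, hVr, hyV⟩ := mem_iUnion₂.1 (hcover hyB)
    have := CellFrame.eq_of_mem_interior (M.compatible hd (hstar W) (hstar V))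
      (M.compatible hd (hstar V) (hstar W)) (M.conforming W.1 (hstar W) V.1 (hstar V))
      (((M.frame hd (hstar W)).mem_interior_iff y).1 hyW) hyV
    rw [Subtype.ext this]
    exact hVr

/-- The part of a cell where the nodal basis function of an interior vertex is positive lies in the
domain. -/
lemma mem_domain_of_shape_pos {p : E d} (hp : p ∈ M.domain) {V : Finset (E d)} (hV : V ∈ M.cells)
    (hpV : p ∈ V) {x : E d} (hx : x ∈ cell V) (hpos : 0 < (M.frame hd hV).shape p x) :
    x ∈ M.domain := by
  -- A point `y` near `x` is contracted towards `p` by a small factor `t`; the contracted point lies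
  -- in a cell `W` with vertex `p`. The facet functions of `W` vanishing at `p` are merely scaled by
  -- `t`, so they are nonnegative at `y`, and the others are positive at `x` because the nodal
  -- function is. Hence `y` lies in `W` as well.
  have hP : ∀ᶠ y in 𝓝 p, (∃ W ∈ M.cells, y ∈ cell W) ∧ ∀ W ∈ M.cells, y ∈ cell W → p ∈ cell W :=
    ((M.mem_domain_iff p).1 hp).and (M.eventually_mem_cell p)
  have hcont : Continuous fun t : ℝ => p + t • (x - p) := by fun_prop
  have htend := hcont.tendsto 0
  rw [zero_smul, add_zero] at htend
  have hev := (htend.eventually hP.eventually_nhds).filter_mono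
    (nhdsWithin_le_nhds (s := Ioi 0))
  have hev1 : ∀ᶠ t in 𝓝[>] (0 : ℝ), t < 1 :=
    (eventually_lt_nhds one_pos).filter_mono nhdsWithin_le_nhds
  obtain ⟨t, ⟨ht, ht1⟩, ht0⟩ := ((hev.and hev1).and self_mem_nhdsWithin).exists
  replace ht0 : (0 : ℝ) < t := ht0
  have hcy : Continuous fun y : E d => p + t • (y - p) := by fun_prop
  have h1 := hcy.continuousAt.eventually ht
  have h2 := hcy.continuousAt.eventually (M.eventually_mem_cell (p + t • (x - p)))
  have h3 : ∀ᶠ y in 𝓝 x, ∀ W : M.cells, ∀ j, 0 < (M.frame hd W.2).lam j x →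
      0 < (M.frame hd W.2).lam j y := by
    refine eventually_all.2 fun W => eventually_all.2 fun j => ?_
    by_cases hj : 0 < (M.frame hd W.2).lam j x
    · filter_upwards [CellFrame.eventually_pos hj] with y hy _ using hy
    · exact Eventually.of_forall fun y h => absurd h hj
  refine (M.mem_domain_iff x).2 ?_
  filter_upwards [h1, h2, h3] with y hy1 hy2 hy3
  obtain ⟨⟨W, hW, hyW⟩, hy1'⟩ := hy1
  have hpW : p ∈ W := CellFrame.vertex_mem_of_mem_cell (M.compatible hd hV hW)
    (M.conforming V hV W hW) hpV (hy1' W hW hyW)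
  have hxtW := hy2 W hW hyW
  have hxtV : p + t • (x - p) ∈ cell V :=
    (convex_cell V).add_smul_sub_mem (subset_cell V hpV) hx ⟨ht0.le, ht1.le⟩
  have hxW : x ∈ cell W := by
    refine (M.compatible hd hV hW).face x hx fun i hi => ?_
    have hcv : Convex ℝ {y : E d | (M.frame hd hV).lam i y = 0} := by
      have := (convex_singleton (0 : ℝ)).affine_preimage ((M.frame hd hV).lam i)
      exact this
    have hmem : p + t • (x - p) ∈ convexHull ℝ ((V : Set (E d)) ∩ (W : Set (E d))) :=
      M.conforming V hV W hW ▸ ⟨hxtV, hxtW⟩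
    have h0 : (M.frame hd hV).lam i (p + t • (x - p)) = 0 :=
      convexHull_min (fun q hq => hi q hq.1 hq.2) hcv hmem
    rw [affineMap_add_smul, affineMap_sub, hi p hpV hpW] at h0
    simpa [ht0.ne'] using h0
  rw [← CellFrame.shape_eq_shape (M.compatible hd hV hW) (M.conforming V hV W hW) hx hxW hpV hpW,
    CellFrame.shape_pos_iff _ hxW] at hpos
  refine ⟨W, hW, ((M.frame hd hW).mem_cell y).2 fun j => ?_⟩
  rcases (M.frame hd hW).vertex p hpW j with h0 | h1
  · have := (M.frame hd hW).lam_nonneg hyW j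
    rw [affineMap_add_smul, affineMap_sub, h0, sub_zero, zero_add] at this
    exact nonneg_of_mul_nonneg_right this ht0
  · exact (hy3 ⟨W, hW⟩ j (hpos j h1)).le

end Mesh

end LOD

/-! ### Finite element spaces -/

namespace LOD

open Set Filter Topology
open scoped ENNReal NNReal

lemma contDiff_of_mem_polySub {k : ElementKind} {d : ℕ} {q : E d → ℝ} (hq : q ∈ polySub k d) :
    ContDiff ℝ 1 q := by
  cases k
  · obtain ⟨c, g, h⟩ := hq
    rw [funext h]
    fun_prop
  · obtain ⟨c, h⟩ := hq
    rw [funext h]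
    exact ContDiff.sum fun S _ => contDiff_const.mul (contDiff_prod fun i _ => by fun_prop)

lemma continuous_of_mem_polySub {k : ElementKind} {d : ℕ} {q : E d → ℝ} (hq : q ∈ polySub k d) :
    Continuous q := (contDiff_of_mem_polySub hq).continuous

/-- A continuous function which is Lipschitz on each set of a finite closed cover is Lipschitz. -/
lemma lipschitzWith_of_finite_closed_cover {d : ℕ} {κ : Type*} [Finite κ] {S : κ → Set (E d)}
    (hS : ∀ j, IsClosed (S j)) (hcov : ∀ x, ∃ j, x ∈ S j) {v : E d → ℝ} (hv : Continuous v)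
    {K : ℝ≥0} (hK : ∀ j, LipschitzOnWith K v (S j)) : LipschitzWith K v := by
  have key : ∀ x y, v y ≤ v x + K * ‖y - x‖ := by
    intro x y
    have hγ : Continuous fun t : ℝ => x + t • (y - x) := by fun_prop
    have hB : ∀ t : ℝ, HasDerivAt (fun t : ℝ => v x + (K * ‖y - x‖) * t) (K * ‖y - x‖) t := by
      intro t
      simpa using ((hasDerivAt_id t).const_mul (K * ‖y - x‖)).const_add (v x)
    have := image_le_of_liminf_slope_right_le_deriv_boundary (f := fun t : ℝ => v (x + t • (y - x)))
      (a := 0) (b := 1) (hv.comp hγ).continuousOn (B := fun t => v x + (K * ‖y - x‖) * t)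
      (B' := fun _ => K * ‖y - x‖) (by simp)
      (fun t _ => (hB t).continuousAt.continuousWithinAt) (fun t _ => (hB t).hasDerivWithinAt)
      (fun t _ r hr => ?_) (right_mem_Icc.2 zero_le_one)
    · simpa using this
    -- Shortly after time `t` the segment visits only sets that already contain its current point,
    -- so one of the Lipschitz bounds applies to the difference quotient.
    · have hloc : ∀ᶠ z in 𝓝 (x + t • (y - x)), ∀ j, z ∈ S j → x + t • (y - x) ∈ S j := by
        refine eventually_all.2 fun j => ?_
        by_cases hx : x + t • (y - x) ∈ S j
        · exact Eventually.of_forall fun _ _ => hx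
        · filter_upwards [(hS j).isOpen_compl.mem_nhds hx] with z hz h using absurd h hz
      have hev := (hγ.continuousAt.eventually hloc).filter_mono (nhdsWithin_le_nhds (s := Ioi t))
      refine (Eventually.frequently ?_)
      filter_upwards [hev, self_mem_nhdsWithin] with s hs hst
      have hst' : 0 < s - t := sub_pos.2 hst
      obtain ⟨j, hj⟩ := hcov (x + s • (y - x))
      have hd := (hK j).dist_le_mul _ hj _ (hs j hj)
      rw [dist_add_left, Real.dist_eq, dist_eq_norm, ← sub_smul, norm_smul,
        Real.norm_of_nonneg hst'.le] at hd
      rw [slope_def_field]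
      refine lt_of_le_of_lt ?_ hr
      rw [div_le_iff₀ hst']
      calc _ ≤ _ := le_abs_self _
        _ ≤ _ := hd
        _ = _ := by ring
  refine LipschitzWith.of_dist_le_mul fun x y => ?_
  rw [Real.dist_eq, abs_le, dist_eq_norm]
  have h1 := key x y
  have h2 := key y x
  rw [norm_sub_rev] at h1
  constructor <;> linarith

namespace Mesh

variable {k : ElementKind} {d : ℕ} (M : Mesh k d)

/-- The finite element space as a submodule. -/
def feSub : Submodule ℝ (E d → ℝ) where
  carrier := M.feSpace
  zero_mem' := ⟨continuous_zero, fun _ _ => ⟨0, (polySub k d).zero_mem, fun _ _ => rfl⟩,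
    fun _ _ => rfl⟩
  add_mem' := by
    rintro f g ⟨hf, hf1, hf2⟩ ⟨hg, hg1, hg2⟩
    refine ⟨hf.add hg, fun V hV => ?_, fun x hx => by simp [hf2 x hx, hg2 x hx]⟩
    obtain ⟨q, hq, hfq⟩ := hf1 V hV
    obtain ⟨r, hr, hgr⟩ := hg1 V hV
    exact ⟨q + r, (polySub k d).add_mem hq hr, fun x hx => by simp [hfq x hx, hgr x hx]⟩
  smul_mem' := by
    rintro c f ⟨hf, hf1, hf2⟩
    refine ⟨hf.const_smul c, fun V hV => ?_, fun x hx => by simp [hf2 x hx]⟩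
    obtain ⟨q, hq, hfq⟩ := hf1 V hV
    exact ⟨c • q, (polySub k d).smul_mem c hq, fun x hx => by simp [hfq x hx]⟩

variable {M}

lemma mem_feSub {v : E d → ℝ} : v ∈ M.feSub ↔ v ∈ M.feSpace := Iff.rfl

lemma feSpace_eq_sum_shape (hd : 1 ≤ d) {v : E d → ℝ} (hv : v ∈ M.feSpace) {V : Finset (E d)}
    (hV : V ∈ M.cells) {x : E d} (hx : x ∈ cell V) :
    v x = ∑ p ∈ V, v p * (M.frame hd hV).shape p x := by
  obtain ⟨q, hq, hvq⟩ := hv.2.1 V hV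
  rw [hvq x hx, (M.frame hd hV).repr_shape hq x]
  exact Finset.sum_congr rfl fun p hp => by rw [hvq p (subset_cell V hp)]

lemma finiteDimensional_feSub (hd : 1 ≤ d) (M : Mesh k d) : FiniteDimensional ℝ M.feSub := by
  classical
  let P : Finset (E d) := M.cells.biUnion id
  let L : M.feSub →ₗ[ℝ] (P → ℝ) :=
    { toFun := fun v p => v.1 p
      map_add' := fun _ _ => rfl
      map_smul' := fun _ _ => rfl }
  refine FiniteDimensional.of_injective L ?_
  rw [← LinearMap.ker_eq_bot, LinearMap.ker_eq_bot']
  intro v hv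
  refine Subtype.ext (funext fun x => ?_)
  by_cases hx : x ∈ M.domain
  · obtain ⟨V, hV, hxV⟩ := M.exists_cell_of_mem_domain hx
    rw [feSpace_eq_sum_shape hd v.2 hV hxV]
    refine Finset.sum_eq_zero fun p hp => ?_
    have : v.1 p = 0 := congrFun hv ⟨p, Finset.mem_biUnion.2 ⟨V, hV, hp⟩⟩
    rw [this, zero_mul]
  · exact v.2.2.2 x hx

lemma Refines.feSpace_subset {TH Th : Mesh k d} (h : Th.Refines TH) : TH.feSpace ⊆ Th.feSpace := by
  rintro v ⟨hc, hp, h0⟩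
  refine ⟨hc, fun V hV => ?_, fun x hx => h0 x (h.1 ▸ hx)⟩
  obtain ⟨W, hW, hVW⟩ := h.2 V hV
  obtain ⟨q, hq, hvq⟩ := hp W hW
  exact ⟨q, hq, fun x hx => hvq x (hVW hx)⟩

/-- The Lipschitz property on the whole space is what makes the pointwise gradient usable: it exists
almost everywhere and controls the function along lines. -/
lemma exists_lipschitzWith {v : E d → ℝ} (hv : v ∈ M.feSpace) : ∃ K : ℝ≥0, LipschitzWith K v := by
  have h : ∀ V : M.cells, ∃ K : ℝ≥0, LipschitzOnWith K v (cell V.1) := by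
    intro V
    obtain ⟨q, hq, hvq⟩ := hv.2.1 V.1 V.2
    obtain ⟨K, hK⟩ := LocallyLipschitzOn.exists_lipschitzOnWith_of_compact (isCompact_cell V.1)
      (contDiff_of_mem_polySub (k := k) hq).locallyLipschitz.locallyLipschitzOn
    exact ⟨K, fun x hx y hy => by rw [hvq x hx, hvq y hy]; exact hK hx hy⟩
  choose K hK using h
  refine ⟨∑ V, K V, lipschitzWith_of_finite_closed_cover
    (S := fun j : Option M.cells => j.elim M.domainᶜ fun V => cell V.1) ?_ ?_ hv.1 ?_⟩
  · rintro (_ | V)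
    · exact M.isOpen_domain.isClosed_compl
    · exact isClosed_cell V.1
  · intro x
    by_cases hx : x ∈ M.domain
    · obtain ⟨V, hV, hxV⟩ := M.exists_cell_of_mem_domain hx
      exact ⟨some ⟨V, hV⟩, hxV⟩
    · exact ⟨none, hx⟩
  · rintro (_ | V)
    · refine LipschitzOnWith.of_dist_le_mul fun x hx y hy => ?_
      rw [hv.2.2 x hx, hv.2.2 y hy, dist_self]
      positivity
    · exact (hK V).weaken (Finset.single_le_sum (f := K) (fun _ _ => zero_le) (Finset.mem_univ V))

/-- There is a finite element function with given values at the interior vertices. -/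
lemma exists_feSpace_nodal (hd : 1 ≤ d) (M : Mesh k d) (c : E d → ℝ) :
    ∃ w ∈ M.feSpace, ∀ p ∈ M.nodes, w p = c p := by
  classical
  -- Vertices outside the open domain receive the value zero, as the boundary condition demands.
  let c' : E d → ℝ := fun p => if p ∈ M.nodes then c p else 0
  let q : M.cells → E d → ℝ := fun V x => ∑ p ∈ V.1, c' p * (M.frame hd V.2).shape p x
  have hle : ∀ V W : M.cells, ∀ x ∈ cell V.1, x ∈ cell W.1 →
      q V x = ∑ p ∈ V.1 ∩ W.1, c' p * (M.frame hd V.2).shape p x := by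
    intro V W x hxV hxW
    refine (Finset.sum_subset Finset.inter_subset_left fun p hp hpW => ?_).symm
    have : (M.frame hd V.2).shape p x = 0 := by
      refine le_antisymm (not_lt.1 fun h => hpW (Finset.mem_inter.2 ⟨hp, ?_⟩))
        ((M.frame hd V.2).shape_nonneg hxV p)
      exact CellFrame.mem_of_shape_pos (M.compatible hd V.2 W.2) (M.conforming _ V.2 _ W.2) hxV hxW
        hp (((M.frame hd V.2).shape_pos_iff hxV p).1 h)
    rw [this, mul_zero]
  -- On an intersection only common vertices contribute, and their basis functions agree there.
  have hagree : ∀ V W : M.cells, ∀ x ∈ cell V.1, x ∈ cell W.1 → q V x = q W x := by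
    intro V W x hxV hxW
    rw [hle V W x hxV hxW, hle W V x hxW hxV, Finset.inter_comm]
    refine Finset.sum_congr rfl fun p hp => ?_
    rw [CellFrame.shape_eq_shape (M.compatible hd V.2 W.2) (M.conforming _ V.2 _ W.2) hxV hxW
      (Finset.mem_inter.1 hp).2 (Finset.mem_inter.1 hp).1]
  have hzero : ∀ V : M.cells, ∀ x ∈ cell V.1, x ∉ M.domain → q V x = 0 := by
    intro V x hxV hx
    refine Finset.sum_eq_zero fun p hp => ?_
    by_cases hpn : p ∈ M.nodes
    · have : (M.frame hd V.2).shape p x = 0 := by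
        refine le_antisymm (not_lt.1 fun h => hx ?_) ((M.frame hd V.2).shape_nonneg hxV p)
        exact M.mem_domain_of_shape_pos hd hpn.1 V.2 hp hxV h
      rw [this, mul_zero]
    · simp only [c', if_neg hpn, zero_mul]
  let w : E d → ℝ := fun x => if h : ∃ V : M.cells, x ∈ cell V.1 then q h.choose x else 0
  have hwV : ∀ V : M.cells, ∀ x ∈ cell V.1, w x = q V x := by
    intro V x hxV
    have h : ∃ V : M.cells, x ∈ cell V.1 := ⟨V, hxV⟩
    simp only [w, dif_pos h]
    exact hagree _ _ x h.choose_spec hxV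
  have hw0 : ∀ x, x ∉ M.domain → w x = 0 := by
    intro x hx
    by_cases h : ∃ V : M.cells, x ∈ cell V.1
    · obtain ⟨V, hV⟩ := h
      rw [hwV V x hV, hzero V x hV hx]
    · simp only [w, dif_neg h]
  have hq : ∀ V : M.cells, q V ∈ polySub k d := by
    intro V
    have : q V = ∑ p ∈ V.1, c' p • (M.frame hd V.2).shape p := by
      funext x; simp [q]
    rw [this]
    exact sum_mem fun p hp => Submodule.smul_mem _ _ ((M.frame hd V.2).shape_mem_polySub hp)
  refine ⟨w, ⟨?_, fun V hV => ⟨q ⟨V, hV⟩, hq _, hwV ⟨V, hV⟩⟩, hw0⟩, fun p hp => ?_⟩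
  · refine (locallyFinite_of_finite
      fun j : Option M.cells => j.elim M.domainᶜ fun V => cell V.1).continuous ?_ ?_ ?_
    · refine eq_univ_of_forall fun x => mem_iUnion.2 ?_
      by_cases hx : x ∈ M.domain
      · obtain ⟨V, hV, hxV⟩ := M.exists_cell_of_mem_domain hx
        exact ⟨some ⟨V, hV⟩, hxV⟩
      · exact ⟨none, hx⟩
    · rintro (_ | V)
      · exact M.isOpen_domain.isClosed_compl
      · exact isClosed_cell V.1
    · rintro (_ | V)
      · exact continuousOn_const.congr fun x hx => hw0 x hx
      · exact (continuous_of_mem_polySub (hq V)).continuousOn.congr fun x hx => hwV V x hx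
  · obtain ⟨V, hV, hpV⟩ := hp.2
    rw [hwV ⟨V, hV⟩ p (subset_cell V hpV)]
    simp only [q]
    rw [Finset.sum_eq_single_of_mem p hpV, (M.frame hd hV).shape_self, mul_one]
    · simp only [c', if_pos hp]
    · intro r hr hrp
      rw [(M.frame hd hV).shape_of_ne hr hpV hrp, mul_zero]

lemma volume_domain_lt_top (M : Mesh k d) : volume M.domain ≠ ⊤ := by
  refine ne_top_of_le_ne_top ?_ (measure_mono interior_subset)
  exact (M.cells.finite_toSet.isCompact_biUnion fun V _ => isCompact_cell V).measure_lt_top.ne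

lemma domain_ae_eq (M : Mesh k d) :
    M.domain =ᵐ[volume] ⋃ V ∈ M.cells, interior (cell V) := by
  refine (ae_le_set.2 ?_).antisymm (LE.le.eventuallyLE (iUnion₂_subset fun V hV =>
    M.interior_subset_domain hV))
  refine measure_mono_null (t := ⋃ V ∈ M.cells, frontier (cell V)) ?_ ?_
  · rintro x ⟨hx, hxn⟩
    obtain ⟨V, hV, hxV⟩ := M.exists_cell_of_mem_domain hx
    refine mem_biUnion hV ⟨subset_closure hxV, fun hi => hxn (mem_biUnion hV hi)⟩
  · refine (measure_biUnion_null_iff M.cells.countable_toSet).2 ?_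
    exact fun V _ => (convex_cell V).addHaar_frontier volume

lemma interior_cell_ae_eq (V : Finset (E d)) : interior (cell V) =ᵐ[volume] cell V := by
  refine (LE.le.eventuallyLE interior_subset).antisymm (ae_le_set.2 ?_)
  refine measure_mono_null ?_ ((convex_cell V).addHaar_frontier volume)
  exact fun x hx => ⟨subset_closure hx.1, hx.2⟩

lemma disjoint_interior (hd : 1 ≤ d) {V W : Finset (E d)} (hV : V ∈ M.cells) (hW : W ∈ M.cells)
    (hne : V ≠ W) : Disjoint (interior (cell V)) (interior (cell W)) := by
  refine Set.disjoint_left.2 fun x hx hxW => hne ?_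
  exact CellFrame.eq_of_mem_interior (M.compatible hd hV hW) (M.compatible hd hW hV)
    (M.conforming V hV W hW) (((M.frame hd hV).mem_interior_iff x).1 hx) (interior_subset hxW)

lemma integral_domain_eq_sum (hd : 1 ≤ d) {g : E d → ℝ} (hg : IntegrableOn g M.domain) :
    ∫ x in M.domain, g x = ∑ V ∈ M.cells, ∫ x in cell V, g x := by
  rw [setIntegral_congr_set M.domain_ae_eq, integral_biUnion_finset M.cells
    (fun V _ => isOpen_interior.measurableSet)
    (fun V hV W hW hne => disjoint_interior hd hV hW hne)
    fun V hV => hg.mono_set (M.interior_subset_domain hV)]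
  exact Finset.sum_congr rfl fun V _ => setIntegral_congr_set (interior_cell_ae_eq V)

end Mesh

end LOD

/-! ### Inverse estimate, local projections, and means over neighboring cells -/

namespace LOD

open Set Filter Topology
open scoped ENNReal NNReal

/-- Polynomials of the families have degree at most three along lines if `d ≤ 3`, so that they can
be extrapolated from four equidistant points. -/
lemma extrapolation_of_mem_polySub {k : ElementKind} {d : ℕ} (hd : d ≤ 3) {q : E d → ℝ}
    (hq : q ∈ polySub k d) (p x : E d) :
    q p = 4 * q (p + (1 / 4 : ℝ) • (x - p)) - 6 * q (p + (1 / 2 : ℝ) • (x - p)) +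
      4 * q (p + (3 / 4 : ℝ) • (x - p)) - q (p + (1 : ℝ) • (x - p)) := by
  -- The weights 4, -6, 4, -1 express the vanishing of the fourth difference with step 1/4.
  cases k
  · obtain ⟨f, rfl⟩ := exists_affineMap_of_mem_polySub_P1 hq
    simp only [affineMap_add_smul]
    ring
  · obtain ⟨c, h⟩ := hq
    have hS : ∀ S : Finset (Fin d), ∏ i ∈ S, p i =
        4 * ∏ i ∈ S, (p + (1 / 4 : ℝ) • (x - p)) i - 6 * ∏ i ∈ S, (p + (1 / 2 : ℝ) • (x - p)) i +
        4 * ∏ i ∈ S, (p + (3 / 4 : ℝ) • (x - p)) i - ∏ i ∈ S, (p + (1 : ℝ) • (x - p)) i := by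
      intro S
      simp only [PiLp.add_apply, PiLp.smul_apply, PiLp.sub_apply, smul_eq_mul]
      have hcard : S.card ≤ 3 := (Finset.card_le_univ S).trans (by simpa using hd)
      interval_cases hc : S.card
      · rw [Finset.card_eq_zero] at hc
        subst hc
        simp
        norm_num
      · obtain ⟨i, rfl⟩ := Finset.card_eq_one.1 hc
        simp only [Finset.prod_singleton]
        ring
      · obtain ⟨i, j, hij, rfl⟩ := Finset.card_eq_two.1 hc
        simp only [Finset.prod_pair hij]
        ring
      · obtain ⟨i, j, l, hij, hil, hjl, rfl⟩ := Finset.card_eq_three.1 hc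
        have h1 : i ∉ ({j, l} : Finset (Fin d)) := by simp [hij, hil]
        simp only [Finset.prod_insert h1, Finset.prod_pair hjl]
        ring
    simp only [h]
    rw [Finset.sum_congr rfl fun S _ => by rw [hS S]]
    simp only [Finset.mul_sum, ← Finset.sum_sub_distrib, ← Finset.sum_add_distrib]
    refine Finset.sum_congr rfl fun S _ => ?_
    ring

/-- The homothety with center `p ∈ D` maps the convex set `D` into itself and has Jacobian `s ^ d ≥
4 ^ (-d)`. -/
lemma integral_sq_comp_homothety_le {d : ℕ} {q : E d → ℝ} (hq : Continuous q) {D : Set (E d)}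
    (hD : IsCompact D) (hc : Convex ℝ D) {p : E d} (hp : p ∈ D) {s : ℝ} (hs : 1 / 4 ≤ s)
    (hs1 : s ≤ 1) : ∫ x in D, q (p + s • (x - p)) ^ 2 ≤ 4 ^ d * ∫ x in D, q x ^ 2 := by
  have h0 : (0 : ℝ) ≤ s := by linarith
  refine integral_sq_le_of_lintegral (by fun_prop) (by positivity) ?_
  have hm : Measurable (D.indicator fun x => ‖q x‖ₑ ^ 2) :=
    (hq.measurable.enorm.pow_const 2).indicator hD.measurableSet
  calc ∫⁻ x in D, ‖q (p + s • (x - p))‖ₑ ^ 2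
      = ∫⁻ x in D, (D.indicator fun x => ‖q x‖ₑ ^ 2) ((p - s • p) + s • x) := by
        refine setLIntegral_congr_fun hD.measurableSet fun x hx => ?_
        have e : (p - s • p) + s • x = p + s • (x - p) := by module
        simp only [e]
        rw [indicator_of_mem (hc.add_smul_sub_mem hp hx ⟨h0, hs1⟩)]
    _ ≤ ∫⁻ x, (D.indicator fun x => ‖q x‖ₑ ^ 2) ((p - s • p) + s • x) :=
        setLIntegral_le_lintegral _ _
    _ ≤ ENNReal.ofReal (((1 / 4 : ℝ) ^ d)⁻¹) * ∫⁻ x, (D.indicator fun x => ‖q x‖ₑ ^ 2) x :=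
        lintegral_comp_affine_le hm _ (by norm_num) hs
    _ = ENNReal.ofReal (4 ^ d * ∫ x in D, q x ^ 2) := by
        rw [lintegral_indicator hD.measurableSet, ENNReal.ofReal_mul (by positivity)]
        congr 1
        · rw [one_div, inv_pow, inv_inv]
        · have hi : IntegrableOn (fun x => q x ^ 2) D :=
            (hq.pow 2).continuousOn.integrableOn_compact hD
          rw [ofReal_integral_eq_lintegral_ofReal hi (Eventually.of_forall fun x => sq_nonneg _)]
          simp only [enorm_sq_eq_ofReal]

/-- The inverse estimate: point values of polynomials are controlled by the mean square. -/
lemma inverse_estimate {k : ElementKind} {d : ℕ} (hd : d ≤ 3) {q : E d → ℝ}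
    (hq : q ∈ polySub k d) {D : Set (E d)} (hD : IsCompact D) (hc : Convex ℝ D) {p : E d}
    (hp : p ∈ D) : volume.real D * q p ^ 2 ≤ 276 * 4 ^ d * ∫ x in D, q x ^ 2 := by
  have hqc := continuous_of_mem_polySub hq
  have hDv : volume D ≠ ⊤ := hD.measure_lt_top.ne
  have hint : ∀ {g : E d → ℝ}, Continuous g → IntegrableOn g D := fun hg =>
    hg.continuousOn.integrableOn_compact hD
  -- Four terms: the square of the sum is at most four times the sum of squares, with weights 4·16,
  -- 4·36, 4·16 and 4·1, which add up to 276.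
  have h1 : ∀ x, q p ^ 2 ≤ 64 * q (p + (1 / 4 : ℝ) • (x - p)) ^ 2 +
      144 * q (p + (1 / 2 : ℝ) • (x - p)) ^ 2 + 64 * q (p + (3 / 4 : ℝ) • (x - p)) ^ 2 +
      4 * q (p + (1 : ℝ) • (x - p)) ^ 2 := by
    intro x
    have e := extrapolation_of_mem_polySub hd hq p x
    set A := q (p + (1 / 4 : ℝ) • (x - p))
    set B := q (p + (1 / 2 : ℝ) • (x - p))
    set C := q (p + (3 / 4 : ℝ) • (x - p))
    set F := q (p + (1 : ℝ) • (x - p))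
    rw [e]
    nlinarith [sq_nonneg (4 * A + 6 * B), sq_nonneg (4 * A - 4 * C), sq_nonneg (4 * A + F),
      sq_nonneg (6 * B + 4 * C), sq_nonneg (6 * B - F), sq_nonneg (4 * C + F)]
  have h2 : volume.real D * q p ^ 2 = ∫ x in D, q p ^ 2 := by simp
  rw [h2]
  have hh : ∀ s : ℝ, Continuous fun x => q (p + s • (x - p)) ^ 2 := fun s => by fun_prop
  calc _ ≤ ∫ x in D, (64 * q (p + (1 / 4 : ℝ) • (x - p)) ^ 2 +
          144 * q (p + (1 / 2 : ℝ) • (x - p)) ^ 2 + 64 * q (p + (3 / 4 : ℝ) • (x - p)) ^ 2 +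
          4 * q (p + (1 : ℝ) • (x - p)) ^ 2) :=
        setIntegral_mono (hint continuous_const) (hint (by fun_prop)) h1
    _ = 64 * (∫ x in D, q (p + (1 / 4 : ℝ) • (x - p)) ^ 2) +
          144 * (∫ x in D, q (p + (1 / 2 : ℝ) • (x - p)) ^ 2) +
          64 * (∫ x in D, q (p + (3 / 4 : ℝ) • (x - p)) ^ 2) +
          4 * ∫ x in D, q (p + (1 : ℝ) • (x - p)) ^ 2 := by
        rw [integral_add (hint (by fun_prop)) (hint (by fun_prop)),
          integral_add (hint (by fun_prop)) (hint (by fun_prop)),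
          integral_add (hint (by fun_prop)) (hint (by fun_prop)), integral_const_mul,
          integral_const_mul, integral_const_mul, integral_const_mul]
    _ ≤ _ := by
        have a1 := integral_sq_comp_homothety_le hqc hD hc hp (s := 1 / 4) (by norm_num) (by norm_num)
        have a2 := integral_sq_comp_homothety_le hqc hD hc hp (s := 1 / 2) (by norm_num) (by norm_num)
        have a3 := integral_sq_comp_homothety_le hqc hD hc hp (s := 3 / 4) (by norm_num) (by norm_num)
        have a4 := integral_sq_comp_homothety_le hqc hD hc hp (s := 1) (by norm_num) (by norm_num)
        linarith

section Projection

variable {k : ElementKind} {d : ℕ} {V : Finset (E d)} {v q : E d → ℝ}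

lemma integrableOn_cell {g : E d → ℝ} (hg : Continuous g) : IntegrableOn g (cell V) :=
  hg.continuousOn.integrableOn_compact (isCompact_cell V)

/-- The Pythagorean identity of the local projection. -/
lemma IsLocalProj.integral_sq_eq (h : IsLocalProj k V v q) (hv : Continuous v) {r : E d → ℝ}
    (hr : r ∈ polySub k d) : ∫ x in cell V, (v x - r x) ^ 2 =
      (∫ x in cell V, (v x - q x) ^ 2) + ∫ x in cell V, (q x - r x) ^ 2 := by
  have hq : q ∈ polySub k d := h.1
  have hqc := continuous_of_mem_polySub hq
  have hrc := continuous_of_mem_polySub hr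
  have h0 := h.2 (q - r) ((polySub k d).sub_mem hq hr)
  have e : ∀ x, (v x - r x) ^ 2 = (v x - q x) ^ 2 + (q x - r x) ^ 2 +
      2 * ((v x - q x) * (q - r) x) := fun x => by simp only [Pi.sub_apply]; ring
  simp_rw [e]
  rw [integral_add, integral_add, integral_const_mul, h0, mul_zero, add_zero]
  all_goals refine integrableOn_cell ?_
  · fun_prop
  · fun_prop
  · fun_prop
  · exact continuous_const.mul ((hv.sub hqc).mul (hqc.sub hrc))

end Projection

namespace CellFrame

variable {k : ElementKind} {d : ℕ} {V W : Finset (E d)} (F : CellFrame k V) (F' : CellFrame k W)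

/-- Along `dir i` the function `lam i` drops at unit rate and no other facet function decreases, so
the facet is reached exactly at time `lam i x`. -/
lemma add_dir_mem {x : E d} (hx : x ∈ cell V) (i : F.ι) {t : ℝ} (h0 : 0 ≤ t)
    (h1 : t ≤ F.lam i x) : x + t • F.dir i ∈ cell V := by
  refine (F.mem_cell _).2 fun j => ?_
  rw [affineMap_add_smul]
  rcases eq_or_ne j i with rfl | h
  · rw [F.dir_self]; linarith
  · have := F.dir_ne i j h
    have := F.lam_nonneg hx j
    positivity

lemma norm_dir_le (i : F.ι) : ‖F.dir i‖ ≤ Metric.diam (cell V) := by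
  obtain ⟨p, hp, h1⟩ := F.exists_one i
  have h := F.add_dir_mem (subset_cell V hp) i zero_le_one h1.ge
  have := Metric.dist_le_diam_of_mem (isCompact_cell V).isBounded h (subset_cell V hp)
  simpa [dist_eq_norm] using this

lemma integral_sub_facet_sq_le {f : E d → ℝ} {K : ℝ≥0} (hf : LipschitzWith K f) (i : F.ι) :
    ∫ x in cell V, (f (x + F.lam i x • F.dir i) - f x) ^ 2 ≤
      Metric.diam (cell V) ^ 2 * ∫ x in cell V, ‖∇ f x‖ ^ 2 := by
  refine (integral_sub_shift_sq_le hf (isClosed_cell V).measurableSet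
    (isCompact_cell V).measure_lt_top.ne (F.dir i) (continuous_affineMap (F.lam i))
    (fun x hx => F.lam_nonneg hx i) (fun x hx => F.lam_le_one hx i)
    fun x hx t h0 h1 => F.add_dir_mem hx i h0 h1).trans ?_
  gcongr
  exact F.norm_dir_le i

lemma volume_real_pos (F : CellFrame k V) : 0 < volume.real (cell V) :=
  ENNReal.toReal_pos F.volume_pos (isCompact_cell V).measure_lt_top.ne

/-- Each interior point is carried along `dir i` to the relative interior of the facet, where `f`
vanishes. The shift estimate therefore bounds `f` itself in mean square. -/
lemma sq_average_le_of_facet {f : E d → ℝ} {K : ℝ≥0} (hf : LipschitzWith K f) (i : F.ι)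
    (h0 : ∀ x, F.lam i x = 0 → (∀ j, j ≠ i → 0 < F.lam j x) → f x = 0) :
    (⨍ x in cell V, f x) ^ 2 ≤
      Metric.diam (cell V) ^ 2 * (∫ x in cell V, ‖∇ f x‖ ^ 2) / volume.real (cell V) := by
  rw [le_div_iff₀ F.volume_real_pos, mul_comm]
  refine (sq_average_le hf.continuous (isCompact_cell V) F.volume_pos).trans
    (le_trans (le_of_eq ?_) (F.integral_sub_facet_sq_le hf i))
  rw [← setIntegral_congr_set (Mesh.interior_cell_ae_eq V),
    ← setIntegral_congr_set (Mesh.interior_cell_ae_eq V)]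
  refine setIntegral_congr_fun isOpen_interior.measurableSet fun x hx => ?_
  have hp := (F.mem_interior_iff x).1 hx
  rw [h0 (x + F.lam i x • F.dir i)]
  · ring
  · rw [affineMap_add_smul, F.dir_self]; ring
  · intro j hj
    rw [affineMap_add_smul]
    have := F.dir_ne i j hj
    have := hp j
    have := (hp i).le
    positivity

/-- The affine map which maps a cell onto its neighbor across a facet and fixes the facet. -/
noncomputable def flip (i : F.ι) (i' : F'.ι) : E d →ᵃ[ℝ] E d :=
  AffineMap.id ℝ (E d) +
    ((LinearMap.toSpanSingleton ℝ (E d) (F.dir i - F'.dir i')).toAffineMap.comp (F.lam i))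

lemma flip_apply (i : F.ι) (i' : F'.ι) (x : E d) :
    flip F F' i i' x = x + F.lam i x • (F.dir i - F'.dir i') := rfl

variable {F F'}

lemma lam_flip {i : F.ι} {i' : F'.ι} {c : ℝ} (hcx : ∀ x, F'.lam i' x = c * F.lam i x) (x : E d) :
    F'.lam i' (flip F F' i i' x) = F.lam i x := by
  have hlin : (F'.lam i').linear (F.dir i) = - c := by
    have e1 := affineMap_add (F'.lam i') 0 (F.dir i)
    rw [hcx, hcx 0, affineMap_add, F.dir_self] at e1
    linarith
  rw [flip_apply, affineMap_add_smul, map_sub, F'.dir_self, hlin, hcx]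
  ring

lemma flip_flip {i : F.ι} {i' : F'.ι} {c : ℝ} (hcx : ∀ x, F'.lam i' x = c * F.lam i x) (x : E d) :
    flip F' F i' i (flip F F' i i' x) = x := by
  rw [flip_apply F' F, lam_flip hcx, flip_apply]
  module

lemma flip_mem (hc : F.Compatible F') {i : F.ι} {i' : F'.ι} {c : ℝ} (hc0 : c < 0)
    (hcx : ∀ x, F'.lam i' x = c * F.lam i x) (hF : ∀ q ∈ V, F.lam i q = 0 → q ∈ W)
    (hF' : ∀ q ∈ W, F'.lam i' q = 0 → q ∈ V) {x : E d} (hx : x ∈ cell V) :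
    flip F F' i i' x ∈ cell W := by
  have hcv := (convex_cell W).affine_preimage (flip F F' i i')
  exact convexHull_min (fun p hp => hc.reflect i i' c hc0 hcx hF hF' p hp) hcv hx

/-- The means over two cells that share a facet are close. -/
lemma sq_average_sub_average_le (hc : F.Compatible F') (hc' : F'.Compatible F) {i : F.ι}
    {i' : F'.ι} {c : ℝ} (hc0 : c < 0) (hcx : ∀ x, F'.lam i' x = c * F.lam i x)
    (hF : ∀ q ∈ V, F.lam i q = 0 → q ∈ W) (hF' : ∀ q ∈ W, F'.lam i' q = 0 → q ∈ V)
    {f : E d → ℝ} {K : ℝ≥0} (hf : LipschitzWith K f) :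
    ((⨍ x in cell V, f x) - ⨍ x in cell W, f x) ^ 2 ≤
      2 * (Metric.diam (cell V) ^ 2 * (∫ x in cell V, ‖∇ f x‖ ^ 2) / volume.real (cell V)) +
      2 * (Metric.diam (cell W) ^ 2 * (∫ x in cell W, ‖∇ f x‖ ^ 2) / volume.real (cell W)) := by
  have hcx' : ∀ x, F.lam i x = c⁻¹ * F'.lam i' x := fun x => by
    rw [hcx, ← mul_assoc, inv_mul_cancel₀ hc0.ne, one_mul]
  set Φ := flip F F' i i' with hΦ
  have himg : Φ '' cell V = cell W := by
    refine Subset.antisymm ?_ fun y hy => ?_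
    · rintro _ ⟨x, hx, rfl⟩
      exact flip_mem hc hc0 hcx hF hF' hx
    · exact ⟨flip F' F i' i y, flip_mem hc' (inv_lt_zero.2 hc0) hcx' hF' hF hy, flip_flip hcx' y⟩
  have hinj : InjOn Φ (cell V) := fun x _ y _ hxy => by
    rw [← flip_flip hcx x, ← flip_flip hcx y]
    exact congrArg _ hxy
  set J := |(LinearMap.toContinuousLinearMap Φ.linear).det| with hJ
  have hderiv : ∀ x ∈ cell V, HasFDerivWithinAt Φ (LinearMap.toContinuousLinearMap Φ.linear)
      (cell V) x := by
    intro x _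
    have e : ⇑Φ = fun x => LinearMap.toContinuousLinearMap Φ.linear x + Φ 0 := by
      funext x
      have := Φ.map_vadd 0 x
      simpa using this
    have h2 : HasFDerivAt (fun x => LinearMap.toContinuousLinearMap Φ.linear x + Φ 0)
        (LinearMap.toContinuousLinearMap Φ.linear) x :=
      (LinearMap.toContinuousLinearMap Φ.linear).hasFDerivAt.add_const (Φ 0)
    rw [← e] at h2
    exact h2.hasFDerivWithinAt
  have hcv : ∀ g : E d → ℝ, ∫ y in cell W, g y = J * ∫ x in cell V, g (Φ x) := by
    intro g
    rw [← himg, integral_image_eq_integral_abs_det_fderiv_smul volume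
      (isClosed_cell V).measurableSet hderiv hinj g]
    simp only [smul_eq_mul]
    rw [integral_const_mul]
  have hvol : volume.real (cell W) = J * volume.real (cell V) := by
    have := hcv fun _ => 1
    simpa using this
  have hJ0 : J ≠ 0 := by
    rintro h0
    rw [h0, zero_mul] at hvol
    exact F'.volume_real_pos.ne' hvol
  have hfc := hf.continuous
  have hΦc : Continuous Φ := Φ.continuous_of_finiteDimensional
  have hV := F.volume_real_pos
  have hW := F'.volume_real_pos
  -- The Jacobian of the affine map is constant and cancels from the means.
  have hmean : (⨍ x in cell W, f x) = ⨍ x in cell V, f (Φ x) := by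
    rw [setAverage_eq, setAverage_eq, hcv, hvol, smul_eq_mul, smul_eq_mul]
    field_simp
  have hdiff : (⨍ x in cell V, f x) - ⨍ x in cell W, f x = ⨍ x in cell V, (f x - f (Φ x)) := by
    rw [hmean, setAverage_eq, setAverage_eq, setAverage_eq, integral_sub, smul_sub]
    · exact integrableOn_cell hfc
    · exact integrableOn_cell (hfc.comp hΦc)
  have hlc := continuous_affineMap (F.lam i)
  have hlc' := continuous_affineMap (F'.lam i')
  set u : E d → ℝ := fun x => f (x + F.lam i x • F.dir i) - f x with hu
  set u' : E d → ℝ := fun y => f (y + F'.lam i' y • F'.dir i') - f y with hu'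
  -- `x` and its image slide to the same point of the common facet, each inside its own cell.
  have hpt : ∀ x, f x - f (Φ x) = u' (Φ x) - u x := by
    intro x
    simp only [hu, hu']
    have e : Φ x + F'.lam i' (Φ x) • F'.dir i' = x + F.lam i x • F.dir i := by
      rw [hΦ, lam_flip hcx, flip_apply]
      module
    rw [e]
    ring
  have huc : Continuous u := by fun_prop
  have huc' : Continuous u' := by fun_prop
  have h1 := sq_average_le (u := fun x => f x - f (Φ x)) (by fun_prop) (isCompact_cell V)
    F.volume_pos
  have h2 : ∫ x in cell V, (f x - f (Φ x)) ^ 2 ≤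
      2 * (∫ x in cell V, u x ^ 2) + 2 * ∫ x in cell V, u' (Φ x) ^ 2 := by
    rw [← integral_const_mul, ← integral_const_mul, ← integral_add]
    · refine setIntegral_mono (integrableOn_cell (by fun_prop)) (integrableOn_cell (by fun_prop))
        fun x => ?_
      simp only [hpt]
      nlinarith [sq_nonneg (u' (Φ x) + u x)]
    · exact integrableOn_cell (by fun_prop)
    · exact integrableOn_cell (by fun_prop)
  have h3 := F.integral_sub_facet_sq_le hf i
  have h4 := F'.integral_sub_facet_sq_le hf i'
  have h5 := hcv fun y => u' y ^ 2
  have hJpos : 0 < J := lt_of_le_of_ne (abs_nonneg _) hJ0.symm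
  rw [hdiff]
  set A := Metric.diam (cell V) ^ 2 * ∫ x in cell V, ‖∇ f x‖ ^ 2
  set B := Metric.diam (cell W) ^ 2 * ∫ x in cell W, ‖∇ f x‖ ^ 2
  have h6 : ∫ x in cell V, u' (Φ x) ^ 2 ≤ B / J := by
    rw [le_div_iff₀ hJpos, mul_comm, ← h5]
    exact h4
  have h7 : volume.real (cell V) * (⨍ x in cell V, (f x - f (Φ x))) ^ 2 ≤ 2 * A + 2 * (B / J) := by
    refine h1.trans (h2.trans ?_)
    have : ∫ x in cell V, u x ^ 2 ≤ A := h3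
    linarith
  rw [hvol]
  calc _ ≤ (2 * A + 2 * (B / J)) / volume.real (cell V) := by
        rwa [le_div_iff₀ hV, mul_comm]
    _ = _ := by field_simp

end CellFrame

end LOD

/-! ### Shape regularity and the Poincaré inequality for vanishing quasi-interpolant -/

namespace LOD

open Set Filter Topology
open scoped ENNReal NNReal

namespace Mesh

variable {k : ElementKind} {d : ℕ} {M : Mesh k d} {σ : ℝ}

lemma diam_le_size (M : Mesh k d) {V : Finset (E d)} (hV : V ∈ M.cells) :
    Metric.diam (cell V) ≤ M.size :=
  le_csSup (M.cells.finite_toSet.image _).bddAbove ⟨V, hV, rfl⟩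

lemma ShapeRegular.mono {σ' : ℝ} (h : M.ShapeRegular σ) (hσ : σ ≤ σ') : M.ShapeRegular σ' := by
  intro V hV
  obtain ⟨c, ρ, hρ, hb, hd⟩ := h V hV
  exact ⟨c, ρ, hρ, hb, hd.trans (by gcongr)⟩

lemma volume_real_ball_zero_pos (d : ℕ) : 0 < volume.real (Metric.ball (0 : E d) 1) :=
  ENNReal.toReal_pos (Metric.measure_ball_pos volume 0 one_pos).ne' measure_ball_lt_top.ne

lemma volume_real_ball (hd : 1 ≤ d) (x : E d) {r : ℝ} (hr : 0 ≤ r) :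
    volume.real (Metric.ball x r) = r ^ d * volume.real (Metric.ball (0 : E d) 1) := by
  have : Nonempty (Fin d) := ⟨⟨0, hd⟩⟩
  rw [Measure.real, Measure.addHaar_ball _ x hr, ENNReal.toReal_mul,
    ENNReal.toReal_ofReal (by positivity), finrank_euclideanSpace, Fintype.card_fin]
  rfl

lemma volume_real_cell_le (hd : 1 ≤ d) (hV : (V : Finset (E d)).Nonempty) :
    volume.real (cell V) ≤ Metric.diam (cell V) ^ d * volume.real (Metric.ball (0 : E d) 1) := by
  obtain ⟨p, hp⟩ := hV
  have hsub : cell V ⊆ Metric.closedBall p (Metric.diam (cell V)) := fun x hx =>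
    Metric.dist_le_diam_of_mem (isCompact_cell V).isBounded hx (subset_cell V hp)
  have h1 : volume.real (cell V) ≤ volume.real (Metric.closedBall p (Metric.diam (cell V))) :=
    measureReal_mono hsub measure_closedBall_lt_top.ne
  have : Nonempty (Fin d) := ⟨⟨0, hd⟩⟩
  have e : volume.real (Metric.closedBall p (Metric.diam (cell V))) =
      volume.real (Metric.ball p (Metric.diam (cell V))) := by
    rw [Measure.real, Measure.real, Measure.addHaar_closedBall_eq_addHaar_ball]
  rwa [e, volume_real_ball hd p Metric.diam_nonneg] at h1

lemma diam_cell_pos (hd : 1 ≤ d) {V : Finset (E d)} (hV : V ∈ M.cells) :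
    0 < Metric.diam (cell V) := by
  have h1 := volume_real_cell_le hd (M.frame hd hV).nonempty
  have h2 := (M.frame hd hV).volume_real_pos
  refine lt_of_le_of_ne Metric.diam_nonneg fun h => ?_
  rw [← h, zero_pow (by omega), zero_mul] at h1
  linarith

lemma ShapeRegular.le_volume_real (hd : 1 ≤ d) (h : M.ShapeRegular σ) (hσ : 0 < σ) {V : Finset (E d)}
    (hV : V ∈ M.cells) : (Metric.diam (cell V) / (2 * σ)) ^ d *
      volume.real (Metric.ball (0 : E d) 1) ≤ volume.real (cell V) := by
  obtain ⟨c, ρ, hρ, hb, hdiam⟩ := h V hV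
  have h1 : volume.real (Metric.ball c (ρ / 2)) ≤ volume.real (cell V) :=
    measureReal_mono hb (isCompact_cell V).measure_lt_top.ne
  rw [volume_real_ball hd c (by positivity)] at h1
  refine le_trans ?_ h1
  have hle : Metric.diam (cell V) / (2 * σ) ≤ ρ / 2 := by
    rw [div_le_iff₀ (by positivity)]
    linarith
  exact mul_le_mul_of_nonneg_right
    (pow_le_pow_left₀ (div_nonneg Metric.diam_nonneg (by positivity)) hle d)
    (volume_real_ball_zero_pos d).le

/-- Two cells that share two vertices have comparable diameters. -/
lemma ShapeRegular.diam_le_diam (hd : 1 ≤ d) (h : M.ShapeRegular σ) {V W : Finset (E d)}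
    (hV : V ∈ M.cells) {p q : E d} (hpV : p ∈ V) (hqV : q ∈ V) (hpW : p ∈ W) (hqW : q ∈ W)
    (hpq : p ≠ q) : Metric.diam (cell V) ≤ σ * Metric.diam (cell W) := by
  obtain ⟨c, ρ, hρ, hb, hdiam⟩ := h V hV
  have hσ : 0 ≤ σ := nonneg_of_mul_nonneg_left (Metric.diam_nonneg.trans hdiam) hρ
  have hpqW : dist p q ≤ Metric.diam (cell W) := Metric.dist_le_diam_of_mem
    (isCompact_cell W).isBounded (subset_cell W hpW) (subset_cell W hqW)
  -- If `dist p q < ρ`, the inscribed ball contains a segment parallel to `p - q` and longer than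
  -- it. A facet function that is `1` at `p` and `0` at `q` would vary by more than one along this
  -- segment, although it stays in `[0, 1]` on the cell.
  suffices hr : ρ ≤ dist p q from hdiam.trans (by gcongr; exact hr.trans hpqW)
  by_contra! hlt
  obtain ⟨t, ht1, ht2⟩ := exists_between hlt
  have hpos : 0 < dist p q := dist_pos.2 hpq
  obtain ⟨i, h1, h0⟩ := (M.frame hd hV).sep p hpV q hqV hpq
  set s := t / dist p q with hs
  have hs1 : 1 < s := (one_lt_div hpos).2 ht1
  have hmem : ∀ ε : ℝ, |ε| = 1 → c + (ε * s / 2) • (p - q) ∈ cell V := by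
    intro ε hε
    refine hb ?_
    rw [Metric.mem_ball, dist_eq_norm, add_sub_cancel_left, norm_smul, Real.norm_eq_abs, abs_div,
      abs_mul, hε, abs_of_pos (by linarith : (0 : ℝ) < s), ← dist_eq_norm, hs]
    rw [abs_of_pos (by norm_num : (0 : ℝ) < 2)]
    field_simp
    linarith
  have ha := (M.frame hd hV).lam_le_one (hmem 1 (by simp)) i
  have hb' := (M.frame hd hV).lam_nonneg (hmem (-1) (by simp)) i
  rw [affineMap_add_smul, affineMap_sub, h1, h0] at ha hb'
  linarith

/-- Volume count without any comparison of cell sizes. With `ε` below all diameters, each cell at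
`p` is contracted towards `p` to diameter `ε`; by convexity it stays in the cell, and it contains a
ball of radius `ε / (2 σ)`. These disjoint balls lie in the ball of radius `ε` about `p`. -/
lemma ShapeRegular.card_star_le (hd : 1 ≤ d) (h : M.ShapeRegular σ) (hσ : 0 < σ) (p : E d) :
    ((M.star p).card : ℝ) ≤ (2 * σ) ^ d := by
  classical
  obtain ⟨ε, hε, hεd⟩ : ∃ ε : ℝ, 0 < ε ∧ ∀ V ∈ M.cells, ε ≤ Metric.diam (cell V) := by
    have hev : ∀ᶠ ε in 𝓝[>] (0 : ℝ), ∀ V ∈ M.cells, ε ≤ Metric.diam (cell V) := by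
      refine (Finset.eventually_all M.cells).2 fun V hV => ?_
      filter_upwards [(eventually_lt_nhds (diam_cell_pos hd hV)).filter_mono nhdsWithin_le_nhds]
        with ε hε using hε.le
    obtain ⟨ε, h1, h2⟩ := (hev.and self_mem_nhdsWithin).exists
    exact ⟨ε, h2, h1⟩
  -- each cell at `p` contains a ball of radius `ε / (2 σ)` close to `p`
  have hball : ∀ V ∈ M.star p, ∃ z, Metric.ball z (ε / (2 * σ)) ⊆
      interior (cell V) ∩ Metric.closedBall p ε := by
    intro V hV
    obtain ⟨hV, hpV⟩ := M.mem_star.1 hV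
    obtain ⟨c, ρ, hρ, hb, hdiam⟩ := h V hV
    have hD := diam_cell_pos hd hV
    set D := Metric.diam (cell V) with hDdef
    set s := ε / D with hs
    have hs0 : 0 < s := by positivity
    have hs1 : s ≤ 1 := (div_le_one hD).2 (hεd V hV)
    have hsub : Metric.ball (p + s • (c - p)) (ε / (2 * σ)) ⊆
        cell V ∩ Metric.closedBall p ε := by
      intro y hy
      have hx : p + s⁻¹ • (y - p) ∈ cell V := by
        refine hb ?_
        rw [Metric.mem_ball, dist_eq_norm] at hy ⊢
        have e : p + s⁻¹ • (y - p) - c = s⁻¹ • (y - (p + s • (c - p))) := by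
          rw [smul_sub, smul_sub, smul_add, smul_smul, inv_mul_cancel₀ hs0.ne']
          module
        rw [e, norm_smul, Real.norm_of_nonneg (inv_nonneg.2 hs0.le), inv_mul_lt_iff₀ hs0]
        refine hy.trans_le ?_
        rw [hs, div_mul_eq_mul_div, div_le_div_iff₀ (by positivity) hD]
        nlinarith
      have ey : y = p + s • ((p + s⁻¹ • (y - p)) - p) := by
        rw [add_sub_cancel_left, smul_smul, mul_inv_cancel₀ hs0.ne', one_smul, add_sub_cancel]
      refine ⟨?_, ?_⟩
      · rw [ey]
        exact (convex_cell V).add_smul_sub_mem (subset_cell V hpV) hx ⟨hs0.le, hs1⟩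
      · have hdx := Metric.dist_le_diam_of_mem (isCompact_cell V).isBounded hx (subset_cell V hpV)
        rw [dist_eq_norm, add_sub_cancel_left, norm_smul, Real.norm_of_nonneg (inv_nonneg.2 hs0.le),
          inv_mul_le_iff₀ hs0, ← hDdef, hs, div_mul_cancel₀ _ hD.ne'] at hdx
        rwa [Metric.mem_closedBall, dist_eq_norm]
    exact ⟨_, subset_inter (interior_maximal (hsub.trans inter_subset_left) Metric.isOpen_ball)
      (hsub.trans inter_subset_right)⟩
  choose! z hz using hball
  have h1 : volume.real (⋃ V ∈ M.star p, Metric.ball (z V) (ε / (2 * σ))) =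
      ∑ V ∈ M.star p, volume.real (Metric.ball (z V) (ε / (2 * σ))) := by
    refine measureReal_biUnion_finset (fun V hV W hW hne => ?_) (fun V _ => measurableSet_ball)
      (fun V _ => measure_ball_lt_top.ne)
    exact (disjoint_interior hd (M.mem_star.1 hV).1 (M.mem_star.1 hW).1 hne).mono
      ((hz V hV).trans inter_subset_left) ((hz W hW).trans inter_subset_left)
  have h2 : volume.real (⋃ V ∈ M.star p, Metric.ball (z V) (ε / (2 * σ))) ≤
      volume.real (Metric.closedBall p ε) :=
    measureReal_mono (iUnion₂_subset fun V hV => (hz V hV).trans inter_subset_right)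
      measure_closedBall_lt_top.ne
  have : Nonempty (Fin d) := ⟨⟨0, hd⟩⟩
  have e : volume.real (Metric.closedBall p ε) = volume.real (Metric.ball p ε) := by
    rw [Measure.real, Measure.real, Measure.addHaar_closedBall_eq_addHaar_ball]
  rw [h1, e, volume_real_ball hd p hε.le,
    Finset.sum_congr rfl fun V _ => volume_real_ball hd (z V) (by positivity), Finset.sum_const,
    nsmul_eq_mul, ← mul_assoc, div_pow] at h2
  have h3 := le_of_mul_le_mul_right h2 (volume_real_ball_zero_pos d)
  rw [mul_div_assoc', div_le_iff₀ (by positivity), mul_comm] at h3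
  exact le_of_mul_le_mul_left h3 (by positivity)

lemma FacetAdj.diam_le {hd : 1 ≤ d} (h2 : 2 ≤ d) (h : M.ShapeRegular σ) {p : E d}
    {V W : Finset (E d)} (hadj : M.FacetAdj hd p V W) :
    Metric.diam (cell V) ≤ σ * Metric.diam (cell W) := by
  obtain ⟨hV, hW, hp, -, i, hi, hF⟩ := hadj
  obtain ⟨q, hq, hqp, hq0⟩ := (M.frame hd hV).facet_two h2 i p hp
  exact h.diam_le_diam hd hV hp hq (hF p hp hi) (hF q hq hq0) hqp.symm

lemma walk_diam_le {hd : 1 ≤ d} (h2 : 2 ≤ d) (hσ : 0 ≤ σ) (h : M.ShapeRegular σ) {p : E d}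
    {T V : M.star p} (w : (M.starGraph hd p).Walk T V) :
    Metric.diam (cell T.1) ≤ σ ^ w.length * Metric.diam (cell V.1) := by
  induction w with
  | nil => simp
  | cons hadj w ih =>
    refine (FacetAdj.diam_le h2 h hadj).trans ?_
    rw [SimpleGraph.Walk.length_cons, pow_succ']
    nlinarith

/-- The energy density of a cell scaled with the diameter. -/
noncomputable def scaledEnergy (f : E d → ℝ) (V : Finset (E d)) : ℝ :=
  Metric.diam (cell V) ^ 2 * (∫ x in cell V, ‖∇ f x‖ ^ 2) / volume.real (cell V)

lemma walk_average_le {hd : 1 ≤ d} {f : E d → ℝ} {K : ℝ≥0} (hf : LipschitzWith K f) {B : ℝ}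
    {p : E d} {T V : M.star p} (w : (M.starGraph hd p).Walk T V)
    (hB : ∀ W, (M.starGraph hd p).Reachable T W → scaledEnergy f W.1 ≤ B) :
    |(⨍ x in cell T.1, f x) - ⨍ x in cell V.1, f x| ≤ w.length * (2 * √B) := by
  induction w with
  | nil => simp
  | @cons T U V hadj w ih =>
    have hadj' : M.FacetAdj hd p T.1 U.1 := hadj
    have hTB := hB T (SimpleGraph.Reachable.refl T)
    have hUB := hB U hadj.reachable
    have ih' := ih fun W hW => hB W (hadj.reachable.trans hW)
    obtain ⟨hT, hU, hp, hne, i, hi, hF⟩ := hadj'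
    obtain ⟨i', c, hc, hcx, hF'⟩ := CellFrame.exists_opposite_facet (M.compatible hd hT hU)
      (M.compatible hd hU hT) (M.conforming _ hT _ hU) hne hp hi hF
    have hstep := CellFrame.sq_average_sub_average_le (M.compatible hd hT hU)
      (M.compatible hd hU hT) hc hcx hF hF' hf
    have hB0 : 0 ≤ B := le_trans (by unfold scaledEnergy; positivity) hTB
    have hstep' : |(⨍ x in cell T.1, f x) - ⨍ x in cell U.1, f x| ≤ 2 * √B := by
      refine abs_le_of_sq_le_sq (hstep.trans ?_) (by positivity)
      rw [mul_pow, Real.sq_sqrt hB0]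
      unfold scaledEnergy at hTB hUB
      linarith
    rw [SimpleGraph.Walk.length_cons, Nat.cast_add, Nat.cast_one]
    calc _ ≤ _ := abs_sub_le _ (⨍ x in cell U.1, f x) _
      _ ≤ 2 * √B + w.length * (2 * √B) := add_le_add hstep' ih'
      _ = _ := by ring

/-- A path visits each cell at `p` at most once, so its length is bounded by their number. -/
lemma exists_walk_length_le {hd : 1 ≤ d} (h : M.ShapeRegular σ) (hσ : 0 < σ) {p : E d}
    {T V : M.star p} (hr : (M.starGraph hd p).Reachable T V) :
    ∃ w : (M.starGraph hd p).Walk T V, w.length ≤ ⌊(2 * σ) ^ d⌋₊ := by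
  classical
  obtain ⟨w, hw⟩ := hr.exists_isPath
  refine ⟨w, hw.length_lt.le.trans ?_⟩
  rw [Fintype.card_coe]
  exact Nat.le_floor (h.card_star_le hd hσ p)

/-- Volumes and diameters of the cells which can be reached from a given one are comparable. -/
lemma volume_mul_scaledEnergy_le {hd : 1 ≤ d} (h : M.ShapeRegular σ) (hσ : 1 ≤ σ) {p : E d}
    {T V : M.star p} (hr : (M.starGraph hd p).Reachable T V) (f : E d → ℝ) :
    volume.real (cell T.1) * scaledEnergy f V.1 ≤
      (2 * σ) ^ d * σ ^ (d * ⌊(2 * σ) ^ d⌋₊) * M.size ^ 2 * ∫ x in cell V.1, ‖∇ f x‖ ^ 2 := by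
  have hσ0 : 0 < σ := by linarith
  obtain ⟨w, hw⟩ := exists_walk_length_le h hσ0 hr
  have hT := (M.mem_star.1 T.2).1
  have hV := (M.mem_star.1 V.2).1
  have hG : 0 ≤ ∫ x in cell V.1, ‖∇ f x‖ ^ 2 := integral_nonneg fun x => by positivity
  have h1 := volume_real_cell_le hd (M.frame hd hT).nonempty
  have h2 := h.le_volume_real hd hσ0 hV
  have hω := volume_real_ball_zero_pos d
  have hDT := diam_cell_pos hd hT
  have hDV := diam_cell_pos hd hV
  have hTs := M.diam_le_size hT
  have hVs := M.diam_le_size hV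
  have hvol := (M.frame hd hV).volume_real_pos
  set DT := Metric.diam (cell T.1)
  set DV := Metric.diam (cell V.1) with hDVdef
  set G := ∫ x in cell V.1, ‖∇ f x‖ ^ 2
  set n := ⌊(2 * σ) ^ d⌋₊
  have h3 : volume.real (cell T.1) * DV ^ d ≤ (2 * σ) ^ d * DT ^ d * volume.real (cell V.1) := by
    rw [div_pow, div_mul_eq_mul_div, div_le_iff₀ (by positivity)] at h2
    calc _ ≤ DT ^ d * volume.real (Metric.ball (0 : E d) 1) * DV ^ d := by gcongr
      _ = DT ^ d * (DV ^ d * volume.real (Metric.ball (0 : E d) 1)) := by ring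
      _ ≤ DT ^ d * (volume.real (cell V.1) * (2 * σ) ^ d) := by gcongr
      _ = _ := by ring
  have h4 : DT ^ d * DV ^ 2 ≤ σ ^ (d * n) * M.size ^ 2 * DV ^ d := by
    -- Adjacent intervals may have unrelated lengths. For `d = 1` this is harmless: `DT` appears
    -- only to the first power and is bounded by the mesh size, as is one factor `DV`. For `d ≥ 2`
    -- diameters along the chain are comparable.
    rcases hd.eq_or_lt with rfl | hd2
    · rw [pow_one, pow_one, one_mul]
      have h5 : DT * DV ≤ M.size ^ 2 := by
        have hsz : 0 ≤ M.size := hDT.le.trans hTs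
        rw [sq]; gcongr
      have h6 : (1 : ℝ) ≤ σ ^ n := one_le_pow₀ hσ
      calc DT * DV ^ 2 = (DT * DV) * DV := by ring
        _ ≤ (M.size ^ 2) * DV := by gcongr
        _ ≤ (σ ^ n * M.size ^ 2) * DV := by
          gcongr
          exact le_mul_of_one_le_left (sq_nonneg _) h6
    · have h5 : DT ≤ σ ^ n * DV := by
        refine (walk_diam_le hd2 hσ0.le h w).trans ?_
        rw [← hDVdef]
        gcongr
      calc DT ^ d * DV ^ 2 ≤ (σ ^ n * DV) ^ d * M.size ^ 2 := by gcongr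
        _ = _ := by rw [mul_pow, ← pow_mul, mul_comm n d]; ring
  have h7 : volume.real (cell T.1) * DV ^ 2 ≤
      (2 * σ) ^ d * (σ ^ (d * n) * M.size ^ 2) * volume.real (cell V.1) := by
    have hp : 0 < DV ^ d := by positivity
    refine le_of_mul_le_mul_right ?_ hp
    calc _ = (volume.real (cell T.1) * DV ^ d) * DV ^ 2 := by ring
      _ ≤ ((2 * σ) ^ d * DT ^ d * volume.real (cell V.1)) * DV ^ 2 := by gcongr
      _ = (2 * σ) ^ d * volume.real (cell V.1) * (DT ^ d * DV ^ 2) := by ring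
      _ ≤ (2 * σ) ^ d * volume.real (cell V.1) * (σ ^ (d * n) * M.size ^ 2 * DV ^ d) := by gcongr
      _ = _ := by ring
  unfold scaledEnergy
  rw [mul_div_assoc', div_le_iff₀ hvol]
  calc _ = (volume.real (cell T.1) * DV ^ 2) * G := by ring
    _ ≤ ((2 * σ) ^ d * (σ ^ (d * n) * M.size ^ 2) * volume.real (cell V.1)) * G := by gcongr
    _ = _ := by ring

/-- The projection minus the mean is a polynomial, and by the Pythagorean identity its mean square
is at most that of `f` minus its mean. The inverse estimate and the Poincaré inequality contribute
`276 * 4 ^ d` and `2 ^ d`. -/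
lemma abs_localProj_sub_average_le (hd : 1 ≤ d) (hd3 : d ≤ 3) {f q : E d → ℝ} {K : ℝ≥0}
    (hf : LipschitzWith K f) {V : Finset (E d)} (hV : V ∈ M.cells) (hq : IsLocalProj k V f q)
    {p : E d} (hp : p ∈ V) {B : ℝ} (hB : scaledEnergy f V ≤ B) :
    |q p - ⨍ x in cell V, f x| ≤ √(276 * 8 ^ d) * √B := by
  have hvol := (M.frame hd hV).volume_real_pos
  set m := ⨍ x in cell V, f x
  have hm : (fun _ => m) ∈ polySub k d := const_mem_polySub k d m
  have h1 := inverse_estimate hd3 ((polySub k d).sub_mem hq.1 hm) (isCompact_cell V) (convex_cell V)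
    (subset_cell V hp)
  have h2 := hq.integral_sq_eq hf.continuous hm
  have h3 := integral_sub_average_sq_le hf (isCompact_cell V) (convex_cell V)
    (M.frame hd hV).volume_pos
  have h4 : 0 ≤ ∫ x in cell V, (f x - q x) ^ 2 := integral_nonneg fun x => sq_nonneg _
  simp only [Pi.sub_apply] at h1
  have h5 : (q p - m) ^ 2 ≤ 276 * 8 ^ d * B := by
    have e : (8 : ℝ) ^ d = 4 ^ d * 2 ^ d := by rw [← mul_pow]; norm_num
    refine le_trans ?_ (mul_le_mul_of_nonneg_left hB (by positivity))
    unfold scaledEnergy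
    rw [mul_div_assoc', le_div_iff₀ hvol, mul_comm]
    refine h1.trans ?_
    calc _ ≤ 276 * 4 ^ d * (2 ^ d * Metric.diam (cell V) ^ 2 * ∫ x in cell V, ‖∇ f x‖ ^ 2) := by
          gcongr
          linarith
      _ = _ := by rw [e]; ring
  rw [← Real.sqrt_mul (by positivity)]
  exact Real.abs_le_sqrt h5

/-- The nodal values of the local projections of a function with vanishing quasi-interpolant. -/
lemma abs_localProj_le (hd : 1 ≤ d) (hd3 : d ≤ 3) (h : M.ShapeRegular σ) (hσ : 1 ≤ σ)
    {f : E d → ℝ} {K : ℝ≥0} (hf : LipschitzWith K f) (hf0 : ∀ x, x ∉ M.domain → f x = 0)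
    {Q : Finset (E d) → E d → ℝ} (hQ : ∀ V ∈ M.cells, IsLocalProj k V f (Q V))
    (hQ0 : ∀ p ∈ M.nodes, ∑ V ∈ M.star p, Q V p = 0) {T : Finset (E d)} (hT : T ∈ M.cells)
    {p : E d} (hp : p ∈ T) {B : ℝ}
    (hB : ∀ W, (M.starGraph hd p).Reachable ⟨T, M.mem_star.2 ⟨hT, hp⟩⟩ W →
      scaledEnergy f W.1 ≤ B) :
    |Q T p| ≤ (2 * √(276 * 8 ^ d) + 2 * (2 * σ) ^ d + 1) * √B := by
  have hσ0 : 0 < σ := by linarith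
  set T' : M.star p := ⟨T, M.mem_star.2 ⟨hT, hp⟩⟩ with hT'
  set κ := √(276 * 8 ^ d)
  have hTB := abs_localProj_sub_average_le hd hd3 hf hT (hQ T hT) hp
    (hB T' (SimpleGraph.Reachable.refl _))
  have hchain : ∀ W, (M.starGraph hd p).Reachable T' W →
      |(⨍ x in cell T, f x) - ⨍ x in cell W.1, f x| ≤ (2 * σ) ^ d * (2 * √B) := by
    intro W hW
    obtain ⟨w, hw⟩ := exists_walk_length_le h hσ0 hW
    refine (walk_average_le hf w hB).trans ?_
    gcongr
    exact (Nat.cast_le.2 hw).trans (Nat.floor_le (by positivity))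
  have hκ : 0 ≤ κ * √B := by positivity
  -- With a free facet the chain ends at a cell whose mean is small by the boundary condition.
  -- Otherwise `p` is an interior vertex and all cells at `p` are comparable with `T`.
  rcases M.reachable_hasFreeFacet_or hd T' with ⟨V, hr, hV, i, -, hu⟩ | ⟨hpd, hall⟩
  · have h1 := (M.frame hd hV).sq_average_le_of_facet hf i fun x hx0 hxp =>
      hf0 x (M.notMem_domain_of_unshared hd hV hu hx0 hxp)
    have hVB : scaledEnergy f V.1 ≤ B := hB V hr
    have h2 : |⨍ x in cell V.1, f x| ≤ √B := Real.abs_le_sqrt (h1.trans hVB)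
    have h3 := hchain V hr
    have e : Q T p = (Q T p - ⨍ x in cell T, f x) +
      ((⨍ x in cell T, f x) - ⨍ x in cell V.1, f x) + ⨍ x in cell V.1, f x := by ring
    rw [e]
    refine (abs_add_three _ _ _).trans ?_
    linarith
  · have hnode : p ∈ M.nodes := ⟨hpd, T, hT, hp⟩
    have hpair : ∀ W ∈ M.star p, |Q T p - Q W p| ≤ 2 * κ * √B + (2 * σ) ^ d * (2 * √B) := by
      intro W hW
      have h1 := abs_localProj_sub_average_le hd hd3 hf (M.mem_star.1 hW).1
        (hQ W (M.mem_star.1 hW).1) (M.mem_star.1 hW).2 (hB ⟨W, hW⟩ (hall _))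
      have h2 := hchain ⟨W, hW⟩ (hall _)
      have e : Q T p - Q W p = (Q T p - ⨍ x in cell T, f x) +
        ((⨍ x in cell T, f x) - ⨍ x in cell W, f x) - (Q W p - ⨍ x in cell W, f x) := by ring
      rw [e]
      refine (abs_sub _ _).trans ((add_le_add (abs_add_le _ _) le_rfl).trans ?_)
      linarith
    have hcard : (0 : ℝ) < (M.star p).card := by
      exact_mod_cast Finset.card_pos.2 ⟨T, M.mem_star.2 ⟨hT, hp⟩⟩
    -- Since the nodal values at `p` sum to zero, `Q T p` is the average of its differences to the
    -- other values.
    have hsum : (M.star p).card * Q T p = ∑ W ∈ M.star p, (Q T p - Q W p) := by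
      rw [Finset.sum_sub_distrib, hQ0 p hnode]
      simp
    have h1 : (M.star p).card * |Q T p| ≤
        (M.star p).card * (2 * κ * √B + (2 * σ) ^ d * (2 * √B)) := by
      rw [← abs_of_pos hcard, ← abs_mul, abs_of_pos hcard, hsum]
      refine (Finset.abs_sum_le_sum_abs _ _).trans ((Finset.sum_le_sum hpair).trans ?_)
      rw [Finset.sum_const, nsmul_eq_mul]
    have h2 := le_of_mul_le_mul_left h1 hcard
    have h3 : 0 ≤ √B := by positivity
    linarith

/-- Finite overlap: exchanging the two cells that share `p` shows that `G W` is counted once for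
each vertex of `W` and each cell at that vertex. -/
lemma sum_cells_sum_star_le (hd : 1 ≤ d) (h : M.ShapeRegular σ) (hσ : 0 < σ)
    {G : Finset (E d) → ℝ} (hG : ∀ V, 0 ≤ G V) :
    ∑ T ∈ M.cells, ∑ p ∈ T, ∑ W ∈ M.star p, G W ≤ 2 ^ d * (2 * σ) ^ d * ∑ W ∈ M.cells, G W := by
  classical
  have e : ∑ T ∈ M.cells, ∑ p ∈ T, ∑ W ∈ M.star p, G W =
      ∑ W ∈ M.cells, ∑ p ∈ W, ∑ _T ∈ M.star p, G W := by
    set P : Finset (E d) := M.cells.biUnion id with hP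
    have h1 : ∀ T ∈ M.cells, ∀ g : E d → ℝ, ∑ p ∈ T, g p = ∑ p ∈ P, if p ∈ T then g p else 0 := by
      intro T hT g
      rw [← Finset.sum_filter]
      congr 1
      ext p
      rw [Finset.mem_filter]
      exact ⟨fun hp => ⟨Finset.mem_biUnion.2 ⟨T, hT, hp⟩, hp⟩, fun hp => hp.2⟩
    have h2 : ∀ p (g : Finset (E d) → ℝ), ∑ W ∈ M.star p, g W =
        ∑ W ∈ M.cells, if p ∈ W then g W else 0 := by
      intro p g
      rw [← Finset.sum_filter]
      refine Finset.sum_congr ?_ fun _ _ => rfl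
      ext W
      rw [M.mem_star, Finset.mem_filter]
    rw [Finset.sum_congr rfl fun T hT => h1 T hT _, Finset.sum_comm,
      Finset.sum_congr rfl fun W hW => h1 W hW _,
      Finset.sum_comm (s := M.cells) (t := P) (f := fun W p => if p ∈ W then _ else _)]
    refine Finset.sum_congr rfl fun p _ => ?_
    simp only [h2, ← Finset.sum_filter]
    rw [Finset.sum_comm]
  rw [e, Finset.mul_sum]
  refine Finset.sum_le_sum fun W hW => ?_
  calc ∑ p ∈ W, ∑ _T ∈ M.star p, G W ≤ ∑ p ∈ W, (2 * σ) ^ d * G W := by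
        refine Finset.sum_le_sum fun p _ => ?_
        rw [Finset.sum_const, nsmul_eq_mul]
        exact mul_le_mul_of_nonneg_right (h.card_star_le hd hσ p) (hG W)
    _ = (W.card : ℝ) * ((2 * σ) ^ d * G W) := by rw [Finset.sum_const, nsmul_eq_mul]
    _ ≤ 2 ^ d * ((2 * σ) ^ d * G W) := by
        have hc : (W.card : ℝ) ≤ 2 ^ d := by exact_mod_cast (M.frame hd hW).card_le
        exact mul_le_mul_of_nonneg_right hc (mul_nonneg (by positivity) (hG W))
    _ = _ := by ring

/-- Inside the cell `q x` is a convex combination of nodal values, with the nodal basis functions as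
weights. -/
lemma integral_sq_polySub_le (hd : 1 ≤ d) {V : Finset (E d)} (hV : V ∈ M.cells) {q : E d → ℝ}
    (hq : q ∈ polySub k d) :
    ∫ x in cell V, q x ^ 2 ≤ volume.real (cell V) * ∑ p ∈ V, q p ^ 2 := by
  have hqc := continuous_of_mem_polySub hq
  have hb : ∀ x ∈ cell V, q x ^ 2 ≤ ∑ p ∈ V, q p ^ 2 := by
    intro x hx
    have hφ : ∀ p ∈ V, 0 ≤ (M.frame hd hV).shape p x := fun p _ =>
      (M.frame hd hV).shape_nonneg hx p
    have h1 := Finset.sum_sq_le_sum_mul_sum_of_sq_le_mul V (r := fun p =>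
      q p * (M.frame hd hV).shape p x) (f := fun p => (M.frame hd hV).shape p x)
      (g := fun p => q p ^ 2 * (M.frame hd hV).shape p x) hφ
      (fun p hp => mul_nonneg (sq_nonneg _) (hφ p hp)) (fun p _ => le_of_eq (by ring))
    rw [(M.frame hd hV).sum_shape, one_mul, ← (M.frame hd hV).repr_shape hq] at h1
    refine h1.trans (Finset.sum_le_sum fun p hp => ?_)
    refine mul_le_of_le_one_right (sq_nonneg _) ?_
    rw [← (M.frame hd hV).sum_shape x]
    exact Finset.single_le_sum hφ hp
  calc ∫ x in cell V, q x ^ 2 ≤ ∫ x in cell V, ∑ p ∈ V, q p ^ 2 :=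
        setIntegral_mono_on (integrableOn_cell (by fun_prop)) (integrableOn_cell continuous_const)
          (isClosed_cell V).measurableSet hb
    _ = _ := by simp

/-- The Poincaré inequality for functions with vanishing quasi-interpolant, with a constant that
depends only on the dimension and the shape regularity. -/
theorem integral_sq_le_of_quasiInterp_zero (hd : 1 ≤ d) (hd3 : d ≤ 3) (hσ : 1 ≤ σ)
    (h : M.ShapeRegular σ) {f : E d → ℝ} {K : ℝ≥0} (hf : LipschitzWith K f)
    (hf0 : ∀ x, x ∉ M.domain → f x = 0)
    {Q : Finset (E d) → E d → ℝ} (hQ : ∀ V ∈ M.cells, IsLocalProj k V f (Q V))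
    (hQ0 : ∀ p ∈ M.nodes, ∑ V ∈ M.star p, Q V p = 0) :
    ∫ x in M.domain, f x ^ 2 ≤
      (2 * 2 ^ d + 2 * (2 * √(276 * 8 ^ d) + 2 * (2 * σ) ^ d + 1) ^ 2 *
        ((2 * σ) ^ d * σ ^ (d * ⌊(2 * σ) ^ d⌋₊)) * (2 ^ d * (2 * σ) ^ d)) *
        M.size ^ 2 * ∫ x in M.domain, ‖∇ f x‖ ^ 2 := by
  classical
  have hσ0 : 0 < σ := by linarith
  have hfc := hf.continuous
  set c₃ := (2 * σ) ^ d * σ ^ (d * ⌊(2 * σ) ^ d⌋₊) with hc₃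
  set κ := 2 * √(276 * 8 ^ d) + 2 * (2 * σ) ^ d + 1 with hκ
  let G : Finset (E d) → ℝ := fun V => ∫ x in cell V, ‖∇ f x‖ ^ 2
  have hG : ∀ V, 0 ≤ G V := fun V => integral_nonneg fun x => by positivity
  have hcell : ∀ T ∈ M.cells, ∫ x in cell T, f x ^ 2 ≤ 2 * 2 ^ d * M.size ^ 2 * G T +
      2 * κ ^ 2 * c₃ * M.size ^ 2 * ∑ p ∈ T, ∑ W ∈ M.star p, G W := by
    intro T hT
    have hvol := (M.frame hd hT).volume_real_pos
    have hqT : Q T ∈ polySub k d := (hQ T hT).1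
    have hqc := continuous_of_mem_polySub hqT
    have hnode : ∀ p ∈ T, volume.real (cell T) * Q T p ^ 2 ≤
        κ ^ 2 * c₃ * M.size ^ 2 * ∑ W ∈ M.star p, G W := by
      intro p hp
      set Γ := ∑ W ∈ M.star p, G W
      have hΓ : 0 ≤ Γ := Finset.sum_nonneg fun W _ => hG W
      -- The bound `B` is normalized by the volume of `T`, so that this volume cancels when the
      -- nodal values are turned into an integral over `T`.
      have hb := abs_localProj_le hd hd3 h hσ hf hf0 hQ hQ0 hT hp
        (B := c₃ * M.size ^ 2 * Γ / volume.real (cell T)) (fun W hW => by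
          rw [le_div_iff₀ hvol, mul_comm]
          refine (volume_mul_scaledEnergy_le h hσ hW f).trans ?_
          gcongr
          exact Finset.single_le_sum (fun W _ => hG W) W.2)
      have h2 := pow_le_pow_left₀ (abs_nonneg _) hb 2
      rw [sq_abs, mul_pow, Real.sq_sqrt (by positivity), mul_div_assoc', le_div_iff₀ hvol,
        mul_comm] at h2
      linarith
    have h1 := (hQ T hT).integral_sq_eq hfc
      (const_mem_polySub k d (⨍ y in cell T, f y))
    have h2 := integral_sub_average_sq_le hf (isCompact_cell T) (convex_cell T)
      (M.frame hd hT).volume_pos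
    have h3 : 0 ≤ ∫ x in cell T, (Q T x - ⨍ y in cell T, f y) ^ 2 :=
      integral_nonneg fun x => sq_nonneg _
    have h4 : 2 ^ d * Metric.diam (cell T) ^ 2 * G T ≤ 2 ^ d * M.size ^ 2 * G T := by
      have := M.diam_le_size hT
      have := hG T
      gcongr
    have h5 := integral_sq_polySub_le hd hT hqT
    have h6 : ∫ x in cell T, f x ^ 2 ≤
        2 * (∫ x in cell T, (f x - Q T x) ^ 2) + 2 * ∫ x in cell T, Q T x ^ 2 := by
      rw [← integral_const_mul, ← integral_const_mul, ← integral_add]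
      · refine setIntegral_mono (integrableOn_cell (by fun_prop)) (integrableOn_cell (by fun_prop))
          fun x => ?_
        simp only
        nlinarith [sq_nonneg (f x - 2 * Q T x)]
      · exact integrableOn_cell (by fun_prop)
      · exact integrableOn_cell (by fun_prop)
    have h7 : volume.real (cell T) * ∑ p ∈ T, Q T p ^ 2 ≤
        κ ^ 2 * c₃ * M.size ^ 2 * ∑ p ∈ T, ∑ W ∈ M.star p, G W := by
      rw [Finset.mul_sum, Finset.mul_sum]
      exact Finset.sum_le_sum hnode
    have h8 : ∫ x in cell T, (f x - ⨍ y in cell T, f y) ^ 2 ≤ 2 ^ d * M.size ^ 2 * G T :=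
      h2.trans h4
    linarith
  have hf2 : IntegrableOn (fun x => f x ^ 2) M.domain :=
    ((hfc.pow 2).continuousOn.integrableOn_compact
      (M.cells.finite_toSet.isCompact_biUnion fun V _ => isCompact_cell V)).mono_set
      interior_subset
  rw [integral_domain_eq_sum hd hf2,
    integral_domain_eq_sum hd (integrableOn_norm_gradient_sq hf M.volume_domain_lt_top)]
  have hsum := sum_cells_sum_star_le hd h hσ0 hG
  calc ∑ V ∈ M.cells, ∫ x in cell V, f x ^ 2
      ≤ ∑ T ∈ M.cells, (2 * 2 ^ d * M.size ^ 2 * G T +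
        2 * κ ^ 2 * c₃ * M.size ^ 2 * ∑ p ∈ T, ∑ W ∈ M.star p, G W) := Finset.sum_le_sum hcell
    _ = 2 * 2 ^ d * M.size ^ 2 * ∑ T ∈ M.cells, G T + 2 * κ ^ 2 * c₃ * M.size ^ 2 *
        ∑ T ∈ M.cells, ∑ p ∈ T, ∑ W ∈ M.star p, G W := by
        rw [Finset.sum_add_distrib, Finset.mul_sum, Finset.mul_sum]
    _ ≤ 2 * 2 ^ d * M.size ^ 2 * ∑ T ∈ M.cells, G T + 2 * κ ^ 2 * c₃ * M.size ^ 2 *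
        (2 ^ d * (2 * σ) ^ d * ∑ W ∈ M.cells, G W) := by gcongr
    _ = _ := by ring

end Mesh

end LOD

/-! ### Galerkin problems for symmetric nondegenerate forms -/

namespace LOD

open Set Filter Topology
open scoped ENNReal NNReal

section BilinearForms

variable {F : Type*} [AddCommGroup F] [Module ℝ F]

/-- `B` is bilinear and symmetric on the subspace `X`. -/
structure IsSymmBilinOn (X : Submodule ℝ F) (B : F → F → ℝ) : Prop where
  add_left : ∀ x ∈ X, ∀ y ∈ X, ∀ z ∈ X, B (x + y) z = B x z + B y z
  smul_left : ∀ (c : ℝ), ∀ x ∈ X, ∀ z ∈ X, B (c • x) z = c * B x z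
  symm : ∀ x ∈ X, ∀ y ∈ X, B x y = B y x

/-- `l` is linear on the subspace `X`. -/
structure IsLinOn (X : Submodule ℝ F) (l : F → ℝ) : Prop where
  add : ∀ x ∈ X, ∀ y ∈ X, l (x + y) = l x + l y
  smul : ∀ (c : ℝ), ∀ x ∈ X, l (c • x) = c * l x

/-- `B` is nondegenerate on the subspace `X`. -/
def NondegOn (X : Submodule ℝ F) (B : F → F → ℝ) : Prop :=
  ∀ x ∈ X, (∀ y ∈ X, B x y = 0) → x = 0

variable {X N W : Submodule ℝ F} {B : F → F → ℝ} {l : F → ℝ}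

lemma IsSymmBilinOn.mono (hB : IsSymmBilinOn X B) (h : N ≤ X) : IsSymmBilinOn N B :=
  ⟨fun x hx y hy z hz => hB.add_left x (h hx) y (h hy) z (h hz),
    fun c x hx z hz => hB.smul_left c x (h hx) z (h hz),
    fun x hx y hy => hB.symm x (h hx) y (h hy)⟩

lemma IsLinOn.mono (hl : IsLinOn X l) (h : N ≤ X) : IsLinOn N l :=
  ⟨fun x hx y hy => hl.add x (h hx) y (h hy), fun c x hx => hl.smul c x (h hx)⟩

lemma IsSymmBilinOn.isLinOn (hB : IsSymmBilinOn X B) {x : F} (hx : x ∈ X) : IsLinOn X (B x) :=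
  ⟨fun y hy z hz => by
    rw [hB.symm x hx _ (X.add_mem hy hz), hB.add_left y hy z hz x hx, hB.symm y hy x hx,
      hB.symm z hz x hx],
   fun c y hy => by
    rw [hB.symm x hx _ (X.smul_mem c hy), hB.smul_left c y hy x hx, hB.symm y hy x hx]⟩

lemma IsSymmBilinOn.sub_left (hB : IsSymmBilinOn X B) {x y z : F} (hx : x ∈ X) (hy : y ∈ X)
    (hz : z ∈ X) : B (x - y) z = B x z - B y z := by
  have h := hB.add_left (x - y) (X.sub_mem hx hy) y hy z hz
  rw [sub_add_cancel] at h
  linarith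

/-- Nondegeneracy makes the map into the dual injective, hence bijective in finite dimension; no
definiteness is needed. -/
lemma existsUnique_of_nondegOn [FiniteDimensional ℝ X] (hB : IsSymmBilinOn X B)
    (hN : NondegOn X B) (hl : IsLinOn X l) : ∃! x, x ∈ X ∧ ∀ y ∈ X, B x y = l y := by
  let Φ : X →ₗ[ℝ] Module.Dual ℝ X := LinearMap.mk₂ ℝ (fun x y => B x y)
    (fun x y z => hB.add_left x x.2 y y.2 z z.2) (fun c x z => hB.smul_left c x x.2 z z.2)
    (fun x y z => (hB.isLinOn x.2).add y y.2 z z.2) (fun c x y => (hB.isLinOn x.2).smul c y y.2)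
  have hinj : Function.Injective Φ := by
    rw [injective_iff_map_eq_zero]
    intro x hx
    exact Subtype.ext (hN x x.2 fun y hy => LinearMap.congr_fun hx ⟨y, hy⟩)
  let L : Module.Dual ℝ X :=
    { toFun := fun y => l y
      map_add' := fun x y => hl.add x x.2 y y.2
      map_smul' := fun c x => hl.smul c x x.2 }
  obtain ⟨x, hx⟩ := (LinearMap.injective_iff_surjective_of_finrank_eq_finrank
    Subspace.dual_finrank_eq.symm).1 hinj L
  refine ⟨x, ⟨x.2, fun y hy => LinearMap.congr_fun hx ⟨y, hy⟩⟩, ?_⟩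
  rintro x' ⟨hx', h'⟩
  refine sub_eq_zero.1 (hN _ (X.sub_mem hx' x.2) fun y hy => ?_)
  rw [hB.sub_left hx' x.2 hy, h' y hy]
  exact sub_eq_zero.2 (LinearMap.congr_fun hx ⟨y, hy⟩).symm

/-- The elements of `X` that are `B`-orthogonal to `N`. -/
def orthSet (X N : Submodule ℝ F) (B : F → F → ℝ) : Set F := {v | v ∈ X ∧ ∀ w ∈ N, B v w = 0}

/-- `c` is the `B`-orthogonal projection of `v` onto `N`. -/
def IsOrthProj (N : Submodule ℝ F) (B : F → F → ℝ) (v c : F) : Prop :=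
  c ∈ N ∧ ∀ w ∈ N, B c w = B v w

lemma existsUnique_isOrthProj [FiniteDimensional ℝ X] (hB : IsSymmBilinOn X B) (hN : N ≤ X)
    (hNB : NondegOn N B) {v : F} (hv : v ∈ X) : ∃! c, IsOrthProj N B v c := by
  have : FiniteDimensional ℝ N := Submodule.finiteDimensional_of_le hN
  exact existsUnique_of_nondegOn (hB.mono hN) hNB ((hB.isLinOn hv).mono hN)

lemma IsOrthProj.sub_mem (hB : IsSymmBilinOn X B) (hN : N ≤ X) {v c : F} (hv : v ∈ X)
    (hc : IsOrthProj N B v c) : v - c ∈ orthSet X N B :=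
  ⟨X.sub_mem hv (hN hc.1), fun w hw => by
    rw [hB.sub_left hv (hN hc.1) (hN hw), hc.2 w hw, sub_self]⟩

/-- For `u` orthogonal to `N` choose `w ∈ W` with `u - w ∈ N`. Then `w - u` lies in `N` and
represents `B w` there, so it is the projection of `w`, and `u = w - (w - u)`. -/
lemma orthSet_eq (hB : IsSymmBilinOn X B) (hN : N ≤ X)
    (hW : W ≤ X) (hWN : ∀ v ∈ X, ∃ w ∈ W, v - w ∈ N) :
    orthSet X N B = {u | ∃ v ∈ W, ∃ c, IsOrthProj N B v c ∧ u = v - c} := by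
  ext u
  constructor
  · rintro ⟨hu, hu0⟩
    obtain ⟨w, hw, hn⟩ := hWN u hu
    refine ⟨w, hw, w - u, ⟨by simpa using N.neg_mem hn, fun z hz => ?_⟩, by abel⟩
    rw [hB.sub_left (hW hw) hu (hN hz), hu0 z hz, sub_zero]
  · rintro ⟨v, hv, c, hc, rfl⟩
    exact hc.sub_mem hB hN (hW hv)

/-- The solution is the one in `X` minus its projection onto `N`. For uniqueness, the difference of
two solutions is orthogonal to `N` and to its complement, which together span `X`. -/
lemma existsUnique_orthSet [FiniteDimensional ℝ X] (hB : IsSymmBilinOn X B) (hXB : NondegOn X B)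
    (hN : N ≤ X) (hNB : NondegOn N B) (hl : IsLinOn X l) :
    ∃! u, u ∈ orthSet X N B ∧ ∀ w ∈ orthSet X N B, B u w = l w := by
  obtain ⟨u, ⟨hu, hul⟩, -⟩ := existsUnique_of_nondegOn hB hXB hl
  obtain ⟨c, hc, -⟩ := existsUnique_isOrthProj hB hN hNB hu
  have hcX := hN hc.1
  refine ⟨u - c, ⟨hc.sub_mem hB hN hu, fun w hw => ?_⟩, ?_⟩
  · rw [hB.sub_left hu hcX hw.1, hul w hw.1, hB.symm c hcX w hw.1, hw.2 c hc.1, sub_zero]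
  · rintro u' ⟨hu', hu'l⟩
    have hms := hc.sub_mem hB hN hu
    have hd : u' - (u - c) ∈ X := X.sub_mem hu'.1 hms.1
    refine sub_eq_zero.1 (hXB _ hd fun x hx => ?_)
    obtain ⟨e, he, -⟩ := existsUnique_isOrthProj hB hN hNB hx
    have heX := hN he.1
    have hxe := he.sub_mem hB hN hx
    have h1 : B (u' - (u - c)) (x - e) = 0 := by
      rw [hB.sub_left hu'.1 hms.1 hxe.1, hu'l _ hxe, hB.sub_left hu hcX hxe.1, hul _ hxe.1,
        hB.symm c hcX _ hxe.1, hxe.2 c hc.1]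
      ring
    have h2 : B (u' - (u - c)) e = 0 := by
      rw [hB.sub_left hu'.1 hms.1 heX, hu'.2 e he.1, hms.2 e he.1, sub_zero]
    have h3 := (hB.isLinOn hd).add _ hxe.1 _ heX
    rw [sub_add_cancel] at h3
    rw [h3, h1, h2, add_zero]

/-- The difference of the Galerkin solutions in `X` and in the `B`-orthogonal complement of `N` is
the Galerkin solution in `N`. -/
lemma sub_isGalerkin [FiniteDimensional ℝ X] (hB : IsSymmBilinOn X B) (hXB : NondegOn X B)
    (hN : N ≤ X) (hNB : NondegOn N B) (hl : IsLinOn X l) {u u' : F} (hu : u ∈ X)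
    (hul : ∀ w ∈ X, B u w = l w) (hu' : u' ∈ orthSet X N B)
    (hu'l : ∀ w ∈ orthSet X N B, B u' w = l w) :
    u - u' ∈ N ∧ ∀ w ∈ N, B (u - u') w = l w := by
  obtain ⟨c, hc, -⟩ := existsUnique_isOrthProj hB hN hNB hu
  have hcX := hN hc.1
  have h : u' = u - c := (existsUnique_orthSet hB hXB hN hNB hl).unique ⟨hu', hu'l⟩
    ⟨hc.sub_mem hB hN hu, fun w hw => by
      rw [hB.sub_left hu hcX hw.1, hul w hw.1, hB.symm c hcX w hw.1, hw.2 c hc.1, sub_zero]⟩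
  rw [h, sub_sub_cancel]
  exact ⟨hc.1, fun w hw => by rw [hc.2 w hw, hul w (hN hw)]⟩

end BilinearForms

end LOD

/-! ### The energy form -/

namespace LOD

open Set Filter Topology
open scoped ENNReal NNReal

section Gradient

variable {d : ℕ} {f g : E d → ℝ} {K L : ℝ≥0}

lemma gradient_add_ae (hf : LipschitzWith K f) (hg : LipschitzWith L g) :
    ∀ᵐ x, ∇ (f + g) x = ∇ f x + ∇ g x := by
  filter_upwards [hf.ae_differentiableAt, hg.ae_differentiableAt] with x h1 h2
  simp only [gradient]
  rw [fderiv_add h1 h2, map_add]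

lemma gradient_smul_ae (hf : LipschitzWith K f) (c : ℝ) :
    ∀ᵐ x, ∇ (c • f) x = c • ∇ f x := by
  filter_upwards [hf.ae_differentiableAt] with x h1
  simp only [gradient]
  rw [fderiv_const_smul h1, map_smulₛₗ]
  rfl

/-- A Lipschitz function whose gradient vanishes almost everywhere is constant. -/
lemma eq_of_gradient_ae_eq_zero (hf : LipschitzWith K f) (h : ∀ᵐ x, ∇ f x = 0) (x y : E d) :
    f x = f y := by
  set D : Set (E d) := Metric.closedBall 0 (max ‖x‖ ‖y‖ + 1)
  have hr : 0 < max ‖x‖ ‖y‖ + 1 := by positivity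
  have hD0 : volume D ≠ 0 := (Metric.measure_closedBall_pos volume 0 hr).ne'
  have hDc : IsCompact D := isCompact_closedBall _ _
  have h1 := integral_sub_average_sq_le hf hDc (convex_closedBall _ _) hD0
  have h2 : ∫ z in D, ‖∇ f z‖ ^ 2 = 0 := by
    refine integral_eq_zero_of_ae ?_
    filter_upwards [ae_restrict_of_ae h] with z hz
    simp [hz]
  rw [h2, mul_zero] at h1
  have hfc := hf.continuous
  set m := ⨍ z in D, f z
  have h3 : ∫ z in D, (f z - m) ^ 2 = 0 := le_antisymm h1 (integral_nonneg fun z => sq_nonneg _)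
  have hint : IntegrableOn (fun z => (f z - m) ^ 2) D :=
    ((hfc.sub continuous_const).pow 2).continuousOn.integrableOn_compact hDc
  rw [integral_eq_zero_iff_of_nonneg (fun z => sq_nonneg _) hint] at h3
  have h4 : (fun z => (f z - m) ^ 2) =ᵐ[volume.restrict (Metric.ball 0 (max ‖x‖ ‖y‖ + 1))] 0 :=
    ae_restrict_of_ae_restrict_of_subset Metric.ball_subset_closedBall h3
  have h5 := Measure.eqOn_open_of_ae_eq h4 Metric.isOpen_ball (by fun_prop) continuousOn_const
  have h6 : ∀ z, ‖z‖ ≤ max ‖x‖ ‖y‖ → f z = m := by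
    intro z hz
    have h7 := h5 (mem_ball_zero_iff.2 (by linarith : ‖z‖ < max ‖x‖ ‖y‖ + 1))
    exact sub_eq_zero.1 (pow_eq_zero_iff two_ne_zero |>.1 h7)
  rw [h6 x (le_max_left _ _), h6 y (le_max_right _ _)]

lemma memLp_gradient_apply (hf : LipschitzWith K f) {Ω : Set (E d)} (hΩ : volume Ω ≠ ⊤)
    (i : Fin d) : MemLp (fun x => (∇ f x).ofLp i) ⊤ (volume.restrict Ω) := by
  have : IsFiniteMeasure (volume.restrict Ω) := isFiniteMeasure_restrict.2 hΩ
  refine MemLp.of_bound ?_ K (Eventually.of_forall fun x => ?_)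
  · have h := measurable_gradient f
    exact (by fun_prop : Measurable fun x => (∇ f x).ofLp i).aestronglyMeasurable
  · exact (PiLp.norm_apply_le (∇ f x) i).trans (norm_gradient_le hf x)

end Gradient

lemma mul_norm_sq_le_of_spectrum {d : ℕ} {A : Matrix (Fin d) (Fin d) ℝ} {α : ℝ} (hA : A.IsSymm)
    (h : ∀ μ ∈ spectrum ℝ A, α ≤ μ) (ξ : E d) : α * ‖ξ‖ ^ 2 ≤ (A *ᵥ ξ.ofLp) ⬝ᵥ ξ.ofLp := by
  have hpsd : (A - algebraMap ℝ _ α).PosSemidef := by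
    rw [Matrix.posSemidef_iff_isHermitian_and_spectrum_nonneg]
    constructor
    · refine Matrix.IsHermitian.sub ?_ ?_
      · rw [Matrix.IsHermitian, Matrix.conjTranspose_eq_transpose_of_trivial]
        exact hA
      · rw [Matrix.IsHermitian, Algebra.algebraMap_eq_smul_one]
        simp
    · rw [← spectrum.sub_singleton_eq]
      rintro _ ⟨μ, hμ, _, rfl, rfl⟩
      exact sub_nonneg.2 (h μ hμ)
  have h1 := hpsd.dotProduct_mulVec_nonneg ξ.ofLp
  rw [Matrix.sub_mulVec, dotProduct_sub, Algebra.algebraMap_eq_smul_one, Matrix.smul_mulVec,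
    Matrix.one_mulVec, dotProduct_smul] at h1
  have h2 : ‖ξ‖ ^ 2 = ξ.ofLp ⬝ᵥ ξ.ofLp := by
    rw [EuclideanSpace.real_norm_sq_eq, dotProduct]
    exact Finset.sum_congr rfl fun i _ => sq _
  rw [h2, dotProduct_comm (A *ᵥ _)]
  simp only [star_trivial, smul_eq_mul] at h1
  linarith

section Energy

variable {d : ℕ} {Ω : Set (E d)} {A : E d → Matrix (Fin d) (Fin d) ℝ} {α β : ℝ}
  {u v w : E d → ℝ} {K L J : ℝ≥0}

lemma IsDiffusion.integrable (hA : IsDiffusion Ω A α β) (hΩ : volume Ω ≠ ⊤)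
    (hu : LipschitzWith K u) (hv : LipschitzWith L v) :
    Integrable (fun x => (A x *ᵥ (∇ u x).ofLp) ⬝ᵥ (∇ v x).ofLp) (volume.restrict Ω) := by
  have : IsFiniteMeasure (volume.restrict Ω) := isFiniteMeasure_restrict.2 hΩ
  have h : MemLp (fun x => ∑ i, (∑ j, A x i j * (∇ u x).ofLp j) * (∇ v x).ofLp i) ⊤
      (volume.restrict Ω) := by
    refine memLp_finsetSum _ fun i _ => ?_
    refine MemLp.mul (p := ⊤) (q := ⊤) (memLp_gradient_apply hv hΩ i) ?_
    exact memLp_finsetSum _ fun j _ =>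
      MemLp.mul (p := ⊤) (q := ⊤) (memLp_gradient_apply hu hΩ j) (hA.memLp i j)
  exact h.integrable le_top

lemma IsDiffusion.energy_add_left (hA : IsDiffusion Ω A α β) (hΩ : volume Ω ≠ ⊤)
    (hu : LipschitzWith K u) (hv : LipschitzWith L v) (hw : LipschitzWith J w) :
    energy Ω A (u + v) w = energy Ω A u w + energy Ω A v w := by
  unfold energy
  rw [← integral_add (hA.integrable hΩ hu hw) (hA.integrable hΩ hv hw)]
  refine integral_congr_ae ?_
  filter_upwards [ae_restrict_of_ae (gradient_add_ae hu hv)] with x hx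
  rw [hx, WithLp.ofLp_add, Matrix.mulVec_add, add_dotProduct]

lemma energy_smul_left (hu : LipschitzWith K u) (c : ℝ) :
    energy Ω A (c • u) w = c * energy Ω A u w := by
  unfold energy
  rw [← integral_const_mul]
  refine integral_congr_ae ?_
  filter_upwards [ae_restrict_of_ae (gradient_smul_ae hu c)] with x hx
  rw [hx, WithLp.ofLp_smul, Matrix.mulVec_smul, smul_dotProduct, smul_eq_mul]

lemma IsDiffusion.energy_symm (hA : IsDiffusion Ω A α β) (u v : E d → ℝ) :
    energy Ω A u v = energy Ω A v u := by
  refine integral_congr_ae ?_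
  filter_upwards [hA.symm] with x hx
  rw [dotProduct_comm, Matrix.dotProduct_mulVec, ← Matrix.mulVec_transpose, hx.eq]

lemma IsDiffusion.mul_integral_le_energy (hA : IsDiffusion Ω A α β) (hΩ : volume Ω ≠ ⊤)
    (hu : LipschitzWith K u) : α * ∫ x in Ω, ‖∇ u x‖ ^ 2 ≤ energy Ω A u u := by
  rw [← integral_const_mul]
  refine integral_mono_ae ((integrableOn_norm_gradient_sq hu hΩ).const_mul α)
    (hA.integrable hΩ hu hu) ?_
  filter_upwards [hA.symm, hA.spec] with x h1 h2
  exact mul_norm_sq_le_of_spectrum h1 (fun μ hμ => (h2 μ hμ).1) _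

lemma IsDiffusion.energy_nonneg (hA : IsDiffusion Ω A α β) (hα : 0 < α) (hΩ : volume Ω ≠ ⊤)
    (hu : LipschitzWith K u) : 0 ≤ energy Ω A u u :=
  (mul_nonneg hα.le (integral_nonneg fun x => by positivity)).trans
    (hA.mul_integral_le_energy hΩ hu)

end Energy

namespace Mesh

variable {k : ElementKind} {d : ℕ} {M : Mesh k d} {A : E d → Matrix (Fin d) (Fin d) ℝ} {α β : ℝ}
  {v : E d → ℝ}

/-- The gradient vanishes almost everywhere in the domain, and also outside, where `v` is zero; what
is left is covered by boundaries of cells and is null. So `v` is constant on the whole space and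
vanishes somewhere, the domain being bounded. Connectedness is not needed. -/
lemma eq_zero_of_energy_eq_zero (hd : 1 ≤ d) (hA : IsDiffusion M.domain A α β) (hα : 0 < α)
    (hv : v ∈ M.feSpace) (h : energy M.domain A v v = 0) : v = 0 := by
  obtain ⟨K, hK⟩ := M.exists_lipschitzWith hv
  have hΩ := M.volume_domain_lt_top
  have h1 := hA.mul_integral_le_energy hΩ hK
  rw [h] at h1
  have h2 : ∫ x in M.domain, ‖∇ v x‖ ^ 2 = 0 :=
    le_antisymm (nonpos_of_mul_nonpos_right h1 hα) (integral_nonneg fun x => by positivity)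
  rw [integral_eq_zero_iff_of_nonneg (fun x => by positivity)
    (integrableOn_norm_gradient_sq hK hΩ)] at h2
  have h3 := (ae_restrict_iff' M.isOpen_domain.measurableSet).1 h2
  have hcl : IsClosed (⋃ V ∈ M.cells, cell V) :=
    M.cells.finite_toSet.isClosed_biUnion fun V _ => isClosed_cell V
  have hnull : ∀ᵐ x, x ∈ ⋃ V ∈ M.cells, cell V → x ∈ M.domain := by
    have hi : ∀ᵐ x, ∀ V ∈ M.cells, x ∈ cell V → x ∈ interior (cell V) := by
      refine (ae_ball_iff M.cells.countable_toSet).2 fun V _ => ?_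
      filter_upwards [(interior_cell_ae_eq V).mem_iff] with x hx using hx.2
    filter_upwards [hi] with x hx hxc
    obtain ⟨V, hV, hxV⟩ := mem_iUnion₂.1 hxc
    exact interior_mono (subset_biUnion_of_mem (u := fun V => cell V) hV) (hx V hV hxV)
  have h4 : ∀ᵐ x, ∇ v x = 0 := by
    filter_upwards [h3, hnull] with x hx hxn
    by_cases hxc : x ∈ ⋃ V ∈ M.cells, cell V
    · have := hx (hxn hxc)
      simpa using this
    · have hev : v =ᶠ[𝓝 x] fun _ => 0 := by
        filter_upwards [hcl.isOpen_compl.mem_nhds hxc] with y hy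
        exact hv.2.2 y fun hyd => hy (interior_subset hyd)
      rw [hev.gradient_eq, gradient_fun_const]
  have hbdd : Bornology.IsBounded M.domain :=
    (M.cells.finite_toSet.isCompact_biUnion fun V _ => isCompact_cell V).isBounded.subset
      interior_subset
  have : Nonempty (Fin d) := ⟨⟨0, hd⟩⟩
  obtain ⟨y, hy⟩ : ∃ y, y ∉ M.domain := by
    by_contra! hall
    exact NormedSpace.unbounded_univ ℝ (E d) (hbdd.subset fun x _ => hall x)
  ext x
  rw [eq_of_gradient_ae_eq_zero hK h4 x y, hv.2.2 y hy, Pi.zero_apply]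

end Mesh

end LOD

/-! ### Existence of local projections and the kernel of the quasi-interpolation -/

namespace LOD

open Set Filter Topology
open scoped ENNReal NNReal

section LocalProj

variable {k : ElementKind} {d : ℕ} {V : Finset (E d)} {v w q r : E d → ℝ}

lemma CellFrame.finiteDimensional_polySub (F : CellFrame k V) :
    FiniteDimensional ℝ (polySub k d) := by
  let φ : polySub k d →ₗ[ℝ] (V → ℝ) :=
    { toFun := fun q p => (q : E d → ℝ) p
      map_add' := fun _ _ => rfl
      map_smul' := fun _ _ => rfl }
  refine FiniteDimensional.of_injective φ ((injective_iff_map_eq_zero φ).2 fun q hq => ?_)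
  ext x
  rw [F.repr_shape q.2 x]
  refine Finset.sum_eq_zero fun p hp => ?_
  rw [show (q : E d → ℝ) p = 0 from congrFun hq ⟨p, hp⟩, zero_mul]

/-- The `L²` product on the cell is nondegenerate on polynomials, because by the inverse estimate
zero mean square forces all nodal values to vanish. -/
lemma CellFrame.exists_isLocalProj (F : CellFrame k V) (hd3 : d ≤ 3) (hv : Continuous v) :
    ∃ q, IsLocalProj k V v q := by
  have := F.finiteDimensional_polySub
  have hint : ∀ {f g : E d → ℝ}, Continuous f → Continuous g →
      IntegrableOn (fun x => f x * g x) (cell V) := fun hf hg => integrableOn_cell (hf.mul hg)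
  have hc : ∀ {q}, q ∈ polySub k d → Continuous q := fun hq => continuous_of_mem_polySub hq
  have hB : IsSymmBilinOn (polySub k d) fun q r => ∫ x in cell V, q x * r x := by
    refine ⟨fun x hx y hy z hz => ?_, fun c x _ z _ => ?_, fun x _ y _ => ?_⟩
    · rw [← integral_add (hint (hc hx) (hc hz)) (hint (hc hy) (hc hz))]
      simp only [Pi.add_apply, add_mul]
    · rw [← integral_const_mul]
      simp only [Pi.smul_apply, smul_eq_mul, mul_assoc]
    · simp only [mul_comm]
  have hN : NondegOn (polySub k d) fun q r => ∫ x in cell V, q x * r x := by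
    intro q hq h
    ext x
    rw [F.repr_shape hq x]
    refine Finset.sum_eq_zero fun p hp => ?_
    have h1 := inverse_estimate hd3 hq (isCompact_cell V) (convex_cell V) (subset_cell V hp)
    have h2 := h q hq
    simp only [← sq] at h2
    rw [h2, mul_zero] at h1
    have h3 := nonpos_of_mul_nonpos_right h1 F.volume_real_pos
    rw [pow_eq_zero_iff two_ne_zero |>.1 (le_antisymm h3 (sq_nonneg _)), zero_mul]
  have hl : IsLinOn (polySub k d) fun r => ∫ x in cell V, v x * r x := by
    refine ⟨fun x hx y hy => ?_, fun c x _ => ?_⟩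
    · rw [← integral_add (hint hv (hc hx)) (hint hv (hc hy))]
      simp only [Pi.add_apply, mul_add]
    · rw [← integral_const_mul]
      simp only [Pi.smul_apply, smul_eq_mul, mul_left_comm]
  obtain ⟨q, ⟨hq, hql⟩, -⟩ := existsUnique_of_nondegOn hB hN hl
  refine ⟨q, hq, fun r hr => ?_⟩
  have h := hql r hr
  simp only [sub_mul]
  rw [integral_sub (hint hv (hc hr)) (hint (hc hq) (hc hr))]
  exact sub_eq_zero.2 h.symm

lemma IsLocalProj.continuous (h : IsLocalProj k V v q) : Continuous q :=
  continuous_of_mem_polySub h.1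

lemma IsLocalProj.add (hq : IsLocalProj k V v q) (hr : IsLocalProj k V w r) (hv : Continuous v)
    (hw : Continuous w) : IsLocalProj k V (v + w) (q + r) := by
  refine ⟨(polySub k d).add_mem hq.1 hr.1, fun s hs => ?_⟩
  have hsc : Continuous s := continuous_of_mem_polySub hs
  have h := integral_add
    (integrableOn_cell (V := V) ((hv.sub hq.continuous).mul hsc))
    (integrableOn_cell (V := V) ((hw.sub hr.continuous).mul hsc))
  simp only [Pi.mul_apply, Pi.sub_apply] at h
  rw [hq.2 s hs, hr.2 s hs, add_zero] at h
  rw [← h]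
  refine integral_congr_ae (Eventually.of_forall fun x => ?_)
  simp only [Pi.add_apply]
  ring

lemma IsLocalProj.smul (hq : IsLocalProj k V v q) (c : ℝ) : IsLocalProj k V (c • v) (c • q) := by
  refine ⟨(polySub k d).smul_mem c hq.1, fun s hs => ?_⟩
  have h := integral_const_mul c (fun x => (v x - q x) * s x) (μ := volume.restrict (cell V))
  rw [hq.2 s hs, mul_zero] at h
  rw [← h]
  refine integral_congr_ae (Eventually.of_forall fun x => ?_)
  simp only [Pi.smul_apply, smul_eq_mul]
  ring

lemma isLocalProj_self (hq : q ∈ polySub k d) (hvq : ∀ x ∈ cell V, v x = q x) :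
    IsLocalProj k V v q := by
  refine ⟨hq, fun s _ => ?_⟩
  refine setIntegral_eq_zero_of_forall_eq_zero fun x hx => ?_
  rw [hvq x hx, sub_self, zero_mul]

end LocalProj

namespace Mesh

variable {k : ElementKind} {d : ℕ} {TH Th : Mesh k d} {v : E d → ℝ}

lemma card_star_pos {M : Mesh k d} {p : E d} (hp : p ∈ M.nodes) : (0 : ℝ) < (M.star p).card := by
  obtain ⟨-, V, hV, hpV⟩ := hp
  exact_mod_cast Finset.card_pos.2 ⟨V, M.mem_star.2 ⟨hV, hpV⟩⟩

/-- At an interior vertex the number of cells is positive, so the average may be replaced by the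
sum, which makes the condition visibly linear. -/
lemma mem_kernelSpace_iff : v ∈ kernelSpace TH Th ↔ v ∈ Th.feSub ∧
    ∃ Q : Finset (E d) → E d → ℝ, (∀ V ∈ TH.cells, IsLocalProj k V v (Q V)) ∧
      ∀ p ∈ TH.nodes, ∑ V ∈ TH.star p, Q V p = 0 := by
  rw [kernelSpace, Set.mem_ofPred_eq, mem_feSub, IsQuasiInterp]
  refine and_congr_right fun _ => ⟨?_, ?_⟩
  · rintro ⟨-, Q, hQ, h⟩
    refine ⟨Q, hQ, fun p hp => ?_⟩
    have h1 := h p hp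
    rw [Pi.zero_apply, zero_eq_mul] at h1
    exact h1.resolve_left (one_div_pos.2 (card_star_pos hp)).ne'
  · rintro ⟨Q, hQ, h⟩
    refine ⟨TH.feSub.zero_mem, Q, hQ, fun p hp => ?_⟩
    rw [h p hp, mul_zero, Pi.zero_apply]

/-- The kernel of the quasi-interpolation in the fine finite element space, as a subspace. -/
def kernelSub (TH Th : Mesh k d) : Submodule ℝ (E d → ℝ) where
  carrier := kernelSpace TH Th
  zero_mem' := mem_kernelSpace_iff.2 ⟨Th.feSub.zero_mem, fun _ => 0,
    fun V _ => isLocalProj_self (polySub k d).zero_mem fun _ _ => rfl,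
    fun _ _ => Finset.sum_const_zero⟩
  add_mem' := by
    intro v w hv hw
    obtain ⟨hv, P, hP, hP0⟩ := mem_kernelSpace_iff.1 hv
    obtain ⟨hw, Q, hQ, hQ0⟩ := mem_kernelSpace_iff.1 hw
    refine mem_kernelSpace_iff.2 ⟨Th.feSub.add_mem hv hw, fun V => P V + Q V,
      fun V hV => (hP V hV).add (hQ V hV) hv.1 hw.1, fun p hp => ?_⟩
    simp only [Pi.add_apply, Finset.sum_add_distrib, hP0 p hp, hQ0 p hp, add_zero]
  smul_mem' := by
    intro c v hv
    obtain ⟨hv, P, hP, hP0⟩ := mem_kernelSpace_iff.1 hv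
    refine mem_kernelSpace_iff.2 ⟨Th.feSub.smul_mem c hv, fun V => c • P V,
      fun V hV => (hP V hV).smul c, fun p hp => ?_⟩
    simp only [Pi.smul_apply, smul_eq_mul, ← Finset.mul_sum, hP0 p hp, mul_zero]

lemma kernelSub_le : kernelSub TH Th ≤ Th.feSub := fun _ hv => hv.1

/-- Each fine function is the sum of a coarse function and a function in the kernel of the
quasi-interpolation. -/
lemma exists_sub_mem_kernelSub (hd : 1 ≤ d) (hd3 : d ≤ 3) (href : Th.Refines TH)
    (hv : v ∈ Th.feSub) : ∃ w ∈ TH.feSub, v - w ∈ kernelSub TH Th := by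
  classical
  have hQ : ∀ V, ∃ q, V ∈ TH.cells → IsLocalProj k V v q := by
    intro V
    by_cases hV : V ∈ TH.cells
    · obtain ⟨q, hq⟩ := (TH.frame hd hV).exists_isLocalProj hd3 hv.1
      exact ⟨q, fun _ => hq⟩
    · exact ⟨0, fun h => absurd h hV⟩
  choose Q hQ using hQ
  -- `w` is the quasi-interpolant of `v`. On each coarse cell `w` is its own local projection, so
  -- the projections of `v - w` sum to zero at each interior vertex.
  obtain ⟨w, hw, hwp⟩ := TH.exists_feSpace_nodal hd
    fun p => ((TH.star p).card : ℝ)⁻¹ * ∑ V ∈ TH.star p, Q V p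
  have hw' : ∀ V, ∃ q, V ∈ TH.cells → q ∈ polySub k d ∧ ∀ x ∈ cell V, w x = q x := by
    intro V
    by_cases hV : V ∈ TH.cells
    · obtain ⟨q, hq⟩ := hw.2.1 V hV
      exact ⟨q, fun _ => hq⟩
    · exact ⟨0, fun h => absurd h hV⟩
  choose P hP using hw'
  refine ⟨w, hw, mem_kernelSpace_iff.2 ⟨Th.feSub.sub_mem hv (href.feSpace_subset hw),
    fun V => Q V + (-1 : ℝ) • P V, fun V hV => ?_, fun p hp => ?_⟩⟩
  · have h := (hQ V hV).add ((isLocalProj_self (hP V hV).1 (hP V hV).2).smul (-1)) hv.1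
      (hw.1.const_smul _)
    rwa [neg_one_smul, ← sub_eq_add_neg] at h
  · have h1 : ∀ V ∈ TH.star p, (Q V + (-1 : ℝ) • P V) p = Q V p - w p := by
      intro V hV
      obtain ⟨hV, hpV⟩ := TH.mem_star.1 hV
      rw [(hP V hV).2 p (subset_cell V hpV)]
      simp [sub_eq_add_neg]
    rw [Finset.sum_congr rfl h1, Finset.sum_sub_distrib, Finset.sum_const, nsmul_eq_mul, hwp p hp,
      mul_inv_cancel_left₀ (card_star_pos hp).ne', sub_self]

end Mesh

end LOD

/-! ### The optimality system and the error estimate -/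

namespace LOD

open Set Filter Topology
open scoped ENNReal NNReal

namespace Mesh

variable {k : ElementKind} {d : ℕ} {TH Th M : Mesh k d} {A : E d → Matrix (Fin d) (Fin d) ℝ}
  {α β : ℝ} {v w : E d → ℝ} {yd : E d → ℝ}

lemma memLp_of_mem_feSub (hv : v ∈ M.feSub) : MemLp v 2 (volume.restrict M.domain) := by
  have hK : IsCompact (⋃ V ∈ M.cells, cell V) :=
    M.cells.finite_toSet.isCompact_biUnion fun V _ => isCompact_cell V
  have : IsFiniteMeasure (volume.restrict M.domain) :=
    isFiniteMeasure_restrict.2 M.volume_domain_lt_top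
  obtain ⟨C, hC⟩ := hK.exists_bound_of_continuousOn hv.1.continuousOn
  refine MemLp.of_bound hv.1.aestronglyMeasurable C ?_
  exact (ae_restrict_iff' M.isOpen_domain.measurableSet).2
    (Eventually.of_forall fun x hx => hC x (interior_subset hx))

lemma integrable_mul (hv : MemLp v 2 (volume.restrict M.domain)) (hw : w ∈ M.feSub) :
    Integrable (fun x => v x * w x) (volume.restrict M.domain) :=
  hv.integrable_mul (memLp_of_mem_feSub hw)

lemma isSymmBilinOn_energy (hA : IsDiffusion M.domain A α β) :
    IsSymmBilinOn M.feSub (energy M.domain A) := by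
  refine ⟨fun x hx y hy z hz => ?_, fun c x hx z _ => ?_, fun x _ y _ => hA.energy_symm x y⟩
  · obtain ⟨_, h1⟩ := M.exists_lipschitzWith hx
    obtain ⟨_, h2⟩ := M.exists_lipschitzWith hy
    obtain ⟨_, h3⟩ := M.exists_lipschitzWith hz
    exact hA.energy_add_left M.volume_domain_lt_top h1 h2 h3
  · obtain ⟨_, h1⟩ := M.exists_lipschitzWith hx
    exact energy_smul_left h1 c

lemma isLinOn_integral_mul (hv : MemLp v 2 (volume.restrict M.domain)) :
    IsLinOn M.feSub fun w => ∫ x in M.domain, v x * w x := by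
  refine ⟨fun x hx y hy => ?_, fun c x _ => ?_⟩
  · rw [← integral_add (integrable_mul hv hx) (integrable_mul hv hy)]
    simp only [Pi.add_apply, mul_add]
  · rw [← integral_const_mul]
    simp only [Pi.smul_apply, smul_eq_mul, mul_left_comm]

lemma integral_mul_comm (Ω : Set (E d)) (v w : E d → ℝ) :
    ∫ x in Ω, v x * w x = ∫ x in Ω, w x * v x := by
  simp only [mul_comm]

lemma isSymmBilinOn_kktForm (hA : IsDiffusion M.domain A α β) :
    IsSymmBilinOn (M.feSub.prod M.feSub) (kktForm M.domain A) := by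
  have hE := isSymmBilinOn_energy hA
  have hl : ∀ {v}, v ∈ M.feSub → IsLinOn M.feSub fun w => ∫ x in M.domain, w x * v x := by
    intro v hv
    simp only [fun w => integral_mul_comm M.domain w v]
    exact isLinOn_integral_mul (memLp_of_mem_feSub hv)
  refine ⟨fun x hx y hy z hz => ?_, fun c x hx z hz => ?_, fun x hx y hy => ?_⟩
  · simp only [kktForm, Prod.fst_add, Prod.snd_add]
    rw [hE.add_left _ hx.1 _ hy.1 _ hz.1, hE.add_left _ hx.2 _ hy.2 _ hz.2,
      (hl hz.1).add _ hx.2 _ hy.2, (hl hz.2).add _ hx.1 _ hy.1]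
    ring
  · simp only [kktForm, Prod.smul_fst, Prod.smul_snd]
    rw [hE.smul_left c _ hx.1 _ hz.1, hE.smul_left c _ hx.2 _ hz.2,
      (hl hz.1).smul c _ hx.2, (hl hz.2).smul c _ hx.1]
    ring
  · simp only [kktForm]
    rw [hE.symm _ hx.1 _ hy.1, hE.symm _ hx.2 _ hy.2, integral_mul_comm _ x.2, integral_mul_comm _ x.1]
    ring

/-- Testing with `(p, -y)` turns the form of the optimality system into the energy norm. -/
lemma kktForm_reflect (hA : IsDiffusion M.domain A α β) {u : (E d → ℝ) × (E d → ℝ)}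
    (hu : u ∈ M.feSub.prod M.feSub) :
    kktForm M.domain A u (u.1, -u.2) = energy M.domain A u.1 u.1 + energy M.domain A u.2 u.2 := by
  have h1 := ((isSymmBilinOn_energy hA).isLinOn hu.2).smul (-1) _ hu.2
  have h2 := (isLinOn_integral_mul (memLp_of_mem_feSub hu.1)).smul (-1) _ hu.2
  rw [neg_one_smul] at h1 h2
  simp only [kktForm]
  rw [h1, h2, integral_mul_comm _ u.2]
  ring

lemma energy_nonneg (hA : IsDiffusion M.domain A α β) (hα : 0 < α) (hv : v ∈ M.feSub) :
    0 ≤ energy M.domain A v v := by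
  obtain ⟨_, h⟩ := M.exists_lipschitzWith hv
  exact hA.energy_nonneg hα M.volume_domain_lt_top h

/-- `S × S` contains `(p, -y)` along with `(p, y)`, and testing with it gives the sum of the two
energies, which is definite on the finite element space. -/
lemma nondegOn_kktForm (hd : 1 ≤ d) (hA : IsDiffusion M.domain A α β) (hα : 0 < α)
    {S : Submodule ℝ (E d → ℝ)} (hS : S ≤ M.feSub) :
    NondegOn (S.prod S) (kktForm M.domain A) := by
  intro u hu h
  have hu1 := hS hu.1
  have hu2 := hS hu.2
  have h1 := h (u.1, -u.2) ⟨hu.1, S.neg_mem hu.2⟩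
  rw [kktForm_reflect hA ⟨hu1, hu2⟩] at h1
  have h2 := energy_nonneg hA hα hu1
  have h3 := energy_nonneg hA hα hu2
  exact Prod.ext (eq_zero_of_energy_eq_zero hd hA hα hu1 (by linarith))
    (eq_zero_of_energy_eq_zero hd hA hα hu2 (by linarith))

/-- The constant in the Poincaré inequality for functions with vanishing quasi-interpolant. -/
noncomputable def poincareConst (d : ℕ) (σ : ℝ) : ℝ :=
  2 * 2 ^ d + 2 * (2 * √(276 * 8 ^ d) + 2 * (2 * σ) ^ d + 1) ^ 2 *
    ((2 * σ) ^ d * σ ^ (d * ⌊(2 * σ) ^ d⌋₊)) * (2 ^ d * (2 * σ) ^ d)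

lemma size_nonneg (M : Mesh k d) : 0 ≤ M.size :=
  Real.sSup_nonneg (by rintro _ ⟨V, -, rfl⟩; exact Metric.diam_nonneg)

lemma sqrt_integral_sq_le_of_mem_kernelSub {σ : ℝ} (hd : 1 ≤ d) (hd3 : d ≤ 3) (hσ : 1 ≤ σ)
    (h : TH.ShapeRegular σ) (href : Th.Refines TH) (hA : IsDiffusion TH.domain A α β) (hα : 0 < α)
    (hv : v ∈ kernelSub TH Th) :
    √(∫ x in TH.domain, v x ^ 2) ≤
      √(poincareConst d σ) / √α * TH.size * √(energy TH.domain A v v) := by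
  obtain ⟨hvh, Q, hQ, hQ0⟩ := mem_kernelSpace_iff.1 hv
  obtain ⟨K, hK⟩ := Th.exists_lipschitzWith hvh
  have h1 := integral_sq_le_of_quasiInterp_zero hd hd3 hσ h hK
    (fun x hx => hvh.2.2 x (by rwa [href.1])) hQ hQ0
  have h2 := hA.mul_integral_le_energy TH.volume_domain_lt_top hK
  have hc : 0 ≤ poincareConst d σ := by unfold poincareConst; positivity
  rw [← Real.sqrt_div hc, ← Real.sqrt_sq TH.size_nonneg, ← Real.sqrt_mul (by positivity),
    ← Real.sqrt_mul (by positivity)]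
  refine Real.sqrt_le_sqrt (h1.trans ?_)
  have h3 : ∫ x in TH.domain, ‖∇ v x‖ ^ 2 ≤ energy TH.domain A v v / α := by
    rw [le_div_iff₀ hα]
    linarith
  calc _ ≤ poincareConst d σ * TH.size ^ 2 * (energy TH.domain A v v / α) :=
        mul_le_mul_of_nonneg_left h3 (by positivity)
    _ = _ := by ring

lemma integral_mul_le_sqrt (hyd : MemLp yd 2 (volume.restrict M.domain)) (hv : v ∈ M.feSub) :
    ∫ x in M.domain, yd x * v x ≤
      √(∫ x in M.domain, yd x ^ 2) * √(∫ x in M.domain, v x ^ 2) := by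
  have h := integral_mul_le_Lp_mul_Lq_of_nonneg Real.HolderConjugate.two_two
    (μ := volume.restrict M.domain) (f := fun x => |yd x|) (g := fun x => |v x|)
    (Eventually.of_forall fun x => abs_nonneg _) (Eventually.of_forall fun x => abs_nonneg _)
    (by rw [ENNReal.ofReal_ofNat]; exact hyd.abs)
    (by rw [ENNReal.ofReal_ofNat]; exact (memLp_of_mem_feSub hv).abs)
  simp only [Real.rpow_ofNat, sq_abs, ← Real.sqrt_eq_rpow] at h
  refine le_trans (integral_mono (integrable_mul hyd hv) ?_ fun x => ?_) h
  · exact (integrable_mul hyd hv).abs.congr (Eventually.of_forall fun x => abs_mul _ _)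
  · exact (le_abs_self _).trans (abs_mul _ _).le

/-- The energy norm estimate for the Galerkin solution in the kernel of the quasi-interpolation. -/
lemma energyNorm_le {σ : ℝ} (hd : 1 ≤ d) (hd3 : d ≤ 3) (hσ : 1 ≤ σ) (h : TH.ShapeRegular σ)
    (href : Th.Refines TH) (hA : IsDiffusion Th.domain A α β) (hα : 0 < α)
    (hyd : MemLp yd 2 (volume.restrict Th.domain)) {e : (E d → ℝ) × (E d → ℝ)}
    (he : e ∈ (kernelSub TH Th).prod (kernelSub TH Th))
    (hel : ∀ w ∈ (kernelSub TH Th).prod (kernelSub TH Th),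
      kktForm Th.domain A e w = ∫ x in Th.domain, yd x * w.1 x) :
    energyNorm Th.domain A e ≤
      √(poincareConst d σ) / √α * TH.size * √(∫ x in Th.domain, yd x ^ 2) := by
  have he1 := kernelSub_le he.1
  have he2 := kernelSub_le he.2
  -- The reflected error is admissible and has the same first component, so the right-hand side
  -- involves only `e.1`.
  have h1 := hel (e.1, -e.2) ⟨he.1, (kernelSub TH Th).neg_mem he.2⟩
  rw [kktForm_reflect hA ⟨he1, he2⟩] at h1
  have h2 := integral_mul_le_sqrt hyd he1
  have h3 := sqrt_integral_sq_le_of_mem_kernelSub hd hd3 hσ h href (href.1 ▸ hA) hα he.1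
  rw [← href.1] at h3
  have hn1 := energy_nonneg hA hα he1
  have hn2 := energy_nonneg hA hα he2
  set n := energyNorm Th.domain A e with hn
  have hn0 : 0 ≤ n := Real.sqrt_nonneg _
  have h4 : n ^ 2 = energy Th.domain A e.1 e.1 + energy Th.domain A e.2 e.2 :=
    Real.sq_sqrt (add_nonneg hn1 hn2)
  have h5 : √(energy Th.domain A e.1 e.1) ≤ n := Real.sqrt_le_sqrt (by linarith)
  have hC : 0 ≤ √(poincareConst d σ) / √α * TH.size := mul_nonneg (by positivity) TH.size_nonneg
  have h6 : n * n ≤ (√(poincareConst d σ) / √α * TH.size * √(∫ x in Th.domain, yd x ^ 2)) * n := by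
    calc n * n = ∫ x in Th.domain, yd x * e.1 x := by rw [← sq, h4, h1]
      _ ≤ _ := h2
      _ ≤ √(∫ x in Th.domain, yd x ^ 2) * (√(poincareConst d σ) / √α * TH.size * n) :=
          mul_le_mul_of_nonneg_left (h3.trans (mul_le_mul_of_nonneg_left h5 hC))
            (Real.sqrt_nonneg _)
      _ = _ := by ring
  rcases hn0.eq_or_lt with h0 | h0
  · rw [← h0]
    exact mul_nonneg hC (Real.sqrt_nonneg _)
  · exact le_of_mul_le_mul_right h6 h0

end Mesh

end LOD

/-! ### The theorem -/

theorem theorem3p4 (σ : ℝ) :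
    ∃ C : ℝ, 1 ≤ C ∧
      ∀ (k : LOD.ElementKind) (d : ℕ), 1 ≤ d → d ≤ 3 →
      ∀ (TH Th : LOD.Mesh k d) (Ω : Set (LOD.E d)),
        TH.domain = Ω → TH.ShapeRegular σ → Th.Refines TH →
      ∀ (A : LOD.E d → Matrix (Fin d) (Fin d) ℝ) (α β : ℝ),
        0 < α → LOD.IsDiffusion Ω A α β →
        -- the correction operator is well defined, and the ideal multiscale space is its
        -- corrected coarse space
        (∀ v ∈ Th.feSpace ×ˢ Th.feSpace, ∃! c, LOD.IsCorrector TH Th A v c) ∧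
        LOD.msSpace TH Th A = LOD.correctedSpace TH Th A ∧
        ∀ yd : LOD.E d → ℝ, MemLp yd 2 (volume.restrict Ω) →
          (∃! u, LOD.IsGalerkin Ω A yd (Th.feSpace ×ˢ Th.feSpace) u) ∧
          (∃! u, LOD.IsGalerkin Ω A yd (LOD.msSpace TH Th A) u) ∧
          ∀ ph yh pms yms : LOD.E d → ℝ,
            LOD.IsGalerkin Ω A yd (Th.feSpace ×ˢ Th.feSpace) (ph, yh) →
            LOD.IsGalerkin Ω A yd (LOD.msSpace TH Th A) (pms, yms) →
            LOD.energyNorm Ω A ((ph, yh) - (pms, yms)) ≤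
              C / Real.sqrt α * TH.size * Real.sqrt (∫ x in Ω, yd x ^ 2) := by
  -- The Poincaré estimate is stated for a parameter at least `1`; shape regularity persists when
  -- the parameter grows.
  set s := max σ 1
  have hs : 1 ≤ s := le_max_right _ _
  -- Summing over the dimensions makes the constant independent of `d`, and the summand `1` ensures
  -- `C ≥ 1`.
  refine ⟨1 + ∑ d ∈ Finset.range 4, √(LOD.Mesh.poincareConst d s),
    le_add_of_nonneg_right (Finset.sum_nonneg fun d _ => Real.sqrt_nonneg _), ?_⟩
  intro k d hd hd3 TH Th Ω hΩ hreg href A α β hα hA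
  obtain rfl : Th.domain = Ω := href.1.trans hΩ
  have hfin := LOD.Mesh.finiteDimensional_feSub hd Th
  have hB := LOD.Mesh.isSymmBilinOn_kktForm hA
  have hXB := LOD.Mesh.nondegOn_kktForm hd hA hα (le_refl Th.feSub)
  have hK : LOD.Mesh.kernelSub TH Th ≤ Th.feSub := LOD.Mesh.kernelSub_le
  have hNB := LOD.Mesh.nondegOn_kktForm hd hA hα hK
  have hN : (LOD.Mesh.kernelSub TH Th).prod (LOD.Mesh.kernelSub TH Th) ≤
      Th.feSub.prod Th.feSub := Submodule.prod_mono hK hK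
  have hW : TH.feSub.prod TH.feSub ≤ Th.feSub.prod Th.feSub :=
    Submodule.prod_mono href.feSpace_subset href.feSpace_subset
  have hfin2 : FiniteDimensional ℝ (Th.feSub.prod Th.feSub) :=
    Module.Finite.iff_fg.2 ((Module.Finite.iff_fg.1 hfin).prod (Module.Finite.iff_fg.1 hfin))
  refine ⟨fun v hv => LOD.existsUnique_isOrthProj hB hN hNB hv, ?_, fun yd hyd => ?_⟩
  · refine LOD.orthSet_eq hB hN hW fun v hv => ?_
    obtain ⟨w₁, hw₁, h₁⟩ := LOD.Mesh.exists_sub_mem_kernelSub hd hd3 href hv.1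
    obtain ⟨w₂, hw₂, h₂⟩ := LOD.Mesh.exists_sub_mem_kernelSub hd hd3 href hv.2
    exact ⟨(w₁, w₂), ⟨hw₁, hw₂⟩, h₁, h₂⟩
  · have hl := LOD.Mesh.isLinOn_integral_mul hyd
    have hl2 : LOD.IsLinOn (Th.feSub.prod Th.feSub) fun w => ∫ x in Th.domain, yd x * w.1 x :=
      ⟨fun x hx y hy => hl.add _ hx.1 _ hy.1, fun c x hx => hl.smul c _ hx.1⟩
    refine ⟨LOD.existsUnique_of_nondegOn hB hXB hl2,
      LOD.existsUnique_orthSet hB hXB hN hNB hl2, fun ph yh pms yms hh hms => ?_⟩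
    have he := LOD.sub_isGalerkin hB hXB hN hNB hl2 hh.1 hh.2 hms.1 hms.2
    refine (LOD.Mesh.energyNorm_le hd hd3 hs (hreg.mono (le_max_left _ _)) href hA hα hyd
      he.1 he.2).trans ?_
    have hC : √(LOD.Mesh.poincareConst d s) ≤
        1 + ∑ d ∈ Finset.range 4, √(LOD.Mesh.poincareConst d s) :=
      (Finset.single_le_sum (f := fun d => √(LOD.Mesh.poincareConst d s))
        (fun d _ => Real.sqrt_nonneg _) (Finset.mem_range.2 (by omega))).trans
        (le_add_of_nonneg_left zero_le_one)
    have hsz := TH.size_nonneg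
    gcongr
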